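/- Strings are over alphabets $\{1,\dots,k\}$ and are compared lexicographically; the weight of a string is the sum of its symbols. A necklace is a string that is lexicographically smallest among its rotations. The aperiodic prefix $\mathrm{ap}(s)$ of a string $s$ is the shortest string $u$ with $s=u^j$ for some $j\ge 1$. If $\alpha_1<\alpha_2<\dots<\alpha_m$ are all necklaces of length $\ell$ over $\{1,\dots,k\}$ of weight at least $w$, let $\mathcal{G}_k(\ell,w^\uparrow)=\mathrm{ap}(\alpha_1)\,\mathrm{ap}(\alpha_2)\cdots \mathrm{ap}(\alpha_m)$. Let $\mathcal{G}_k(\ell,w_\downarrow)$ be obtained from $\mathcal{G}_k(\ell,(k\ell-w+\ell)^\uparrow)$ by replacing each symbol $x$ by $k-x+1$. Let $\mathbf{Subset}(n,t)$ be the set of $t$-element subsets of $\{1,\dots,n\}$. The difference representative of $\{s_1<s_2<\dots<s_t\}$ is the length-$t$ string $s_1,\ s_2-s_1,\ \dots,\ s_t-s_{t-1}$. A universal cycle for a finite set whose elements are represented by strings is a cyclic sequence whose length is the size of the set and which contains (positions being read modulo its length) the representative of each element exactly once as a substring. The rank of an element is the starting position, counted from $1$, of its representative in the cycle. **Theorem.**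 For all integers $1\le t\le n$, the sequence $\mathcal{G}_{n-t+1}(t,n_\downarrow)$ is a universal cycle for $\mathbf{Subset}(n,t)$ under difference representatives. Moreover, on the unit-cost random access machine (registers hold natural numbers; each assignment, addition, truncated subtraction, multiplication, halving, indirect read or write, and conditional or unconditional jump takes one step; space is measured by the number of registers): 1. there are one program and a constant $C$ such that for all $1\le t\le n$ the program, given $n$, $t$ and the difference representative of any $A\in\mathbf{Subset}(n,t)$, outputs the rank of $A$ in $\mathcal{G}_{n-t+1}(t,n_\downarrow)$ in at most $C\,n^2t^3$ steps, using at most $C\,nt^3$ registers; 2. there are one program and a constant $C$ such that for all $1\le t\le n$ the program, given $n$, $t$ and any $r$ with $1\le r\le\binom{n}{t}$, outputs the difference representative of the subset $A\in\mathbf{Subset}(n,t)$ of rank $r$ in $\mathcal{G}_{n-t+1}(t,n_\downarrow)$ in at most $C\,n^2t^4\log(n+1)$ steps, using at most $C\,nt^3$ registers. -/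

import Mathlib

namespace SubsetCycle

/-! ### Strings, necklaces and the sequences `𝒢` -/

/-- The set of all length-`n` strings over the alphabet `{1, …, k}`. -/
def strings (k n : ℕ) : Finset (List ℕ) :=
  (Fintype.piFinset fun _ : Fin n => Finset.Icc 1 k).image List.ofFn

/-- A necklace is a string that is lexicographically smallest among its rotations
(`≤` on `List ℕ` is the lexicographic order). -/
def IsNecklace (s : List ℕ) : Prop := ∀ i, i < s.length → s ≤ s.rotate i

instance : DecidablePred IsNecklace := fun s =>
  inferInstanceAs (Decidable (∀ i, i < s.length → s ≤ s.rotate i))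

/-- The aperiodic prefix of `s`: its shortest prefix `u` such that `s = u ^ j` for some `j ≥ 1`. -/
noncomputable def aperiodicPrefix (s : List ℕ) : List ℕ :=
  s.take (sInf {p : ℕ | ∃ j : ℕ, 1 ≤ j ∧ s = (List.replicate j (s.take p)).flatten})

/-- The necklaces of length `n` over `{1, …, k}` with weight (sum of the symbols) at least `w`,
listed in lexicographic order. -/
def necklacesUp (k n w : ℕ) : List (List ℕ) :=
  ((strings k n).filter fun s => w ≤ s.sum ∧ IsNecklace s).sort (· ≤ ·)

/-- `𝒢_k(n, w^↑)`: the concatenation of the aperiodic prefixes of the necklaces of length `n` over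
`{1, …, k}` with weight at least `w`, taken in lexicographic order. -/
noncomputable def grandUp (k n w : ℕ) : List ℕ :=
  ((necklacesUp k n w).map aperiodicPrefix).flatten

/-- The complement of a string over `{1, …, k}`: each symbol `x` is replaced by `k - x + 1`. -/
def comp (k : ℕ) (s : List ℕ) : List ℕ := s.map fun x => k + 1 - x

/-- `𝒢_k(n, w_↓) = comp (𝒢_k(n, (kn - w + n)^↑))`. -/
noncomputable def grandDown (k n w : ℕ) : List ℕ :=
  comp k (grandUp k n (k * n + n - w))

/-! ### Universal cycles, subsets and difference representatives -/

/-- The length-`m` substring of the cyclic sequence `U` that starts at the (0-based) position `i`;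
positions are taken modulo the length of `U`. -/
def window (U : List ℕ) (m i : ℕ) : List ℕ :=
  (List.range m).map fun j => U.getD ((i + j) % U.length) 0

/-- `s` has rank `r` in the cyclic sequence `U`: it starts at the `r`-th symbol, counted from `1`. -/
def HasRank (U s : List ℕ) (r : ℕ) : Prop :=
  1 ≤ r ∧ r ≤ U.length ∧ window U s.length (r - 1) = s

/-- `U` is a universal cycle for the finite set `S`, whose elements are represented by strings
through `rep`: the cyclic sequence `U` has length `|S|` and contains the representation of each
element of `S` exactly once as a substring. -/
def IsUniversalCycle {α : Type*} (U : List ℕ) (S : Finset α) (rep : α → List ℕ) : Prop :=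
  U.length = S.card ∧ ∀ A ∈ S, ∃! r, HasRank U (rep A) r

/-- `Subset(n, t)`: the `t`-subsets of `{1, …, n}`. -/
def tSubsets (n t : ℕ) : Finset (Finset ℕ) := (Finset.Icc 1 n).powersetCard t

/-- The difference representative `s₁, s₂ - s₁, …, s_t - s_{t-1}` of `{s₁ < s₂ < ⋯ < s_t}`. -/
def diffRep (A : Finset ℕ) : List ℕ :=
  List.zipWith (fun x y => x - y) (A.sort (· ≤ ·)) (0 :: A.sort (· ≤ ·))

/-! ### The unit-cost random access machine -/

/-- Instructions of a random access machine. Its memory consists of registers indexed by `ℕ`, each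
holding a natural number. -/
inductive Instr : Type
  /-- `R[d] := c` -/
  | const (d c : ℕ)
  /-- `R[d] := R[a]` -/
  | copy (d a : ℕ)
  /-- `R[d] := R[a] + R[b]` -/
  | add (d a b : ℕ)
  /-- `R[d] := max (R[a] - R[b]) 0` -/
  | sub (d a b : ℕ)
  /-- `R[d] := R[a] * R[b]` -/
  | mul (d a b : ℕ)
  /-- `R[d] := ⌊R[a] / 2⌋` -/
  | half (d a : ℕ)
  /-- `R[d] := R[R[a]]` -/
  | load (d a : ℕ)
  /-- `R[R[d]] := R[a]` -/
  | store (d a : ℕ)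
  /-- go to instruction number `l` -/
  | jump (l : ℕ)
  /-- if `R[a] = 0`, go to instruction number `l` -/
  | jumpZero (a l : ℕ)

/-- A program is a finite list of instructions, numbered from `0`. -/
abbrev Program : Type := List Instr

/-- A configuration: the number of the next instruction, and the contents of the registers. -/
structure Config : Type where
  pc : ℕ
  reg : ℕ → ℕ

/-- Write `v` to register `d` and proceed to the next instruction. -/
def Config.write (c : Config) (d v : ℕ) : Config :=
  ⟨c.pc + 1, Function.update c.reg d v⟩

/-- The effect of one instruction. -/
def Instr.exec : Instr → Config → Config
  | .const d v, c => c.write d v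
  | .copy d a, c => c.write d (c.reg a)
  | .add d a b, c => c.write d (c.reg a + c.reg b)
  | .sub d a b, c => c.write d (c.reg a - c.reg b)
  | .mul d a b, c => c.write d (c.reg a * c.reg b)
  | .half d a, c => c.write d (c.reg a / 2)
  | .load d a, c => c.write d (c.reg (c.reg a))
  | .store d a, c => c.write (c.reg d) (c.reg a)
  | .jump l, c => ⟨l, c.reg⟩
  | .jumpZero a l, c => ⟨if c.reg a = 0 then l else c.pc + 1, c.reg⟩

/-- The registers that an instruction reads or writes. -/
def Instr.accessed : Instr → Config → List ℕ
  | .const d _, _ => [d]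
  | .copy d a, _ => [d, a]
  | .add d a b, _ => [d, a, b]
  | .sub d a b, _ => [d, a, b]
  | .mul d a b, _ => [d, a, b]
  | .half d a, _ => [d, a]
  | .load d a, c => [d, a, c.reg a]
  | .store d a, c => [d, a, c.reg d]
  | .jump _, _ => []
  | .jumpZero a _, _ => [a]

/-- `Run P S T c c'`: in exactly `T` steps the program `P` leads from `c` to `c'`, and on the way it
reads and writes only registers with index less than `S`. -/
inductive Run (P : Program) (S : ℕ) : ℕ → Config → Config → Prop
  | refl (c : Config) : Run P S 0 c c
  | step {T : ℕ} {i : Instr} {c c' : Config} (hi : P[c.pc]? = some i)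
      (hS : ∀ a ∈ i.accessed c, a < S) (h : Run P S T (i.exec c) c') : Run P S (T + 1) c c'

/-- The initial configuration: the input occupies the first registers, all others hold `0`. -/
def initConfig (input : List ℕ) : Config := ⟨0, fun a => input.getD a 0⟩

/-- Started on `input`, the program `P` halts (leaves the range of its instructions) after `T` unit
cost steps, using only the first `S` registers (which include those of the input), and then the first
registers hold `output`. -/
def Computes (P : Program) (input output : List ℕ) (T S : ℕ) : Prop :=
  input.length ≤ S ∧ output.length ≤ S ∧
  ∃ c : Config, Run P S T (initConfig input) c ∧ P[c.pc]? = none ∧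
    (List.range output.length).map c.reg = output

end SubsetCycle

namespace SubsetCycle

/-! ### Lexicographic order on lists -/

/-! Complementing letters, x ↦ k + 1 - x with k = n - t + 1, turns difference representatives into
the `heavy` strings: length t over {1, …, k}, weight at least k(t - 1) + 1. So the combinatorial
claim concerns the windows of `grandUp`. Its length N is the sum of the periods of the heavy
necklaces, and since rotation classes partition `heavy`, this is the number of heavy strings
(`length_grandUp`). It is therefore enough that every heavy string occurs as a window; uniqueness
follows by counting (`window_bijOn`).

Occurrence rests on `take_next_eq`. Raising the end of a heavy necklace α to the letter k gives a
heavy necklace again, so the successor β of α is squeezed between the two and shares with α every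
prefix after which α is not all k. Hence each necklace other than k^t is spelled out in full from
the start of its block (`isPrefix_concatAp`), and a window starting j letters before the end of the
block of α consists of the last j letters of α and the first t - j letters of β. If j ≥ 1 is the
least rotation amount that makes x a necklace α, and x does not start with k^j, this window is x
(`window_rotate`). If x = k^j v, the block to use is that of the last necklace below v, or the end
of the cycle if there is none (`window_replicate_append`, `window_tail`).

The block of a necklace α ends at N minus the number of heavy strings all of whose rotations exceed
α (`countAbove`). Ranking thus needs j and one such count. For unranking, the necklace α at position
q satisfies α ≤ y exactly when q < N - `countAbove` y (`le_iff_lt_countAbove`), so a binary search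
for each letter finds α, and a second one finds its successor.

In complemented letters, with M = k - 1, the count concerns strings x of sum at most M all of whose
rotations are below y. A string-matching automaton for y, with an absorbing state t for texts that
reach or exceed y, decides this: x qualifies exactly when reading x leads some state c < t back to
c, and then c is unique. So the count is a number of closed walks (`closedCount_eq_countAbove`),
computed by dynamic programming with loops over start state, length, state, weight and letter, in
O(n²t³) steps. Unranking repeats this for t letters and O(log n) halvings.

The programs are written in a small loop language. `Cmd.run` shows that compiled commands are
correct and take at most `Cmd.cost` steps. As loop bounds are never reassigned, that cost is bounded
by a monomial which is read off from the syntax (`Cmd.cost_le_pow`). Short pieces of hand-written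
code move the input and the output between the low registers and the arrays. -/

theorem cons_lt_cons {x y : ℕ} {a b : List ℕ} : x :: a < y :: b ↔ x < y ∨ x = y ∧ a < b :=
  List.cons_lt_cons_iff

theorem cons_le_cons {x y : ℕ} {a b : List ℕ} : x :: a ≤ y :: b ↔ x < y ∨ x = y ∧ a ≤ b := by
  rw [← not_lt, ← not_lt, cons_lt_cons]
  by_cases h : b < a <;> simp [h] <;> omega

theorem nil_le (a : List ℕ) : [] ≤ a := by
  rw [← not_lt]
  exact List.not_lt_nil a

theorem take_le_take {a b : List ℕ} (h : a ≤ b) (m : ℕ) : a.take m ≤ b.take m := by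
  induction m generalizing a b with
  | zero => simp
  | succ m ih =>
    cases a with
    | nil => simpa using nil_le _
    | cons x a =>
      cases b with
      | nil => exact absurd h (not_le.2 (List.nil_lt_cons x a))
      | cons y b =>
        rw [cons_le_cons] at h
        simp only [List.take_succ_cons, cons_le_cons]
        rcases h with h | ⟨h, h'⟩
        · exact Or.inl h
        · exact Or.inr ⟨h, ih h'⟩

theorem lt_of_take_lt_take {a b : List ℕ} (m : ℕ) (h : a.take m < b.take m) : a < b := by
  by_contra hc
  exact absurd h (not_lt.2 (take_le_take (not_lt.1 hc) m))

theorem take_eq_of_between {a b c : List ℕ} (m : ℕ) (hab : a ≤ b) (hbc : b ≤ c)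
    (h : a.take m = c.take m) : b.take m = a.take m :=
  le_antisymm (h ▸ take_le_take hbc m) (take_le_take hab m)

theorem take_rotate {l : List ℕ} {c m : ℕ} (h : c + m ≤ l.length) :
    (l.rotate c).take m = (l.drop c).take m := by
  rw [List.rotate_eq_drop_append_take (by omega), List.take_append_of_le_length (by simp; omega)]

/-! ### Necklaces -/

theorem isNecklace_le_rotate {s : List ℕ} (hs : IsNecklace s) (i : ℕ) : s ≤ s.rotate i := by
  rcases s.eq_nil_or_concat with rfl | ⟨_, _, rfl⟩
  · simp
  · rw [← List.rotate_mod]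
    exact hs _ (Nat.mod_lt _ (by simp))

theorem isNecklace_replicate (t k : ℕ) : IsNecklace (List.replicate t k) := by
  intro i _
  simp

/-- For a rotation by 1 ≤ c ≤ f the first f - c + 1 letters decide: there s is at most its own
rotation, whose last letter is s[f], and the new rotation has k > s[f] in that place. A rotation by
c > f starts with k, while the string itself starts with s[0] ≤ s[f] < k. -/
theorem isNecklace_take_append_replicate {s : List ℕ} {k f : ℕ} (hs : IsNecklace s)
    (hf : f < s.length) (hk : s[f] < k) :
    IsNecklace (s.take f ++ List.replicate (s.length - f) k) := by
  rcases Nat.eq_zero_or_pos f with rfl | hf0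
  · simpa using isNecklace_replicate _ _
  intro c hc
  have hlen : (s.take f ++ List.replicate (s.length - f) k).length = s.length := by
    simp; omega
  rw [hlen] at hc
  rcases Nat.eq_zero_or_pos c with rfl | hc0
  · simp
  refine le_of_lt ?_
  rcases le_or_gt c f with hcf | hcf
  · apply lt_of_take_lt_take (f - c + 1)
    rw [take_rotate (by omega)]
    have e1 : (s.take f ++ List.replicate (s.length - f) k).take (f - c + 1)
        = s.take (f - c + 1) := by
      rw [List.take_append_of_le_length (by simp; omega), List.take_take]
      congr 1; omega
    have e2 : ((s.take f ++ List.replicate (s.length - f) k).drop c).take (f - c + 1)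
        = (s.take f).drop c ++ [k] := by
      rw [List.drop_append_of_le_length (by simp; omega), List.take_append]
      simp only [List.length_drop, List.length_take]
      rw [List.take_of_length_le (by simp; omega)]
      have : f - c + 1 - (min f s.length - c) = 1 := by omega
      rw [this]
      congr 1
      rw [List.take_replicate]
      have : min 1 (s.length - f) = 1 := by omega
      rw [this]; rfl
    have e3 : (s.rotate c).take (f - c + 1) = (s.take f).drop c ++ [s[f]] := by
      rw [take_rotate (by omega)]
      rw [List.drop_take, List.take_add_one]
      congr 1
      have h1 : f - c < (s.drop c).length := by simp; omega
      rw [List.getElem?_eq_getElem h1]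
      simp [Nat.add_sub_cancel' hcf]
    rw [e1, e2]
    have h1 := take_le_take (isNecklace_le_rotate hs c) (f - c + 1)
    rw [e3] at h1
    refine lt_of_le_of_lt h1 ?_
    apply List.append_left_lt
    exact cons_lt_cons.2 (Or.inl hk)
  · apply lt_of_take_lt_take 1
    rw [take_rotate (by omega)]
    have h1 := take_le_take (isNecklace_le_rotate hs f) 1
    rw [take_rotate (by omega)] at h1
    have hs0 : 0 < s.length := by omega
    have e0 : s.take 1 = [s[0]] := by
      cases s with
      | nil => simp at hs0
      | cons a l => simp
    have e1 : (s.drop f).take 1 = [s[f]] := by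
      rw [List.drop_eq_getElem_cons hf]; rfl
    rw [e0, e1] at h1
    have h2 : s[0] ≤ s[f] := by
      rw [cons_le_cons] at h1
      rcases h1 with h | h
      · exact h.le
      · exact h.1.le
    have e2 : (s.take f ++ List.replicate (s.length - f) k).take 1 = [s[0]] := by
      rw [List.take_append_of_le_length (by simp; omega), List.take_take,
        Nat.min_eq_left hf0, e0]
    have e3 : ((s.take f ++ List.replicate (s.length - f) k).drop c).take 1 = [k] := by
      rw [List.drop_append, List.drop_of_length_le (by simp; omega)]
      simp only [List.nil_append, List.length_take, List.drop_replicate, List.take_replicate]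
      have : min 1 (s.length - f - (c - min f s.length)) = 1 := by omega
      rw [this]; rfl
    rw [e2, e3]
    rw [cons_lt_cons]
    left; omega

/-- Replacing the end of a necklace by the largest letters gives a necklace. -/
theorem isNecklace_take_append_replicate' {s : List ℕ} {k m : ℕ} (hs : IsNecklace s)
    (hk : ∀ a ∈ s, a ≤ k) (hm : m ≤ s.length) :
    IsNecklace (s.take m ++ List.replicate (s.length - m) k) := by
  by_cases h : ∀ a ∈ s.drop m, a = k
  · have : s.drop m = List.replicate (s.length - m) k := by
      rw [List.eq_replicate_iff]; exact ⟨by simp, h⟩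
    rwa [← this, List.take_append_drop]
  -- The letters from position m up to the first one that differs from k are already k, so the
  -- replacement may just as well start at that later letter.
  · have hex : ∃ f, m ≤ f ∧ ∃ hf : f < s.length, s[f] ≠ k := by
      push Not at h
      obtain ⟨a, ha, hak⟩ := h
      obtain ⟨i, hi, rfl⟩ := List.getElem_of_mem ha
      refine ⟨m + i, by omega, by simp at hi; omega, ?_⟩
      simpa using hak
    classical
    obtain ⟨hmf, hf, hfk⟩ := Nat.find_spec hex
    have hmin := fun g hg => Nat.find_min hex (m := g) hg
    generalize Nat.find hex = f at *
    have := isNecklace_take_append_replicate hs hf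
      (lt_of_le_of_ne (hk _ (List.getElem_mem hf)) hfk)
    have e : s.take f = s.take m ++ List.replicate (f - m) k := by
      apply List.ext_getElem
      · simp; omega
      · intro i h1 h2
        simp only [List.length_take] at h1
        simp only [List.getElem_take, List.getElem_append, List.length_take]
        split_ifs with h3
        · rfl
        · simp only [List.getElem_replicate]
          by_contra h4
          exact hmin i (by omega) ⟨by omega, by omega, h4⟩
    rw [e, List.append_assoc, List.replicate_append_replicate] at this
    convert this using 3
    omega

theorem exists_rotate_isNecklace {s : List ℕ} (hs : s ≠ []) :
    ∃ c, c < s.length ∧ IsNecklace (s.rotate c) := by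
  have hpos : 0 < s.length := List.length_pos_iff.2 hs
  obtain ⟨c, hc, hmin⟩ := Finset.exists_min_image (Finset.range s.length) (fun c => s.rotate c)
    ⟨0, by simpa using hpos⟩
  refine ⟨c, by simpa using hc, fun i _ => ?_⟩
  rw [List.rotate_rotate, ← List.rotate_mod s (c + i)]
  exact hmin _ (by simpa using Nat.mod_lt _ hpos)

theorem IsNecklace.rotate_eq_of_isNecklace {s : List ℕ} {i j : ℕ} (hi : IsNecklace (s.rotate i))
    (hj : IsNecklace (s.rotate j)) : s.rotate i = s.rotate j := by
  have key : ∀ {i j : ℕ}, IsNecklace (s.rotate i) → s.rotate i ≤ s.rotate j := by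
    intro i j hi
    rcases eq_or_ne s [] with rfl | hs
    · simp
    have hpos : 0 < s.length := List.length_pos_iff.2 hs
    -- The multiple of the length does not affect the rotation and keeps the subtraction from
    -- truncating.
    have := isNecklace_le_rotate hi (s.length * i + j - i)
    rw [List.rotate_rotate] at this
    have e : i + (s.length * i + j - i) = s.length * i + j := by
      have : i ≤ s.length * i := Nat.le_mul_of_pos_left _ hpos
      omega
    rwa [e, ← List.rotate_rotate, List.rotate_length_mul] at this
  exact le_antisymm (key hi) (key hj)

theorem isNecklace_head_le {s : List ℕ} (hs : IsNecklace s) (h0 : 0 < s.length) {a : ℕ}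
    (ha : a ∈ s) : s[0] ≤ a := by
  obtain ⟨f, hf, rfl⟩ := List.getElem_of_mem ha
  have h1 := take_le_take (isNecklace_le_rotate hs f) 1
  rw [take_rotate (by omega)] at h1
  have e0 : s.take 1 = [s[0]] := by
    cases s with
    | nil => simp at h0
    | cons a l => simp
  have e1 : (s.drop f).take 1 = [s[f]] := by
    rw [List.drop_eq_getElem_cons hf]; rfl
  rw [e0, e1, cons_le_cons] at h1
  rcases h1 with h | h
  · exact h.le
  · exact h.1.le

/-! ### Aperiodic prefixes -/

theorem flatten_replicate_rotate (u : List ℕ) (j : ℕ) :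
    ((List.replicate j u).flatten).rotate u.length = (List.replicate j u).flatten := by
  cases j with
  | zero => simp
  | succ j =>
    rw [List.replicate_succ, List.flatten_cons, List.rotate_append_length_eq]
    have : List.replicate j u ++ [u] = u :: List.replicate j u := by
      rw [← List.replicate_succ, List.replicate_succ']
    calc (List.replicate j u).flatten ++ u = (List.replicate j u ++ [u]).flatten := by simp
      _ = _ := by rw [this]; simp

/-- Invariance under rotation by p gives s[i + p] = s[i] inside the string, so every block of length
p repeats the first one. -/
theorem eq_flatten_replicate_of_rotate {p : ℕ} (j : ℕ) {s : List ℕ} (hl : s.length = j * p)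
    (hr : s.rotate p = s) : s = (List.replicate j (s.take p)).flatten := by
  rcases Nat.eq_zero_or_pos j with rfl | hj
  · simpa using hl
  have hp : p ≤ s.length := by rw [hl]; exact Nat.le_mul_of_pos_left _ hj
  have hr' : s.drop p ++ s.take p = s := by
    rw [← List.rotate_eq_drop_append_take hp]; exact hr
  have hcyc : ∀ i (hi : i + p < s.length), s[i + p] = s[i] := by
    intro i hi
    have : (s.drop p ++ s.take p)[i]? = s[i]? := by rw [hr']
    rw [List.getElem?_append_left (by simp; omega), List.getElem?_drop,
      List.getElem?_eq_getElem (by omega), List.getElem?_eq_getElem (by omega)] at this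
    simpa [Nat.add_comm] using this
  have main : ∀ m, m ≤ j → s.take (m * p) = (List.replicate m (s.take p)).flatten := by
    intro m hm
    induction m with
    | zero => simp
    | succ m ih =>
      rw [List.replicate_succ', List.flatten_append, ← ih (by omega)]
      have hmp : m * p + p ≤ s.length := by rw [hl]; nlinarith
      have : (s.drop (m * p)).take p = s.take p := by
        apply List.ext_getElem
        · simp; omega
        · intro i h1 h2
          simp only [List.length_take, List.length_drop] at h1
          simp only [List.getElem_take, List.getElem_drop]
          clear ih h1 hm
          induction m with
          | zero => simp
          | succ m ih2 =>
            have := ih2 (by nlinarith)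
            have h4 : (m + 1) * p = m * p + p := by ring
            rw [← this (by simp at h2 ⊢; omega)]
            have h3 := hcyc (m * p + i) (by simp at h2; nlinarith)
            rw [← h3]
            congr 1; ring
      rw [Nat.succ_mul, List.take_add, this]
      simp
  have := main j le_rfl
  rw [← hl] at this
  simpa using this

/-- The length of the aperiodic prefix of a string. -/
noncomputable def period (s : List ℕ) : ℕ := (aperiodicPrefix s).length

theorem rotate_mod_minimal {s : List ℕ} {p i : ℕ} (hp : s.rotate p = s) :
    s.rotate (i % p) = s.rotate i := by
  have h : ∀ m, s.rotate (p * m) = s := by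
    intro m
    induction m with
    | zero => simp
    | succ m ih => rw [Nat.mul_succ, ← List.rotate_rotate, ih, hp]
  conv_rhs => rw [← Nat.div_add_mod i p, ← List.rotate_rotate, h]

/-- The length of the shortest root is also the least positive rotation that fixes the string: the
least such rotation divides the length, since the remainder of the length modulo it would fix the
string too, and a fixing rotation that divides the length yields a root. -/
theorem aperiodicPrefix_spec {s : List ℕ} (hs : s ≠ []) :
    0 < period s ∧ period s ≤ s.length ∧ s.rotate (period s) = s ∧
      (∀ q, 0 < q → s.rotate q = s → period s ≤ q) ∧
      aperiodicPrefix s = s.take (period s) := by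
  have hpos : 0 < s.length := List.length_pos_iff.2 hs
  set A := {p : ℕ | ∃ j : ℕ, 1 ≤ j ∧ s = (List.replicate j (s.take p)).flatten} with hA
  have hmem : s.length ∈ A := ⟨1, le_rfl, by simp⟩
  have hle : sInf A ≤ s.length := Nat.sInf_le hmem
  have hper : period s = sInf A := by
    simp only [period, aperiodicPrefix, List.length_take]
    exact Nat.min_eq_left hle
  obtain ⟨j, hj, hsj⟩ := Nat.sInf_mem ⟨_, hmem⟩
  have h0 : 0 < sInf A := by
    rcases Nat.eq_zero_or_pos (sInf A) with h | h
    · rw [h] at hsj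
      simp at hsj
      exact absurd hsj hs
    · exact h
  have hrot : s.rotate (sInf A) = s := by
    have h1 := flatten_replicate_rotate (s.take (sInf A)) j
    rw [← hsj, List.length_take, Nat.min_eq_left hle] at h1
    exact h1
  refine ⟨hper ▸ h0, hper ▸ hle, hper ▸ hrot, ?_, ?_⟩
  · classical
    have hex : ∃ q, 0 < q ∧ s.rotate q = s := ⟨_, h0, hrot⟩
    obtain ⟨hq0, hqr⟩ := Nat.find_spec hex
    have hmin := fun g hg => Nat.find_min hex (m := g) hg
    have hfle : ∀ q, 0 < q → s.rotate q = s → Nat.find hex ≤ q :=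
      fun q h1 h2 => Nat.find_min' hex ⟨h1, h2⟩
    generalize Nat.find hex = q0 at *
    have hdvd : q0 ∣ s.length := by
      by_contra hnd
      have h2 : s.rotate (s.length % q0) = s := by
        rw [rotate_mod_minimal hqr, List.rotate_length]
      exact hmin _ (Nat.mod_lt _ hq0)
        ⟨Nat.pos_of_ne_zero fun h => hnd (Nat.dvd_of_mod_eq_zero h), h2⟩
    obtain ⟨m, hm⟩ := hdvd
    have hq0A : q0 ∈ A := by
      refine ⟨m, ?_, eq_flatten_replicate_of_rotate m (by rw [hm, mul_comm]) hqr⟩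
      rcases Nat.eq_zero_or_pos m with rfl | h
      · simp at hm; exact absurd hm hs
      · exact h
    intro q h1 h2
    rw [hper]
    exact (Nat.sInf_le hq0A).trans (hfle q h1 h2)
  · rw [hper]; rfl

theorem card_rotations {s : List ℕ} (hs : s ≠ []) :
    ((Finset.range s.length).image fun c => s.rotate c).card = period s := by
  obtain ⟨h0, hle, hrot, hmin, -⟩ := aperiodicPrefix_spec hs
  have : ((Finset.range s.length).image fun c => s.rotate c)
      = (Finset.range (period s)).image fun c => s.rotate c := by
    ext x
    simp only [Finset.mem_image, Finset.mem_range]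
    constructor
    · rintro ⟨c, _, rfl⟩
      exact ⟨c % period s, Nat.mod_lt _ h0, rotate_mod_minimal hrot⟩
    · rintro ⟨c, hc, rfl⟩
      exact ⟨c, by omega, rfl⟩
  rw [this, Finset.card_image_of_injOn, Finset.card_range]
  have key : ∀ a b, a < b → b < period s → s.rotate a ≠ s.rotate b := by
    intro a b hab hb h
    have h2 : s.rotate (b - a) = s := by
      apply List.rotate_injective a
      simp only [List.rotate_rotate]
      rw [Nat.sub_add_cancel hab.le, h]
    have := hmin _ (by omega) h2
    omega
  intro a ha b hb h
  simp only [Finset.coe_range, Set.mem_Iio] at ha hb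
  rcases lt_trichotomy a b with h1 | h1 | h1
  · exact absurd h (key a b h1 hb)
  · exact h1
  · exact absurd h.symm (key b a h1 ha)

end SubsetCycle

namespace SubsetCycle

/-! ### The list of necklaces and its concatenation -/

theorem mem_strings {k t : ℕ} {x : List ℕ} :
    x ∈ strings k t ↔ x.length = t ∧ ∀ a ∈ x, 1 ≤ a ∧ a ≤ k := by
  simp only [strings, Finset.mem_image, Fintype.mem_piFinset, Finset.mem_Icc]
  constructor
  · rintro ⟨f, hf, rfl⟩
    refine ⟨by simp, fun a ha => ?_⟩
    obtain ⟨i, rfl⟩ := (List.mem_ofFn' f a).1 ha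
    exact hf i
  · rintro ⟨rfl, h⟩
    exact ⟨x.get, fun i => h _ (List.get_mem x i), List.ofFn_get x⟩

/-- The strings of length `t` over `{1, …, k}` of weight at least `w`. -/
def heavy (k t w : ℕ) : Finset (List ℕ) := (strings k t).filter fun s => w ≤ s.sum

theorem mem_heavy {k t w : ℕ} {x : List ℕ} :
    x ∈ heavy k t w ↔ x.length = t ∧ (∀ a ∈ x, 1 ≤ a ∧ a ≤ k) ∧ w ≤ x.sum := by
  rw [heavy, Finset.mem_filter, mem_strings, and_assoc]

theorem rotate_mem_heavy {k t w : ℕ} {x : List ℕ} (h : x ∈ heavy k t w) (c : ℕ) :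
    x.rotate c ∈ heavy k t w := by
  rw [mem_heavy] at *
  refine ⟨by simpa using h.1, fun a ha => h.2.1 a (List.mem_rotate.1 ha), ?_⟩
  rw [(List.rotate_perm x c).sum_eq]
  exact h.2.2

theorem mem_necklacesUp {k t w : ℕ} {x : List ℕ} :
    x ∈ necklacesUp k t w ↔ x ∈ heavy k t w ∧ IsNecklace x := by
  simp [necklacesUp, heavy, and_assoc]

theorem necklacesUp_pairwise (k t w : ℕ) : (necklacesUp k t w).Pairwise (· < ·) := by
  have h1 : (necklacesUp k t w).Pairwise (· ≤ ·) := Finset.pairwise_sort _ _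
  have h2 : (necklacesUp k t w).Nodup := Finset.sort_nodup _ _
  exact (h1.and h2).imp fun h => lt_of_le_of_ne h.1 h.2

/-- The concatenation of the aperiodic prefixes of a list of strings. -/
noncomputable def concatAp (l : List (List ℕ)) : List ℕ := (l.map aperiodicPrefix).flatten

theorem concatAp_append (l m : List (List ℕ)) : concatAp (l ++ m) = concatAp l ++ concatAp m := by
  simp [concatAp]

theorem concatAp_cons (a : List ℕ) (m : List (List ℕ)) :
    concatAp (a :: m) = aperiodicPrefix a ++ concatAp m := by
  simp [concatAp]

theorem concatAp_nil : concatAp [] = [] := rfl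

theorem grandUp_eq (k t w : ℕ) : grandUp k t w = concatAp (necklacesUp k t w) := rfl

/-- The number of strings in `heavy k t w` all of whose rotations exceed `y`. -/
def countAbove (k t w : ℕ) (y : List ℕ) : ℕ :=
  ((heavy k t w).filter fun x => ∀ c, c < t → y < x.rotate c).card

/-- As Q passes to smaller strings, some rotation satisfies it exactly when the necklace of the
class does. So the strings on the right form whole rotation classes, and a class has as many members
as the period of its necklace, which is the length of that necklace's block. -/
theorem length_concatAp_filter {k t w : ℕ} (ht : 1 ≤ t) (Q : List ℕ → Prop) [DecidablePred Q]
    (hQ : ∀ a b, a ≤ b → Q b → Q a) :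
    (concatAp ((necklacesUp k t w).filter Q)).length
      = ((heavy k t w).filter fun x => ∃ c, c < t ∧ Q (x.rotate c)).card := by
  have hnd : ((necklacesUp k t w).filter fun x => decide (Q x)).Nodup :=
    (Finset.sort_nodup _ _).filter _
  have hne : ∀ {x}, x ∈ heavy k t w → x ≠ [] := by
    intro x hx h
    have := (mem_heavy.1 hx).1
    simp [h] at this
    omega
  have h1 : (concatAp ((necklacesUp k t w).filter Q)).length
      = ∑ α ∈ ((necklacesUp k t w).filter fun x => decide (Q x)).toFinset, period α := by
    rw [List.sum_toFinset _ hnd, concatAp, List.length_flatten, List.map_map]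
    rfl
  rw [h1]
  have h2 : ((heavy k t w).filter fun x => ∃ c, c < t ∧ Q (x.rotate c))
      = ((necklacesUp k t w).filter fun x => decide (Q x)).toFinset.biUnion fun α =>
        (Finset.range α.length).image fun c => α.rotate c := by
    ext x
    simp only [Finset.mem_filter, Finset.mem_biUnion, List.mem_toFinset, List.mem_filter,
      decide_eq_true_eq, Finset.mem_image, Finset.mem_range, mem_necklacesUp]
    constructor
    · rintro ⟨hx, c, hc, hQc⟩
      obtain ⟨d, hd, hdn⟩ := exists_rotate_isNecklace (hne hx)
      have hlen := (mem_heavy.1 hx).1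
      refine ⟨x.rotate d, ⟨⟨rotate_mem_heavy hx d, hdn⟩, ?_⟩, (x.length - d) % x.length, ?_, ?_⟩
      · refine hQ _ _ ?_ hQc
        have := isNecklace_le_rotate hdn (x.length - d + c)
        rw [List.rotate_rotate] at this
        rwa [show d + (x.length - d + c) = x.length + c by omega, ← List.rotate_rotate,
          List.rotate_length] at this
      · rw [List.length_rotate]; exact Nat.mod_lt _ (by omega)
      · have : (x.length - d) % x.length = (x.length - d) % (x.rotate d).length := by simp
        rw [this, List.rotate_mod, List.rotate_rotate, show d + (x.length - d) = x.length by omega,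
          List.rotate_length]
    · rintro ⟨α, ⟨⟨hα, hn⟩, hQα⟩, c, hc, rfl⟩
      have hlen := (mem_heavy.1 hα).1
      -- This rotates back to the necklace; the remainder is taken because t - c is not below t when
      -- c = 0.
      refine ⟨rotate_mem_heavy hα c, (t - c) % t, Nat.mod_lt _ (by omega), ?_⟩
      have : (t - c) % t = (t - c) % (α.rotate c).length := by simp [hlen]
      rwa [this, List.rotate_mod, List.rotate_rotate,
        show c + (t - c) = α.length by omega, List.rotate_length]
  rw [h2, Finset.card_biUnion]
  · refine Finset.sum_congr rfl fun α hα => ?_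
    rw [List.mem_toFinset, List.mem_filter, mem_necklacesUp] at hα
    exact (card_rotations (hne hα.1.1)).symm
  · intro α hα β hβ hne'
    rw [Finset.mem_coe, List.mem_toFinset, List.mem_filter, mem_necklacesUp] at hα hβ
    rw [Function.onFun, Finset.disjoint_left]
    rintro x hx hx'
    simp only [Finset.mem_image, Finset.mem_range] at hx hx'
    obtain ⟨c, hc, rfl⟩ := hx
    obtain ⟨d, hd, h⟩ := hx'
    apply hne'
    have e : α = β.rotate (d + (α.length - c)) := by
      rw [← List.rotate_rotate, h, List.rotate_rotate, show c + (α.length - c) = α.length by omega,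
        List.rotate_length]
    have := IsNecklace.rotate_eq_of_isNecklace (s := β) (i := d + (α.length - c)) (j := 0)
      (e ▸ hα.1.2) (by simpa using hβ.1.2)
    rw [e, this, List.rotate_zero]

theorem length_grandUp {k t w : ℕ} (ht : 1 ≤ t) :
    (grandUp k t w).length = (heavy k t w).card := by
  have h := length_concatAp_filter (k := k) (w := w) ht (fun _ => True) (fun _ _ _ _ => trivial)
  simp only [decide_true, List.filter_true, and_true] at h
  rw [grandUp_eq, h]
  congr 1
  exact Finset.filter_true_of_mem fun _ _ => ⟨0, by omega, trivial⟩

/-- Locates the end of a block by counting strings, which the automaton below can do. -/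
theorem length_concatAp_filter_le {k t w : ℕ} (ht : 1 ≤ t) (y : List ℕ) :
    (concatAp ((necklacesUp k t w).filter (· ≤ y))).length
      = (grandUp k t w).length - countAbove k t w y := by
  rw [length_concatAp_filter ht (· ≤ y) fun a b h h' => h.trans h', length_grandUp ht, countAbove]
  rw [← Finset.card_sdiff_of_subset (Finset.filter_subset _ _)]
  congr 1
  ext x
  simp only [Finset.mem_filter, Finset.mem_sdiff, not_and, not_forall, not_lt]
  constructor
  · rintro ⟨h, c, hc, h'⟩
    exact ⟨h, fun _ => ⟨c, hc, h'⟩⟩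
  · rintro ⟨h, h'⟩
    obtain ⟨c, hc, h''⟩ := h' h
    exact ⟨h, c, hc, h''⟩

theorem countAbove_le {k t w : ℕ} (ht : 1 ≤ t) (y : List ℕ) :
    countAbove k t w y ≤ (grandUp k t w).length := by
  rw [length_grandUp ht]
  exact Finset.card_filter_le _ _

theorem filter_append_filter_of_pairwise {l : List (List ℕ)} (hl : l.Pairwise (· < ·))
    (v : List ℕ) : l = l.filter (· < v) ++ l.filter (v ≤ ·) := by
  induction l with
  | nil => rfl
  | cons a l ih =>
    rw [List.pairwise_cons] at hl
    by_cases h : a < v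
    · simp only [List.filter_cons, h, not_le.2 h, decide_true, decide_false, if_true]
      simpa using ih hl.2
    · have h' : v ≤ a := not_lt.1 h
      have e : l.filter (· < v) = [] := by
        rw [List.filter_eq_nil_iff]
        intro b hb
        simpa using h'.trans (hl.1 b hb).le
      have e' : l.filter (v ≤ ·) = l := by
        rw [List.filter_eq_self]
        intro b hb
        simpa using h'.trans (hl.1 b hb).le
      simp only [List.filter_cons, h, h', decide_true, decide_false, if_true, e, e']
      simp

theorem filter_le_of_pairwise {A B : List (List ℕ)} {a : List ℕ}
    (hl : (A ++ a :: B).Pairwise (· < ·)) : (A ++ a :: B).filter (· ≤ a) = A ++ [a] := by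
  rw [List.pairwise_append, List.pairwise_cons] at hl
  rw [List.filter_append, List.filter_cons]
  have e : B.filter (· ≤ a) = [] := by
    rw [List.filter_eq_nil_iff]
    intro b hb
    simpa using hl.2.1.1 b hb
  have e' : A.filter (· ≤ a) = A := by
    rw [List.filter_eq_self]
    intro b hb
    simpa using (hl.2.2 b hb a (by simp)).le
  simp [e, e']

/-! ### Successive necklaces -/

theorem le_replicate {k : ℕ} {l : List ℕ} (h : ∀ a ∈ l, a ≤ k) :
    l ≤ List.replicate l.length k := by
  induction l with
  | nil => simp
  | cons a l ih =>
    rw [List.length_cons, List.replicate_succ, cons_le_cons]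
    have h1 := h a (by simp)
    rcases h1.lt_or_eq with h1 | h1
    · exact Or.inl h1
    · exact Or.inr ⟨h1, ih fun b hb => h b (by simp [hb])⟩

theorem sum_le_mul {k : ℕ} {l : List ℕ} (h : ∀ a ∈ l, a ≤ k) : l.sum ≤ l.length * k := by
  simpa using List.sum_le_card_nsmul l k h

section

variable {k t w : ℕ}

/-- The string γ that arises from α by raising the last t - m letters to k is a necklace and has not
lost weight, so it is in the list. It exceeds α, hence α < β ≤ γ, while α and γ have the same first
m letters. -/
theorem take_next_eq {A B : List (List ℕ)} {α β : List ℕ}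
    (hL : necklacesUp k t w = A ++ α :: β :: B) {m : ℕ} (hm : m ≤ t)
    (hd : α.drop m ≠ List.replicate (t - m) k) : β.take m = α.take m := by
  have hp := necklacesUp_pairwise k t w
  have hα : α ∈ necklacesUp k t w := by rw [hL]; simp
  rw [mem_necklacesUp, mem_heavy] at hα
  obtain ⟨⟨hlen, hlet, hsum⟩, hneck⟩ := hα
  set γ := α.take m ++ List.replicate (t - m) k with hγ
  have hk1 : m < t → 1 ≤ k := by
    intro h
    have := hlet α[m] (List.getElem_mem _)
    omega
  have hγmem : γ ∈ necklacesUp k t w := by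
    rw [mem_necklacesUp, mem_heavy]
    refine ⟨⟨by simp [hγ]; omega, ?_, ?_⟩, ?_⟩
    · intro a ha
      rw [hγ, List.mem_append] at ha
      rcases ha with ha | ha
      · exact hlet a (List.mem_of_mem_take ha)
      · rw [List.mem_replicate] at ha
        obtain ⟨h1, rfl⟩ := ha
        exact ⟨hk1 (by omega), le_rfl⟩
    · refine hsum.trans ?_
      conv_lhs => rw [← List.take_append_drop m α]
      rw [hγ, List.sum_append, List.sum_append, List.sum_replicate]
      have := sum_le_mul (k := k) (l := α.drop m) fun a ha => (hlet a (List.mem_of_mem_drop ha)).2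
      rw [List.length_drop, hlen] at this
      exact Nat.add_le_add_left this _
    · have := isNecklace_take_append_replicate' (m := m) hneck (fun a ha => (hlet a ha).2)
        (by omega)
      rwa [hlen] at this
  have hlt : α < γ := by
    conv_lhs => rw [← List.take_append_drop m α]
    apply List.append_left_lt
    refine lt_of_le_of_ne ?_ hd
    have := le_replicate (k := k) (l := α.drop m)
      fun a ha => (hlet a (List.mem_of_mem_drop ha)).2
    simpa [hlen] using this
  rw [hL] at hγmem hp
  rw [List.pairwise_append, List.pairwise_cons, List.pairwise_cons] at hp
  have hβγ : β ≤ γ := by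
    simp only [List.mem_append, List.mem_cons] at hγmem
    rcases hγmem with h | h | h | h
    · exact absurd hlt (not_lt.2 (hp.2.2 _ h α (by simp)).le)
    · exact absurd hlt (by rw [h]; exact lt_irrefl _)
    · exact h.ge
    · exact (hp.2.1.2.1 _ h).le
  refine take_eq_of_between m (hp.2.1.1 β (by simp)).le hβγ ?_
  rw [hγ, List.take_append_of_le_length (by simp; omega), List.take_take, Nat.min_self]

/-- The first letter of a necklace is its least letter; here it is also the largest of the alphabet.
-/
theorem eq_replicate_of_take {α : List ℕ} (hα : α ∈ necklacesUp k t w) {m : ℕ} (hm : 1 ≤ m)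
    (hmt : m ≤ t) (h : α.take m = List.replicate m k) : α = List.replicate t k := by
  rw [mem_necklacesUp, mem_heavy] at hα
  obtain ⟨⟨hlen, hlet, hsum⟩, hneck⟩ := hα
  have h0 : α[0]'(by omega) = k := by
    have h1 : (α.take m)[0]'(by simp; omega) = α[0]'(by omega) := by simp
    rw [← h1]
    simp [h]
  rw [List.eq_replicate_iff]
  refine ⟨hlen, fun b hb => le_antisymm (hlet b hb).2 ?_⟩
  rw [← h0]
  exact isNecklace_head_le hneck _ hb

theorem drop_sub_period {α : List ℕ} (h : α ≠ []) :
    α.drop (α.length - period α) = α.take (period α) := by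
  obtain ⟨h0, hle, hrot, -, -⟩ := aperiodicPrefix_spec h
  rw [List.rotate_eq_drop_append_take hle] at hrot
  have := congrArg (List.drop (α.length - period α)) hrot
  rwa [List.drop_left' (by simp), eq_comm] at this

theorem period_replicate (ht : 1 ≤ t) : period (List.replicate t k) = 1 := by
  have h : List.replicate t k ≠ [] := by simp; omega
  obtain ⟨h0, -, -, hmin, -⟩ := aperiodicPrefix_spec h
  have := hmin 1 one_pos (by simp)
  omega

theorem aperiodicPrefix_replicate (ht : 1 ≤ t) : aperiodicPrefix (List.replicate t k) = [k] := by
  have h : List.replicate t k ≠ [] := by simp; omega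
  obtain ⟨-, -, -, -, h⟩ := aperiodicPrefix_spec h
  rw [h, period_replicate ht, List.take_replicate, Nat.min_eq_left ht]
  rfl

theorem append_replicate_nil {A B : List (List ℕ)}
    (hL : necklacesUp k t w = A ++ List.replicate t k :: B) : B = [] := by
  have hp := necklacesUp_pairwise k t w
  cases B with
  | nil => rfl
  | cons b B =>
    have hb : b ∈ necklacesUp k t w := by rw [hL]; simp
    rw [mem_necklacesUp, mem_heavy] at hb
    rw [hL, List.pairwise_append, List.pairwise_cons] at hp
    have h1 := hp.2.1.1 b (by simp)
    have h2 := le_replicate fun a ha => (hb.1.2.1 a ha).2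
    rw [hb.1.1] at h2
    exact absurd h1 (not_lt.2 h2)

/-- If the period p of α is below t, then α is its aperiodic prefix followed by its own first t - p
letters. The last p letters of α repeat the aperiodic prefix and are not all k, so the successor of
α shares these t - p letters, and induction along the list supplies them. The string k^t is an
exception, since it contributes a single letter at the very end. -/
theorem isPrefix_concatAp (ht : 1 ≤ t) (hK : List.replicate t k ∈ necklacesUp k t w)
    (B : List (List ℕ)) : ∀ (A : List (List ℕ)) (α : List ℕ), necklacesUp k t w = A ++ α :: B →
      α ≠ List.replicate t k → α <+: concatAp (α :: B) := by
  induction B with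
  | nil =>
    intro A α hL hne
    exfalso
    have hp := necklacesUp_pairwise k t w
    have hα : α ∈ necklacesUp k t w := by rw [hL]; simp
    rw [mem_necklacesUp, mem_heavy] at hα
    rw [hL] at hK hp
    rw [List.pairwise_append] at hp
    simp only [List.mem_append, List.mem_singleton] at hK
    rcases hK with h | h
    · have h1 := hp.2.2 _ h α (by simp)
      have h2 := le_replicate fun a ha => (hα.1.2.1 a ha).2
      rw [hα.1.1] at h2
      exact absurd h1 (not_lt.2 h2)
    · exact hne h.symm
  | cons β B ih =>
    intro A α hL hne
    have hα : α ∈ necklacesUp k t w := by rw [hL]; simp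
    have hβ : β ∈ necklacesUp k t w := by rw [hL]; simp
    have hα' := hα
    rw [mem_necklacesUp, mem_heavy] at hα'
    obtain ⟨⟨hlen, hlet, hsum⟩, hneck⟩ := hα'
    have hnil : α ≠ [] := by rintro rfl; simp at hlen; omega
    obtain ⟨h0, hle, hrot, hmin, hap⟩ := aperiodicPrefix_spec hnil
    rw [concatAp_cons, hap]
    have hsplit : α = α.take (period α) ++ α.take (t - period α) := by
      have h2 : α.drop (period α) = α.take (t - period α) := by
        have h3 : (α.drop (period α) ++ α.take (period α)).take (t - period α)
          = α.take (t - period α) := by rw [← List.rotate_eq_drop_append_take hle, hrot]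
        rwa [List.take_left' (by simp [hlen])] at h3
      rw [← h2, List.take_append_drop]
    rcases Nat.eq_or_lt_of_le hle with hpt | hpt
    · rw [hpt, List.take_length]
      exact List.prefix_append _ _
    · have hnext := take_next_eq hL (m := t - period α) (by omega) (by
        intro h
        apply hne
        have h5 := drop_sub_period hnil
        rw [hlen, h, Nat.sub_sub_self (by omega)] at h5
        exact eq_replicate_of_take hα h0 (by omega) h5.symm)
      have hβne : β ≠ List.replicate t k := by
        rintro rfl
        apply hne
        rw [List.take_replicate, Nat.min_eq_left (by omega)] at hnext
        exact eq_replicate_of_take hα (m := t - period α) (by omega) (by omega) hnext.symm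
      have hpre := ih (A ++ [α]) β (by rw [hL]; simp) hβne
      conv_lhs => rw [hsplit]
      rw [List.prefix_append_right_inj, ← hnext]
      exact (List.take_prefix _ _).trans hpre

/-- The block of α equals the last `period α` letters of α, and what follows spells out β in full
unless β = k^t. In that case no letter of β may be needed, which is what j = t says. -/
theorem isPrefix_drop_grandUp (ht : 1 ≤ t) (hK : List.replicate t k ∈ necklacesUp k t w)
    {A B : List (List ℕ)} {α β : List ℕ} (hL : necklacesUp k t w = A ++ α :: β :: B) {j : ℕ}
    (hj : j ≤ period α) (hβ : β ≠ List.replicate t k ∨ j = t) :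
    α.drop (t - j) ++ β.take (t - j) <+:
      (grandUp k t w).drop ((concatAp (A ++ [α])).length - j) := by
  have hα : α ∈ necklacesUp k t w := by rw [hL]; simp
  rw [mem_necklacesUp, mem_heavy] at hα
  obtain ⟨⟨hlen, hlet, hsum⟩, hneck⟩ := hα
  have hnil : α ≠ [] := by rintro rfl; simp at hlen; omega
  obtain ⟨h0, hle, hrot, hmin, hap⟩ := aperiodicPrefix_spec hnil
  have hsuf : α.drop (t - j) = (aperiodicPrefix α).drop (period α - j) := by
    rw [hap, ← drop_sub_period hnil, List.drop_drop]
    congr 1; omega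
  have hlenap : (aperiodicPrefix α).length = period α := rfl
  have e0 : ((concatAp A).length + period α - j) = (concatAp A).length + (period α - j) := by
    omega
  rw [grandUp_eq, hL, concatAp_append, concatAp_append, concatAp_cons, concatAp_cons, concatAp_nil,
    List.append_nil, List.length_append, hlenap, e0, ← List.drop_drop, List.drop_left,
    List.drop_append_of_le_length (by omega), hsuf, List.prefix_append_right_inj]
  rcases hβ with hβ | hβ
  · exact (List.take_prefix _ _).trans
      (isPrefix_concatAp ht hK B (A ++ [α]) β (by rw [hL]; simp) hβ)
  · simp [hβ]

theorem window_of_isPrefix {U l : List ℕ} {q : ℕ} (h : l <+: U.drop q) :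
    window U l.length q = l := by
  have hlen := h.length_le
  rw [List.length_drop] at hlen
  apply List.ext_getElem
  · simp [window]
  · intro i h1 h2
    simp only [window, List.getElem_map, List.getElem_range]
    rw [Nat.mod_eq_of_lt (by omega), List.getD_eq_getElem _ _ (by omega)]
    have := h.getElem h2
    rw [this, List.getElem_drop]

end

end SubsetCycle

namespace SubsetCycle

/-! ### The windows of `grandUp` -/

/-- A rotation by a positive amount below t would bring a letter k to the front. -/
theorem period_cons_replicate {a k t : ℕ} (ht : 1 ≤ t) (ha : a ≠ k) :
    aperiodicPrefix (a :: List.replicate (t - 1) k) = a :: List.replicate (t - 1) k := by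
  set s := a :: List.replicate (t - 1) k with hs
  have hlen : s.length = t := by simp [hs]; omega
  obtain ⟨h0, hle, hrot, -, hap⟩ := aperiodicPrefix_spec (s := s) (by simp [hs])
  rw [hap]
  rcases Nat.eq_or_lt_of_le hle with h | h
  · rw [h, List.take_length]
  · exfalso
    apply ha
    have h1 : (s.rotate (period s))[0]? = s[0]? := by rw [hrot]
    rw [List.getElem?_rotate (by omega), Nat.zero_add, Nat.mod_eq_of_lt h] at h1
    have h2 : s[period s]? = some k := by
      obtain ⟨p, hp⟩ : ∃ p, period s = p + 1 := ⟨period s - 1, by omega⟩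
      rw [hp, hs, List.getElem?_cons_succ, List.getElem?_replicate, if_pos (by omega)]
    rw [h2] at h1
    simpa [hs, eq_comm] using h1

theorem isNecklace_cons_replicate {a k t : ℕ} (ha : a ≤ k) :
    IsNecklace (a :: List.replicate (t - 1) k) := by
  have h : (a :: List.replicate (t - 1) k)
      = (List.replicate t a).take 1 ++ List.replicate ((List.replicate t a).length - 1) k ∨
        t = 0 := by
    rcases t with _ | t
    · exact Or.inr rfl
    · left
      simp [List.take_replicate]
  rcases h with h | rfl
  · rcases Nat.eq_zero_or_pos t with rfl | ht
    · intro i hi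
      simp only [zero_tsub, List.replicate_zero, List.rotate_singleton, le_refl]
    · rw [h]
      refine isNecklace_take_append_replicate' (isNecklace_replicate t a) (fun b hb => ?_)
        (by simp; omega)
      rw [List.mem_replicate] at hb
      omega
  · intro i hi
    simp

section

variable {k t : ℕ}

theorem replicate_mem (hk : 1 ≤ k) (ht : 1 ≤ t) :
    List.replicate t k ∈ necklacesUp k t (k * (t - 1) + 1) := by
  rw [mem_necklacesUp, mem_heavy]
  refine ⟨⟨by simp, fun a ha => ?_, ?_⟩, isNecklace_replicate t k⟩
  · rw [List.mem_replicate] at ha; omega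
  · obtain ⟨t, rfl⟩ : ∃ s, t = s + 1 := ⟨t - 1, by omega⟩
    simp
    nlinarith

theorem cons_replicate_mem {a : ℕ} (ha : 1 ≤ a) (hak : a ≤ k) (ht : 1 ≤ t) :
    a :: List.replicate (t - 1) k ∈ necklacesUp k t (k * (t - 1) + 1) := by
  rw [mem_necklacesUp, mem_heavy]
  refine ⟨⟨by simp; omega, fun b hb => ?_, ?_⟩, isNecklace_cons_replicate hak⟩
  · rw [List.mem_cons, List.mem_replicate] at hb; omega
  · simp
    nlinarith

/-- The one-letter alphabet stands apart: the cycle has length 1, so a window may wrap around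
several times. -/
theorem grandUp_one (ht : 1 ≤ t) : grandUp 1 t (1 * (t - 1) + 1) = [1] := by
  have h : necklacesUp 1 t (1 * (t - 1) + 1) = [List.replicate t 1] := by
    obtain ⟨A, B, hAB⟩ := List.append_of_mem (replicate_mem (k := 1) le_rfl ht)
    have hall : ∀ x ∈ necklacesUp 1 t (1 * (t - 1) + 1), x = List.replicate t 1 := by
      intro x hx
      rw [mem_necklacesUp, mem_heavy] at hx
      rw [List.eq_replicate_iff]
      exact ⟨hx.1.1, fun b hb => by have := hx.1.2.1 b hb; omega⟩
    have hB := append_replicate_nil hAB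
    subst hB
    have hp := necklacesUp_pairwise 1 t (1 * (t - 1) + 1)
    rw [hAB, List.pairwise_append] at hp
    cases A with
    | nil => simpa using hAB
    | cons a A =>
      have h1 := hp.2.2 a (by simp) (List.replicate t 1) (by simp)
      rw [hall a (by rw [hAB]; simp)] at h1
      exact absurd h1 (lt_irrefl _)
  rw [grandUp_eq, h, concatAp_cons, aperiodicPrefix_replicate ht]
  rfl

/-- The weight bound is attained here: a string that starts with 1 reaches it only if all other
letters are k. -/
theorem necklacesUp_head (hk : 1 ≤ k) (ht : 1 ≤ t) : ∃ B,
    necklacesUp k t (k * (t - 1) + 1) = (1 :: List.replicate (t - 1) k) :: B := by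
  have hm := cons_replicate_mem (k := k) (a := 1) le_rfl hk ht
  have hp := necklacesUp_pairwise k t (k * (t - 1) + 1)
  cases h : necklacesUp k t (k * (t - 1) + 1) with
  | nil => rw [h] at hm; simp at hm
  | cons α B =>
    refine ⟨B, ?_⟩
    congr 1
    have hα : α ∈ necklacesUp k t (k * (t - 1) + 1) := by rw [h]; simp
    rw [mem_necklacesUp, mem_heavy] at hα
    obtain ⟨⟨hlen, hlet, hsum⟩, -⟩ := hα
    have hle : α ≤ 1 :: List.replicate (t - 1) k := by
      rw [h, List.pairwise_cons] at hp
      rw [h, List.mem_cons] at hm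
      rcases hm with hm | hm
      · exact hm.ge
      · exact (hp.1 _ hm).le
    refine le_antisymm hle ?_
    cases α with
    | nil => simp at hlen; omega
    | cons a α =>
      have ha := hlet a (by simp)
      rw [cons_le_cons] at hle
      have ha1 : a = 1 := by omega
      subst ha1
      rw [cons_le_cons]
      refine Or.inr ⟨rfl, le_of_eq ?_⟩
      symm
      rw [List.eq_replicate_iff]
      have hlen' : α.length = t - 1 := by simp at hlen; omega
      refine ⟨hlen', fun b hb => ?_⟩
      by_contra hbk
      have hbk' : b < k := lt_of_le_of_ne (hlet b (by simp [hb])).2 hbk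
      obtain ⟨l1, l2, rfl⟩ := List.append_of_mem hb
      have h1 := sum_le_mul (k := k) (l := l1) fun x hx => (hlet x (by simp [hx])).2
      have h2 := sum_le_mul (k := k) (l := l2) fun x hx => (hlet x (by simp [hx])).2
      simp only [List.length_append, List.length_cons] at hlen'
      rw [← hlen'] at hsum
      simp only [List.sum_cons, List.sum_append] at hsum
      nlinarith

/-- A necklace other than k^t starts with a letter at most k - 1, so it is at most (k - 1)k^{t-1}.
-/
theorem necklacesUp_last (hk : 2 ≤ k) (ht : 1 ≤ t) : ∃ A,
    necklacesUp k t (k * (t - 1) + 1)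
      = A ++ [(k - 1) :: List.replicate (t - 1) k, List.replicate t k] := by
  obtain ⟨A, B, hAB⟩ := List.append_of_mem (replicate_mem (k := k) (by omega) ht)
  have hB := append_replicate_nil hAB
  subst hB
  have hm := cons_replicate_mem (k := k) (a := k - 1) (by omega) (by omega) ht
  have hp := necklacesUp_pairwise k t (k * (t - 1) + 1)
  have hne : ((k - 1) :: List.replicate (t - 1) k) ≠ List.replicate t k := by
    intro h
    have : (k - 1) ∈ List.replicate t k := by rw [← h]; simp
    rw [List.mem_replicate] at this
    omega
  have hmA : ((k - 1) :: List.replicate (t - 1) k) ∈ A := by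
    rw [hAB] at hm
    simp only [List.mem_append, List.mem_singleton] at hm
    rcases hm with hm | hm
    · exact hm
    · exact absurd hm hne
  rcases A.eq_nil_or_concat with rfl | ⟨A, δ, rfl⟩
  · simp at hmA
  refine ⟨A, ?_⟩
  rw [hAB]
  suffices h : δ = (k - 1) :: List.replicate (t - 1) k by rw [h]; simp
  have hδ : δ ∈ necklacesUp k t (k * (t - 1) + 1) := by rw [hAB]; simp
  have hδ' := hδ
  rw [mem_necklacesUp, mem_heavy] at hδ'
  obtain ⟨⟨hlen, hlet, -⟩, hneck⟩ := hδ'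
  rw [hAB, List.pairwise_append, List.concat_eq_append, List.pairwise_append] at hp
  have hlt := hp.2.2 δ (by simp) (List.replicate t k) (by simp)
  rw [List.concat_eq_append, List.mem_append, List.mem_singleton] at hmA
  refine le_antisymm ?_ ?_
  · cases δ with
    | nil => simp at hlen; omega
    | cons a δ =>
      have ha := (hlet a (by simp)).2
      rw [cons_le_cons]
      have : a ≠ k := by
        rintro rfl
        refine hlt.ne (eq_replicate_of_take hδ le_rfl ht ?_)
        simp
      rcases (show a < k - 1 ∨ a = k - 1 by omega) with h | h
      · exact Or.inl h
      · refine Or.inr ⟨h, ?_⟩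
        have := le_replicate (k := k) (l := δ) fun x hx => (hlet x (by simp [hx])).2
        rwa [show δ.length = t - 1 by simp at hlen; omega] at this
  · rcases hmA with h | h
    · exact (hp.1.2.2 _ h δ (by simp)).le
    · exact h.le

/-- The last two blocks are (k - 1)k^{t-1} and k, so the cycle ends with t letters k, and it starts
with 1k^{t-1}. A window that begins in the final run of k's therefore continues with 1k^{t-1}. -/
theorem window_tail (hk : 2 ≤ k) (ht : 1 ≤ t) {j : ℕ} (hj1 : 1 ≤ j) (hj : j ≤ t) :
    t < (grandUp k t (k * (t - 1) + 1)).length ∧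
    window (grandUp k t (k * (t - 1) + 1)) t ((grandUp k t (k * (t - 1) + 1)).length - j)
      = List.replicate j k ++ (1 :: List.replicate (t - 1) k).take (t - j) := by
  obtain ⟨B, hB⟩ := necklacesUp_head (k := k) (by omega) ht
  obtain ⟨A, hA⟩ := necklacesUp_last hk ht
  have hK := replicate_mem (k := k) (by omega) ht
  have hpre : (1 :: List.replicate (t - 1) k) <+: grandUp k t (k * (t - 1) + 1) := by
    rw [grandUp_eq, hB]
    refine isPrefix_concatAp ht hK B [] _ hB ?_
    intro h
    have : 1 ∈ List.replicate t k := by rw [← h]; simp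
    rw [List.mem_replicate] at this
    omega
  have hU : grandUp k t (k * (t - 1) + 1) = concatAp A ++ [k - 1] ++ List.replicate t k := by
    rw [grandUp_eq, hA, concatAp_append, concatAp_cons, concatAp_cons, concatAp_nil,
      period_cons_replicate ht (by omega), aperiodicPrefix_replicate ht]
    obtain ⟨t, rfl⟩ : ∃ s, t = s + 1 := ⟨t - 1, by omega⟩
    simp [List.replicate_succ']
  generalize grandUp k t (k * (t - 1) + 1) = U at *
  have hlen : U.length = (concatAp A).length + 1 + t := by rw [hU]; simp; omega
  refine ⟨by omega, ?_⟩
  apply List.ext_getElem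
  · simp [window]; omega
  intro i h1 h2
  simp only [window, List.length_map, List.length_range] at h1
  simp only [window, List.getElem_map, List.getElem_range, List.getElem_append,
    List.length_replicate]
  split_ifs with h
  · rw [Nat.mod_eq_of_lt (by omega), List.getD_eq_getElem _ _ (by omega)]
    simp only [hU, List.getElem_append]
    rw [dif_neg]
    · simp
    · simp
      omega
  · have e : (U.length - j + i) % U.length = i - j := by
      rw [show U.length - j + i = U.length + (i - j) by omega, Nat.add_mod_left,
        Nat.mod_eq_of_lt (by omega)]
    rw [e, List.getD_eq_getElem _ _ (by omega), List.getElem_take]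
    exact (hpre.getElem _).symm

end

end SubsetCycle

namespace SubsetCycle

/-! ### Ranks in `grandUp` -/

section

variable {k t : ℕ}

theorem eq_replicate_of_last {w : ℕ} {A : List (List ℕ)} {α : List ℕ}
    (hK : List.replicate t k ∈ necklacesUp k t w) (hL : necklacesUp k t w = A ++ [α]) :
    α = List.replicate t k := by
  have hp := necklacesUp_pairwise k t w
  have hα : α ∈ necklacesUp k t w := by rw [hL]; simp
  rw [mem_necklacesUp, mem_heavy] at hα
  rw [hL] at hK hp
  rw [List.pairwise_append] at hp
  simp only [List.mem_append, List.mem_singleton] at hK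
  rcases hK with h | h
  · have h1 := hp.2.2 _ h α (by simp)
    have h2 := le_replicate fun a ha => (hα.1.2.1 a ha).2
    rw [hα.1.1] at h2
    exact absurd h1 (not_lt.2 h2)
  · exact h.symm

theorem rotate_of_rotate_eq_replicate {x : List ℕ} {j : ℕ}
    (h : x.rotate j = List.replicate t k) : x = List.replicate t k := by
  apply List.rotate_injective j
  simpa using h

/-- With α the necklace `x.rotate j`, the string x is the last j letters of α followed by the first
t - j. As those last j letters are not all k, the successor of α has the same first t - j letters,
so x is read off j letters before the block of α ends. -/
theorem window_rotate (hk : 1 ≤ k) (ht : 1 ≤ t) {x : List ℕ}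
    (hx : x ∈ heavy k t (k * (t - 1) + 1)) {j : ℕ} (hj1 : 1 ≤ j) (hj : j ≤ t)
    (hn : IsNecklace (x.rotate j)) (hmin : ∀ i, 1 ≤ i → i < j → ¬ IsNecklace (x.rotate i))
    (hne : x.take j ≠ List.replicate j k) :
    countAbove k t (k * (t - 1) + 1) (x.rotate j) + j ≤ (grandUp k t (k * (t - 1) + 1)).length ∧
    window (grandUp k t (k * (t - 1) + 1)) t ((grandUp k t (k * (t - 1) + 1)).length
      - countAbove k t (k * (t - 1) + 1) (x.rotate j) - j) = x := by
  have hK := replicate_mem hk ht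
  have hp := necklacesUp_pairwise k t (k * (t - 1) + 1)
  have hlen := (mem_heavy.1 hx).1
  have hα : x.rotate j ∈ necklacesUp k t (k * (t - 1) + 1) :=
    mem_necklacesUp.2 ⟨rotate_mem_heavy hx j, hn⟩
  have hcnt := length_concatAp_filter_le (k := k) (w := k * (t - 1) + 1) ht (x.rotate j)
  have hle := countAbove_le (k := k) (w := k * (t - 1) + 1) ht (x.rotate j)
  have hdrop : (x.rotate j).drop (t - j) = x.take j := by
    rw [List.rotate_eq_drop_append_take (by omega), List.drop_left' (by simp [hlen])]
  have htake : (x.rotate j).take (t - j) = x.drop j := by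
    rw [List.rotate_eq_drop_append_take (by omega), List.take_left' (by simp [hlen])]
  have hαne : x.rotate j ≠ List.replicate t k := by
    intro h
    apply hne
    rw [rotate_of_rotate_eq_replicate h, List.take_replicate, Nat.min_eq_left hj]
  have hxlen : (x.rotate j).length = t := by simpa using hlen
  have hper : j ≤ period (x.rotate j) := by
    obtain ⟨h0, -, hrot, -, -⟩ := aperiodicPrefix_spec (s := x.rotate j)
      (by intro h; rw [h] at hxlen; simp at hxlen; omega)
    -- Otherwise rotation by j minus the period would reach the same necklace earlier.
    by_contra hlt
    apply hmin (j - period (x.rotate j)) (by omega) (by omega)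
    have : x.rotate (j - period (x.rotate j)) = x.rotate j := by
      apply List.rotate_injective (period (x.rotate j))
      simp only
      rw [hrot, List.rotate_rotate, Nat.sub_add_cancel (by omega)]
    rwa [this]
  obtain ⟨A, B, hAB⟩ := List.append_of_mem hα
  have hf : (necklacesUp k t (k * (t - 1) + 1)).filter (· ≤ x.rotate j) = A ++ [x.rotate j] := by
    rw [hAB] at hp ⊢
    exact filter_le_of_pairwise hp
  rw [hf] at hcnt
  cases B with
  | nil => exact absurd (eq_replicate_of_last hK hAB) hαne
  | cons β B =>
    have hnext := take_next_eq hAB (m := t - j) (by omega)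
      (by rw [hdrop, Nat.sub_sub_self hj]; exact hne)
    -- If β were k^t with j < t, the shared prefix would make α start with k, which forces α = k^t.
    have hβ : β ≠ List.replicate t k ∨ j = t := by
      by_contra hcon
      push Not at hcon
      obtain ⟨rfl, hjt⟩ := hcon
      apply hαne
      rw [List.take_replicate, Nat.min_eq_left (by omega)] at hnext
      exact eq_replicate_of_take hα (m := t - j) (by omega) (by omega) hnext.symm
    have hpre := isPrefix_drop_grandUp ht hK hAB hper hβ
    rw [hnext, hdrop, htake, List.take_append_drop, hcnt] at hpre
    have hapos : period (x.rotate j) ≤ (concatAp (A ++ [x.rotate j])).length := by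
      rw [concatAp_append, List.length_append, concatAp_cons, concatAp_nil, List.append_nil]
      exact Nat.le_add_left _ _
    refine ⟨by omega, ?_⟩
    have := window_of_isPrefix hpre
    rwa [hlen] at this

theorem le_append (v l : List ℕ) : v ≤ v ++ l := by
  rw [← not_lt]
  intro h
  induction v with
  | nil => exact List.not_lt_nil _ h
  | cons a v ih =>
    rw [List.cons_append, cons_lt_cons] at h
    rcases h with h | h
    · exact lt_irrefl _ h
    · exact ih h.2

/-- The letter 0 lies below the alphabet, so every continuation of v by letters of the alphabet is
above v0^j. This turns a comparison with the short string v into one with a string of full length,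
as `countAbove` requires it for the programs. -/
theorem le_append_zeros_iff {j : ℕ} (hj : 1 ≤ j) {v z : List ℕ} (hz : z.length = v.length + j)
    (hpos : ∀ a ∈ z, 1 ≤ a) : z ≤ v ++ List.replicate j 0 ↔ z < v := by
  constructor
  · intro h
    by_contra hv
    rw [not_lt] at hv
    have h1 := take_le_take hv v.length
    rw [List.take_length] at h1
    rcases h1.lt_or_eq with h1 | h1
    · refine absurd h (not_le.2 (lt_of_take_lt_take v.length ?_))
      rwa [List.take_left]
    · refine absurd h (not_le.2 ?_)
      rw [← List.take_append_drop v.length z, ← h1]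
      apply List.append_left_lt
      obtain ⟨j, rfl⟩ : ∃ i, j = i + 1 := ⟨j - 1, by omega⟩
      have hdl : (z.drop v.length).length = j + 1 := by simp; omega
      cases hd : z.drop v.length with
      | nil => rw [hd] at hdl; simp at hdl
      | cons a l =>
        rw [List.replicate_succ]
        refine cons_lt_cons.2 (Or.inl ?_)
        exact hpos a (List.mem_of_mem_drop (i := v.length) (by rw [hd]; simp))
  · intro h
    by_contra hc
    rw [not_le] at hc
    have := take_le_take hc.le v.length
    rw [List.take_left] at this
    have h2 := lt_of_lt_of_le h this
    have h3 := take_le_take h.le v.length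
    rw [List.take_length] at h3
    exact absurd h2 (by
      rw [not_lt]
      calc z.take v.length ≤ z.take v.length ++ z.drop v.length := by
            exact le_append _ _
        _ = z := List.take_append_drop _ _)

/-- Write x = k^j v, so that the necklace is vk^j, whose successor need not start with v. Let β be
the first necklace that is at least v; from v ≤ β ≤ vk^j it starts with v. Its predecessor δ is
below v, hence does not start with v, and by `take_next_eq` this is possible only if δ ends with
k^j. So x is read off j letters before the block of δ ends. Without a predecessor β is 1k^{t-1}, and
the window wraps around. -/
theorem window_replicate_append (hk : 1 ≤ k) (ht : 1 ≤ t) {x : List ℕ}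
    (hx : x ∈ heavy k t (k * (t - 1) + 1)) {j : ℕ} (hj1 : 1 ≤ j) (hj : j < t)
    (hn : IsNecklace (x.rotate j)) (htk : x.take j = List.replicate j k)
    (hne : x ≠ List.replicate t k) :
    ∃ E, E = (grandUp k t (k * (t - 1) + 1)).length
        - countAbove k t (k * (t - 1) + 1) (x.drop j ++ List.replicate j 0) ∧
      ((j ≤ E ∧ window (grandUp k t (k * (t - 1) + 1)) t (E - j) = x) ∨
      (E = 0 ∧ t < (grandUp k t (k * (t - 1) + 1)).length ∧
        window (grandUp k t (k * (t - 1) + 1)) t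
          ((grandUp k t (k * (t - 1) + 1)).length - j) = x)) := by
  refine ⟨_, rfl, ?_⟩
  have hK := replicate_mem hk ht
  have hp := necklacesUp_pairwise k t (k * (t - 1) + 1)
  obtain ⟨hlen, hlet, -⟩ := mem_heavy.1 hx
  have hk2 : 2 ≤ k := by
    by_contra hlt
    have : k = 1 := by omega
    subst this
    apply hne
    rw [List.eq_replicate_iff]
    exact ⟨hlen, fun b hb => by have := hlet b hb; omega⟩
  set v := x.drop j with hv
  have hvlen : v.length = t - j := by simp [hv, hlen]
  have hxv : x = List.replicate j k ++ v := by rw [← htk, hv, List.take_append_drop]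
  have hrot : x.rotate j = v ++ List.replicate j k := by
    rw [List.rotate_eq_drop_append_take (by omega), htk]
  have hcnt := length_concatAp_filter_le (k := k) (w := k * (t - 1) + 1) ht
    (v ++ List.replicate j 0)
  have hfil : (necklacesUp k t (k * (t - 1) + 1)).filter (· ≤ v ++ List.replicate j 0)
      = (necklacesUp k t (k * (t - 1) + 1)).filter (· < v) := by
    apply List.filter_congr
    intro z hz
    rw [mem_necklacesUp, mem_heavy] at hz
    have := le_append_zeros_iff hj1 (v := v) (z := z) (by omega) fun a ha => (hz.1.2.1 a ha).1
    simp only [this]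
  rw [hfil] at hcnt
  rw [← hcnt]
  have hsplit := filter_append_filter_of_pairwise hp v
  have hα : x.rotate j ∈ necklacesUp k t (k * (t - 1) + 1) :=
    mem_necklacesUp.2 ⟨rotate_mem_heavy hx j, hn⟩
  have hvα : v ≤ x.rotate j := by
    rw [hrot]
    exact le_append _ _
  have hαB : x.rotate j ∈ (necklacesUp k t (k * (t - 1) + 1)).filter (v ≤ ·) := by
    rw [List.mem_filter]; exact ⟨hα, by simpa using hvα⟩
  have hαne : x.rotate j ≠ List.replicate t k := fun h => hne (rotate_of_rotate_eq_replicate h)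
  have hAlt : ∀ z ∈ (necklacesUp k t (k * (t - 1) + 1)).filter (· < v), z < v := by
    intro z hz; simpa using (List.mem_filter.1 hz).2
  have hBle : ∀ z ∈ (necklacesUp k t (k * (t - 1) + 1)).filter (v ≤ ·), v ≤ z := by
    intro z hz; simpa using (List.mem_filter.1 hz).2
  generalize (necklacesUp k t (k * (t - 1) + 1)).filter (· < v) = A at *
  generalize (necklacesUp k t (k * (t - 1) + 1)).filter (v ≤ ·) = B at *
  cases B with
  | nil => simp at hαB
  | cons β B =>
    have hβα : β ≤ x.rotate j := by
      rw [hsplit, List.pairwise_append, List.pairwise_cons] at hp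
      rw [List.mem_cons] at hαB
      rcases hαB with h | h
      · exact h.ge
      · exact (hp.2.1.1 _ h).le
    have hβtake : β.take (t - j) = v := by
      have h1 := take_le_take hβα (t - j)
      have h2 := take_le_take (hBle β (by simp)) (t - j)
      rw [hrot, List.take_left' hvlen] at h1
      rw [List.take_of_length_le hvlen.le] at h2
      exact le_antisymm h1 h2
    have hβne : β ≠ List.replicate t k := by
      rintro rfl
      apply hαne
      rw [List.take_replicate, Nat.min_eq_left (by omega)] at hβtake
      rw [hrot, ← hβtake, List.replicate_append_replicate, Nat.sub_add_cancel hj.le]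
    rcases A.eq_nil_or_concat with rfl | ⟨A, δ, rfl⟩
    · right
      obtain ⟨C, hC⟩ := necklacesUp_head hk ht
      have hβ1 : β = 1 :: List.replicate (t - 1) k := by
        rw [hC] at hsplit
        simp only [List.nil_append, List.cons.injEq] at hsplit
        exact hsplit.1.symm
      obtain ⟨h1, h2⟩ := window_tail hk2 ht hj1 hj.le
      refine ⟨rfl, h1, ?_⟩
      rw [h2, ← hβ1, hβtake, ← hxv]
    · left
      rw [List.concat_eq_append] at *
      have hsplit' : necklacesUp k t (k * (t - 1) + 1) = A ++ δ :: β :: B := by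
        rw [hsplit]; simp
      have hδ : δ ∈ necklacesUp k t (k * (t - 1) + 1) := by rw [hsplit']; simp
      have hδ' := hδ
      rw [mem_necklacesUp, mem_heavy] at hδ'
      have hδd : δ.drop (t - j) = List.replicate j k := by
        by_contra hd
        have := take_next_eq hsplit' (m := t - j) (by omega)
          (by rwa [Nat.sub_sub_self hj.le])
        rw [hβtake] at this
        have h3 := hAlt δ (by simp)
        refine absurd h3 (not_lt.2 ?_)
        rw [this]
        conv_rhs => rw [← List.take_append_drop (t - j) δ]
        exact le_append _ _
      have hδne : δ ≠ List.replicate t k := by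
        rintro rfl
        exact absurd (append_replicate_nil hsplit') (by simp)
      have hδnil : δ ≠ [] := by
        rintro rfl
        have := hδ'.1.1
        simp at this
        omega
      obtain ⟨h0, hle, -, -, -⟩ := aperiodicPrefix_spec hδnil
      -- A period p < j would repeat the last p letters of δ, all equal to k, at its beginning.
      have hper : j ≤ period δ := by
        by_contra hlt
        apply hδne
        refine eq_replicate_of_take hδ (m := period δ) h0 (by omega) ?_
        rw [← drop_sub_period hδnil, hδ'.1.1,
          show t - period δ = (t - j) + (j - period δ) by omega, ← List.drop_drop, hδd,
          List.drop_replicate, Nat.sub_sub_self (by omega)]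
      have hpre := isPrefix_drop_grandUp ht hK hsplit' hper (Or.inl hβne)
      rw [hδd, hβtake, ← hxv] at hpre
      have hapos : period δ ≤ (concatAp (A ++ [δ])).length := by
        rw [concatAp_append, List.length_append, concatAp_cons, concatAp_nil, List.append_nil]
        exact Nat.le_add_left _ _
      refine ⟨by omega, ?_⟩
      have := window_of_isPrefix hpre
      rwa [hlen] at this

theorem window_replicate (hk : 1 ≤ k) (ht : 1 ≤ t) :
    window (grandUp k t (k * (t - 1) + 1)) t ((grandUp k t (k * (t - 1) + 1)).length - t)
      = List.replicate t k := by
  rcases (show k = 1 ∨ 2 ≤ k by omega) with rfl | hk2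
  -- The cycle has length 1, so the starting position truncates to 0 and the window reads its only
  -- letter t times.
  · rw [grandUp_one ht]
    apply List.ext_getElem
    · simp [window]
    · intro i h1 h2
      simp [window, Nat.mod_one]
  · rw [(window_tail hk2 ht ht le_rfl).2]
    simp

theorem exists_window (hk : 1 ≤ k) (ht : 1 ≤ t) {x : List ℕ}
    (hx : x ∈ heavy k t (k * (t - 1) + 1)) :
    ∃ q, q < (grandUp k t (k * (t - 1) + 1)).length ∧
      window (grandUp k t (k * (t - 1) + 1)) t q = x := by
  have hpos : 0 < (grandUp k t (k * (t - 1) + 1)).length := by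
    rw [length_grandUp ht, Finset.card_pos]
    exact ⟨x, hx⟩
  by_cases hxk : x = List.replicate t k
  · exact ⟨_, by omega, hxk ▸ window_replicate hk ht⟩
  have hlen := (mem_heavy.1 hx).1
  -- The amounts run from 1 to t and not from 0, because j counts the letters that are read before a
  -- block ends; for a string that is a necklace itself, j = t will do.
  have hex : ∃ j, 1 ≤ j ∧ j ≤ t ∧ IsNecklace (x.rotate j) := by
    obtain ⟨c, hc, hn⟩ := exists_rotate_isNecklace (s := x) (by rintro rfl; simp at hlen; omega)
    rcases Nat.eq_zero_or_pos c with rfl | h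
    · refine ⟨t, ht, le_rfl, ?_⟩
      rw [← hlen, List.rotate_length]
      simpa using hn
    · exact ⟨c, h, by omega, hn⟩
  classical
  obtain ⟨hj1, hj, hn⟩ := Nat.find_spec hex
  have hmin := fun g hg => Nat.find_min hex (m := g) hg
  generalize Nat.find hex = j at *
  by_cases htk : x.take j = List.replicate j k
  · have hjt : j < t := by
      rcases Nat.eq_or_lt_of_le hj with h | h
      · rw [h, List.take_of_length_le (by omega)] at htk
        exact absurd htk hxk
      · exact h
    obtain ⟨E, hE, ⟨h1, h2⟩ | ⟨h1, h2, h3⟩⟩ := window_replicate_append hk ht hx hj1 hjt hn htk hxk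
    · exact ⟨_, by omega, h2⟩
    · exact ⟨_, by omega, h3⟩
  · obtain ⟨h1, h2⟩ := window_rotate hk ht hx hj1 hj hn
      (fun i hi hij h => hmin i hij ⟨hi, by omega, h⟩) htk
    exact ⟨_, by omega, h2⟩

/-- Every heavy string is a window, and there are only as many positions as heavy strings, so no
window repeats and none is anything else. -/
theorem window_bijOn (hk : 1 ≤ k) (ht : 1 ≤ t) :
    Set.BijOn (window (grandUp k t (k * (t - 1) + 1)) t)
      (Finset.range (grandUp k t (k * (t - 1) + 1)).length)
      (heavy k t (k * (t - 1) + 1)) := by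
  set U := grandUp k t (k * (t - 1) + 1) with hU
  have hsurj : heavy k t (k * (t - 1) + 1) ⊆ (Finset.range U.length).image (window U t) := by
    intro x hx
    obtain ⟨q, hq, h⟩ := exists_window hk ht hx
    exact Finset.mem_image.2 ⟨q, by simpa using hq, h⟩
  have hcard : ((Finset.range U.length).image (window U t)).card ≤ U.length := by
    simpa using Finset.card_image_le (s := Finset.range U.length) (f := window U t)
  have heq := Finset.eq_of_subset_of_card_le hsurj (by rw [← length_grandUp ht]; exact hcard)
  refine ⟨fun q hq => ?_, ?_, fun x hx => ?_⟩
  · rw [heq]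
    exact Finset.mem_coe.2 (Finset.mem_image_of_mem _ hq)
  · rw [← Finset.card_image_iff, ← heq, ← length_grandUp ht, Finset.card_range]
  · have := hsurj hx
    simpa using this

/-! ### Unranking -/

theorem exists_split_of_lt {l : List (List ℕ)} {q : ℕ} (h : q < (concatAp l).length) :
    ∃ A α B, l = A ++ α :: B ∧ (concatAp A).length ≤ q ∧ q < (concatAp (A ++ [α])).length := by
  induction l generalizing q with
  | nil => simp [concatAp] at h
  | cons a l ih =>
    rw [concatAp_cons, List.length_append] at h
    by_cases hq : q < (aperiodicPrefix a).length
    · exact ⟨[], a, l, rfl, by simp [concatAp], by simpa [concatAp] using hq⟩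
    · obtain ⟨A, α, B, rfl, h1, h2⟩ := ih (q := q - (aperiodicPrefix a).length) (by omega)
      refine ⟨a :: A, α, B, rfl, ?_, ?_⟩
      · rw [concatAp_cons, List.length_append]; omega
      · rw [List.cons_append, concatAp_cons, List.length_append]; omega

/-- The right side says that the blocks of the necklaces up to y extend beyond position q. This is
the monotone test by which a search finds the necklace at q. -/
theorem le_iff_lt_countAbove {w : ℕ} (ht : 1 ≤ t) {A B : List (List ℕ)} {α : List ℕ} {q : ℕ}
    (hL : necklacesUp k t w = A ++ α :: B) (h1 : (concatAp A).length ≤ q)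
    (h2 : q < (concatAp (A ++ [α])).length) (y : List ℕ) :
    α ≤ y ↔ q < (grandUp k t w).length - countAbove k t w y := by
  rw [← length_concatAp_filter_le ht, hL]
  have hp := necklacesUp_pairwise k t w
  rw [hL, List.pairwise_append, List.pairwise_cons] at hp
  constructor
  · intro h
    refine h2.trans_le ?_
    rw [List.filter_append, List.filter_cons, if_pos (by simpa using h)]
    have : A.filter (· ≤ y) = A := by
      rw [List.filter_eq_self]
      intro b hb
      simpa using (hp.2.2 b hb α (by simp)).le.trans h
    rw [this, concatAp_append, concatAp_append, concatAp_cons, concatAp_cons, concatAp_nil]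
    simp
  · intro h
    by_contra hy
    rw [not_le] at hy
    have : (α :: B).filter (· ≤ y) = [] := by
      rw [List.filter_eq_nil_iff]
      intro b hb
      rw [List.mem_cons] at hb
      have : y < b := by
        rcases hb with rfl | hb
        · exact hy
        · exact hy.trans (hp.2.1.1 b hb)
      simpa using this
    rw [List.filter_append, this, List.append_nil] at h
    have hle : ∀ l : List (List ℕ),
        (concatAp (l.filter (· ≤ y))).length ≤ (concatAp l).length := by
      intro l
      induction l with
      | nil => simp
      | cons a l ih =>
        rw [List.filter_cons]
        split_ifs
        · simp only [concatAp_cons, List.length_append]; omega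
        · simp only [concatAp_cons, List.length_append]; omega
    have := hle A
    omega

/-- Here α is the necklace whose block contains q, j is the number of letters from q to the end of
that block, and β is the successor, whose block contains q + j. The bound on q excludes the windows
that reach the last letter of the cycle; it makes sure that α has a successor, and that β = k^t
occurs only with j = t. -/
theorem window_eq_of_lt (hk : 1 ≤ k) (ht : 1 ≤ t) {q : ℕ}
    (hq : q + t < (grandUp k t (k * (t - 1) + 1)).length) :
    ∃ α ∈ necklacesUp k t (k * (t - 1) + 1), ∃ β ∈ necklacesUp k t (k * (t - 1) + 1), ∃ j,
      1 ≤ j ∧ j ≤ t ∧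
      (∀ y, α ≤ y ↔ q < (grandUp k t (k * (t - 1) + 1)).length
        - countAbove k t (k * (t - 1) + 1) y) ∧
      j = (grandUp k t (k * (t - 1) + 1)).length - countAbove k t (k * (t - 1) + 1) α - q ∧
      (∀ y, β ≤ y ↔ q + j < (grandUp k t (k * (t - 1) + 1)).length
        - countAbove k t (k * (t - 1) + 1) y) ∧
      window (grandUp k t (k * (t - 1) + 1)) t q = α.drop (t - j) ++ β.take (t - j) := by
  have hK := replicate_mem hk ht
  have hp := necklacesUp_pairwise k t (k * (t - 1) + 1)
  obtain ⟨A, α, B, hL, h1, h2⟩ := exists_split_of_lt (l := necklacesUp k t (k * (t - 1) + 1))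
    (q := q) (by rw [← grandUp_eq]; omega)
  have hnil : ∀ β ∈ necklacesUp k t (k * (t - 1) + 1), β.length = t ∧ β ≠ [] ∧
      0 < period β ∧ period β ≤ t := by
    intro β hβ
    have hlen := (mem_heavy.1 (mem_necklacesUp.1 hβ).1).1
    have hn : β ≠ [] := by rintro rfl; simp at hlen; omega
    have := aperiodicPrefix_spec hn
    exact ⟨hlen, hn, this.1, hlen ▸ this.2.1⟩
  have hα : α ∈ necklacesUp k t (k * (t - 1) + 1) := by rw [hL]; simp
  have hcnt := length_concatAp_filter_le (k := k) (w := k * (t - 1) + 1) ht α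
  have hf : (necklacesUp k t (k * (t - 1) + 1)).filter (· ≤ α) = A ++ [α] := by
    rw [hL] at hp ⊢
    exact filter_le_of_pairwise hp
  rw [hf] at hcnt
  have hlast : (concatAp (A ++ [α])).length = (concatAp A).length + period α := by
    rw [concatAp_append, concatAp_cons, concatAp_nil, List.append_nil, List.length_append]; rfl
  have hαp := hnil α hα
  have hUlen : (grandUp k t (k * (t - 1) + 1)).length
      = (concatAp (A ++ [α])).length + (concatAp B).length := by
    rw [grandUp_eq, hL, ← List.length_append, ← concatAp_append]; simp
  cases B with
  | nil =>
    rw [concatAp_nil, List.length_nil] at hUlen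
    omega
  | cons β B =>
    have hβ : β ∈ necklacesUp k t (k * (t - 1) + 1) := by rw [hL]; simp
    have hL' : necklacesUp k t (k * (t - 1) + 1) = (A ++ [α]) ++ β :: B := by rw [hL]; simp
    have hβp := hnil β hβ
    refine ⟨α, hα, β, hβ, (concatAp (A ++ [α])).length - q, by omega, by omega,
      le_iff_lt_countAbove ht hL h1 h2, by rw [← hcnt], ?_, ?_⟩
    · refine le_iff_lt_countAbove ht hL' (by omega) ?_
      have h3 : (concatAp (A ++ [α] ++ [β])).length
          = (concatAp (A ++ [α])).length + period β := by
        rw [concatAp_append, concatAp_cons, concatAp_nil, List.append_nil, List.length_append]; rfl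
      omega
    · have hor : β ≠ List.replicate t k ∨ (concatAp (A ++ [α])).length - q = t := by
        by_contra hcon
        push Not at hcon
        obtain ⟨rfl, hjt⟩ := hcon
        have := append_replicate_nil hL'
        subst this
        rw [concatAp_cons, concatAp_nil, aperiodicPrefix_replicate ht] at hUlen
        simp only [List.append_nil, List.length_singleton] at hUlen
        omega
      have hpre := isPrefix_drop_grandUp ht hK hL
        (j := (concatAp (A ++ [α])).length - q) (by omega) hor
      rw [show (concatAp (A ++ [α])).length - ((concatAp (A ++ [α])).length - q) = q by omega]
        at hpre
      have := window_of_isPrefix hpre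
      rw [List.length_append, List.length_drop, List.length_take, hαp.1, hβp.1] at this
      rwa [show t - (t - ((concatAp (A ++ [α])).length - q))
        + min (t - ((concatAp (A ++ [α])).length - q)) t = t by omega] at this

end

end SubsetCycle

namespace SubsetCycle

/-! ### Difference representatives -/

/-- The partial sums of a list, starting from `b`. -/
def partialSums : ℕ → List ℕ → List ℕ
  | _, [] => []
  | b, x :: l => (b + x) :: partialSums (b + x) l

theorem length_partialSums (b : ℕ) (l : List ℕ) : (partialSums b l).length = l.length := by
  induction l generalizing b with
  | nil => rfl
  | cons x l ih => simp [partialSums, ih]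

theorem zipWith_sub_partialSums (b : ℕ) (l : List ℕ) :
    List.zipWith (fun x y => x - y) (partialSums b l) (b :: partialSums b l) = l := by
  induction l generalizing b with
  | nil => rfl
  | cons x l ih =>
    simp only [partialSums, List.zipWith_cons_cons, List.cons.injEq]
    exact ⟨by omega, ih _⟩

theorem mem_partialSums {b : ℕ} {l : List ℕ} (h : ∀ a ∈ l, 1 ≤ a) :
    ∀ c ∈ partialSums b l, b < c ∧ c ≤ b + l.sum := by
  induction l generalizing b with
  | nil => simp [partialSums]
  | cons x l ih =>
    have hx := h x (by simp)
    intro c hc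
    simp only [partialSums, List.mem_cons] at hc
    rw [List.sum_cons]
    rcases hc with rfl | hc
    · omega
    · have := ih (fun a ha => h a (by simp [ha])) c hc
      omega

theorem partialSums_pairwise {b : ℕ} {l : List ℕ} (h : ∀ a ∈ l, 1 ≤ a) :
    (partialSums b l).Pairwise (· < ·) := by
  induction l generalizing b with
  | nil => simp [partialSums]
  | cons x l ih =>
    have h' : ∀ a ∈ l, 1 ≤ a := fun a ha => h a (by simp [ha])
    exact List.pairwise_cons.2 ⟨fun c hc => (mem_partialSums h' c hc).1, ih h'⟩

theorem partialSums_zipWith_sub {b : ℕ} {l : List ℕ} (h : (b :: l).Pairwise (· < ·)) :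
    partialSums b (List.zipWith (fun x y => x - y) l (b :: l)) = l := by
  induction l generalizing b with
  | nil => rfl
  | cons x l ih =>
    rw [List.pairwise_cons] at h
    have hb := h.1 x (by simp)
    simp only [List.zipWith_cons_cons, partialSums]
    rw [show b + (x - b) = x by omega, ih h.2]

theorem zipWith_sub_mem {b : ℕ} {l : List ℕ} (h : (b :: l).Pairwise (· < ·)) :
    ∀ a ∈ List.zipWith (fun x y => x - y) l (b :: l), 1 ≤ a := by
  induction l generalizing b with
  | nil => simp
  | cons x l ih =>
    rw [List.pairwise_cons] at h
    have hb := h.1 x (by simp)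
    intro a ha
    simp only [List.zipWith_cons_cons, List.mem_cons] at ha
    rcases ha with rfl | ha
    · omega
    · exact ih h.2 a ha

theorem zipWith_sub_sum_le {b n : ℕ} {l : List ℕ} (h : (b :: l).Pairwise (· < ·))
    (hn : ∀ a ∈ b :: l, a ≤ n) :
    b + (List.zipWith (fun x y => x - y) l (b :: l)).sum ≤ n := by
  induction l generalizing b with
  | nil => simpa using hn
  | cons x l ih =>
    rw [List.pairwise_cons] at h
    have hb := h.1 x (by simp)
    have := ih h.2 fun a ha => hn a (by simp [List.mem_cons.1 ha])
    simp only [List.zipWith_cons_cons, List.sum_cons]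
    omega

/-- The compositions of numbers `≤ n` into `t` positive parts. -/
def IsDiffString (n t : ℕ) (d : List ℕ) : Prop :=
  d.length = t ∧ (∀ a ∈ d, 1 ≤ a) ∧ d.sum ≤ n

theorem pairwise_zero_sort {n t : ℕ} {A : Finset ℕ} (hA : A ∈ tSubsets n t) :
    (0 :: A.sort (· ≤ ·)).Pairwise (· < ·) := by
  rw [tSubsets, Finset.mem_powersetCard] at hA
  refine List.pairwise_cons.2 ⟨fun a ha => ?_, ?_⟩
  · have := Finset.mem_Icc.1 (hA.1 ((Finset.mem_sort _).1 ha))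
    omega
  · exact ((Finset.pairwise_sort A (· ≤ ·)).and (Finset.sort_nodup A (· ≤ ·))).imp
      fun h => lt_of_le_of_ne h.1 h.2

theorem isDiffString_diffRep {n t : ℕ} {A : Finset ℕ} (hA : A ∈ tSubsets n t) :
    IsDiffString n t (diffRep A) := by
  have hp := pairwise_zero_sort hA
  rw [tSubsets, Finset.mem_powersetCard] at hA
  refine ⟨?_, zipWith_sub_mem hp, ?_⟩
  · simp [diffRep, hA.2]
  · have := zipWith_sub_sum_le (n := n) hp fun a ha => by
      rw [List.mem_cons, Finset.mem_sort] at ha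
      rcases ha with rfl | ha
      · omega
      · exact (Finset.mem_Icc.1 (hA.1 ha)).2
    simpa [diffRep] using this

theorem diffRep_injOn (n t : ℕ) : Set.InjOn diffRep (tSubsets n t : Set (Finset ℕ)) := by
  intro A hA B hB h
  have h1 := partialSums_zipWith_sub (pairwise_zero_sort hA)
  have h2 := partialSums_zipWith_sub (pairwise_zero_sort hB)
  have h3 : A.sort (· ≤ ·) = B.sort (· ≤ ·) := by
    rw [← h1, ← h2]
    exact congrArg (partialSums 0) h
  rw [← Finset.sort_toFinset A (· ≤ ·), h3, Finset.sort_toFinset]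

theorem exists_diffRep_eq {n t : ℕ} {d : List ℕ} (hd : IsDiffString n t d) :
    ∃ A ∈ tSubsets n t, diffRep A = d := by
  obtain ⟨hlen, hpos, hsum⟩ := hd
  have hpw := partialSums_pairwise (b := 0) hpos
  have hnd : (partialSums 0 d).Nodup := hpw.imp fun h => h.ne
  have hsort : (partialSums 0 d).toFinset.sort (· ≤ ·) = partialSums 0 d :=
    (List.toFinset_sort (· ≤ ·) hnd).2 (hpw.imp fun h => h.le)
  refine ⟨(partialSums 0 d).toFinset, ?_, ?_⟩
  · rw [tSubsets, Finset.mem_powersetCard]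
    refine ⟨fun a ha => ?_, ?_⟩
    · have := mem_partialSums hpos a (List.mem_toFinset.1 ha)
      rw [Finset.mem_Icc]
      omega
    · rw [List.toFinset_card_of_nodup hnd, length_partialSums, hlen]
  · rw [diffRep, hsort, zipWith_sub_partialSums]

/-! ### The universal cycle -/

theorem comp_involutive {k : ℕ} {x : List ℕ} (h : ∀ a ∈ x, a ≤ k + 1) : comp k (comp k x) = x := by
  rw [comp, comp, List.map_map]
  conv_rhs => rw [← List.map_id x]
  refine List.map_congr_left fun a ha => ?_
  have := h a ha
  simp only [Function.comp, id]
  omega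

theorem sum_comp {k : ℕ} {x : List ℕ} (h : ∀ a ∈ x, a ≤ k + 1) :
    (comp k x).sum + x.sum = x.length * (k + 1) := by
  induction x with
  | nil => simp [comp]
  | cons a x ih =>
    have := ih fun b hb => h b (by simp [hb])
    have ha := h a (by simp)
    simp only [comp, List.map_cons, List.sum_cons, List.length_cons] at *
    rw [add_mul, ← this]
    omega

theorem length_comp (k : ℕ) (x : List ℕ) : (comp k x).length = x.length := by simp [comp]

theorem window_comp {k : ℕ} {U : List ℕ} (hU : U ≠ []) (m q : ℕ) :
    window (comp k U) m q = comp k (window U m q) := by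
  have hpos : 0 < U.length := List.length_pos_iff.2 hU
  simp only [window, length_comp]
  rw [comp, comp, List.map_map]
  refine List.map_congr_left fun i _ => ?_
  have := Nat.mod_lt (q + i) hpos
  simp only [Function.comp]
  rw [List.getD_eq_getElem _ _ (by simpa using this), List.getD_eq_getElem _ _ this]
  simp

section

variable {n t : ℕ}

/-- With k = n - t + 1 one has n = k + t - 1. The form on the right is the weight of 1k^{t-1}. -/
theorem weight_bound (ht : 1 ≤ t) (htn : t ≤ n) :
    (n - t + 1) * t + t - n = (n - t + 1) * (t - 1) + 1 := by
  obtain ⟨t, rfl⟩ : ∃ s, t = s + 1 := ⟨t - 1, by omega⟩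
  obtain ⟨m, rfl⟩ : ∃ m, n = t + 1 + m := ⟨n - (t + 1), by omega⟩
  have : t + 1 + m - (t + 1) + 1 = m + 1 := by omega
  rw [this]
  have : (m + 1) * (t + 1) = (m + 1) * t + m + 1 := by ring
  rw [this, Nat.add_sub_cancel]
  omega

/-- A letter of a difference string is at most n - t + 1, since the other t - 1 letters are at least
1. Complementing turns a sum s into t(k + 1) - s, so the upper bound n on the sum becomes the lower
bound on the weight. -/
theorem mem_heavy_iff_comp (ht : 1 ≤ t) (htn : t ≤ n) {d : List ℕ} :
    IsDiffString n t d ↔ (∀ a ∈ d, 1 ≤ a ∧ a ≤ n - t + 1) ∧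
      comp (n - t + 1) d ∈ heavy (n - t + 1) t ((n - t + 1) * (t - 1) + 1) := by
  have hk : ∀ {d : List ℕ}, d.length = t → (∀ a ∈ d, 1 ≤ a) → d.sum ≤ n →
      ∀ a ∈ d, a ≤ n - t + 1 := by
    intro d hlen hpos hsum a ha
    obtain ⟨l1, l2, rfl⟩ := List.append_of_mem ha
    have h1 := List.card_nsmul_le_sum l1 1 fun x hx => hpos x (by simp [hx])
    have h2 := List.card_nsmul_le_sum l2 1 fun x hx => hpos x (by simp [hx])
    simp at hlen hsum h1 h2
    omega
  have hw := weight_bound ht htn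
  rw [mem_heavy]
  constructor
  · rintro ⟨hlen, hpos, hsum⟩
    have hle := hk hlen hpos hsum
    refine ⟨fun a ha => ⟨hpos a ha, hle a ha⟩, by rw [length_comp, hlen], ?_, ?_⟩
    · intro a ha
      rw [comp, List.mem_map] at ha
      obtain ⟨b, hb, rfl⟩ := ha
      have h1 := hpos b hb
      have h2 := hle b hb
      omega
    · have := sum_comp (k := n - t + 1) (x := d) fun a ha => (hle a ha).trans (by omega)
      rw [hlen] at this
      have e : t * (n - t + 1 + 1) = (n - t + 1) * t + t := by ring
      omega
  · rintro ⟨hle, hlen, -, hsum⟩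
    rw [length_comp] at hlen
    refine ⟨hlen, fun a ha => (hle a ha).1, ?_⟩
    have := sum_comp (k := n - t + 1) (x := d) fun a ha => (hle a ha).2.trans (by omega)
    rw [hlen] at this
    have e : t * (n - t + 1 + 1) = (n - t + 1) * t + t := by ring
    have h3 : n ≤ (n - t + 1) * t + t := by
      obtain ⟨m, rfl⟩ : ∃ m, n = t + m := ⟨n - t, by omega⟩
      have : t + m - t = m := by omega
      rw [this]
      nlinarith
    omega

theorem grandDown_eq (ht : 1 ≤ t) (htn : t ≤ n) : grandDown (n - t + 1) t n
    = comp (n - t + 1) (grandUp (n - t + 1) t ((n - t + 1) * (t - 1) + 1)) := by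
  rw [grandDown, weight_bound ht htn]

theorem grandUp_ne_nil (ht : 1 ≤ t) :
    grandUp (n - t + 1) t ((n - t + 1) * (t - 1) + 1) ≠ [] := by
  intro h
  have h1 := length_grandUp (k := n - t + 1) (w := (n - t + 1) * (t - 1) + 1) ht
  rw [h, List.length_nil, eq_comm, Finset.card_eq_zero] at h1
  have h2 := (mem_necklacesUp.1 (replicate_mem (k := n - t + 1) (by omega) ht)).1
  rw [h1] at h2
  simp at h2

/-- The window of `grandDown` at a position corresponds to a window of `grandUp`. -/
theorem hasRank_iff (ht : 1 ≤ t) (htn : t ≤ n) {d : List ℕ} (hd : IsDiffString n t d) {r : ℕ} :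
    HasRank (grandDown (n - t + 1) t n) d r ↔
      1 ≤ r ∧ r ≤ (grandUp (n - t + 1) t ((n - t + 1) * (t - 1) + 1)).length ∧
      window (grandUp (n - t + 1) t ((n - t + 1) * (t - 1) + 1)) t (r - 1)
        = comp (n - t + 1) d := by
  have hle := ((mem_heavy_iff_comp ht htn).1 hd).1
  rw [HasRank, grandDown_eq ht htn, length_comp, hd.1, window_comp (grandUp_ne_nil ht)]
  constructor
  · rintro ⟨h1, h2, h3⟩
    refine ⟨h1, h2, ?_⟩
    -- The window is heavy, so its letters are at most k and complementing it can be undone.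
    have hq := (window_bijOn (k := n - t + 1) (t := t) (by omega) ht).mapsTo
      (x := r - 1) (by simp; omega)
    rw [← h3, comp_involutive fun a ha => ((mem_heavy.1 hq).2.1 a ha).2.trans (by omega)]
  · rintro ⟨h1, h2, h3⟩
    refine ⟨h1, h2, ?_⟩
    rw [h3, comp_involutive fun a ha => (hle a ha).2.trans (by omega)]

theorem card_heavy (ht : 1 ≤ t) (htn : t ≤ n) :
    (heavy (n - t + 1) t ((n - t + 1) * (t - 1) + 1)).card = (tSubsets n t).card := by
  symm
  refine Finset.card_bij (fun A _ => comp (n - t + 1) (diffRep A)) ?_ ?_ ?_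
  · intro A hA
    exact ((mem_heavy_iff_comp ht htn).1 (isDiffString_diffRep hA)).2
  · intro A hA B hB h
    have h1 := ((mem_heavy_iff_comp ht htn).1 (isDiffString_diffRep hA)).1
    have h2 := ((mem_heavy_iff_comp ht htn).1 (isDiffString_diffRep hB)).1
    apply diffRep_injOn n t hA hB
    rw [← comp_involutive (k := n - t + 1) (x := diffRep A) fun a ha => (h1 a ha).2.trans (by omega),
      h, comp_involutive fun a ha => (h2 a ha).2.trans (by omega)]
  · intro x hx
    have hx' := mem_heavy.1 hx
    have hc : comp (n - t + 1) (comp (n - t + 1) x) = x :=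
      comp_involutive fun a ha => (hx'.2.1 a ha).2.trans (by omega)
    have hd : IsDiffString n t (comp (n - t + 1) x) := by
      rw [mem_heavy_iff_comp ht htn, hc]
      refine ⟨fun a ha => ?_, hx⟩
      rw [comp, List.mem_map] at ha
      obtain ⟨b, hb, rfl⟩ := ha
      have := hx'.2.1 b hb
      omega
    obtain ⟨A, hA, h⟩ := exists_diffRep_eq hd
    exact ⟨A, hA, by rw [h, hc]⟩

theorem length_grandUp_eq_choose (ht : 1 ≤ t) (htn : t ≤ n) :
    (grandUp (n - t + 1) t ((n - t + 1) * (t - 1) + 1)).length = n.choose t := by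
  rw [length_grandUp ht, card_heavy ht htn, tSubsets, Finset.card_powersetCard]
  simp

theorem isUniversalCycle_grandDown (ht : 1 ≤ t) (htn : t ≤ n) :
    IsUniversalCycle (grandDown (n - t + 1) t n) (tSubsets n t) diffRep := by
  refine ⟨?_, fun A hA => ?_⟩
  · rw [grandDown_eq ht htn, length_comp, length_grandUp ht, card_heavy ht htn]
  · have hd := isDiffString_diffRep hA
    have hb := window_bijOn (k := n - t + 1) (t := t) (by omega) ht
    obtain ⟨q, hq, h⟩ := hb.surjOn ((mem_heavy_iff_comp ht htn).1 hd).2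
    rw [Finset.mem_coe, Finset.mem_range] at hq
    refine ⟨q + 1, (hasRank_iff ht htn hd).2 ⟨by omega, by omega, by simpa using h⟩, ?_⟩
    intro r hr
    obtain ⟨h1, h2, h3⟩ := (hasRank_iff ht htn hd).1 hr
    have := hb.injOn (x₁ := r - 1) (x₂ := q) (by simp; omega) (by simpa using hq) (h3.trans h.symm)
    omega

end

end SubsetCycle

namespace SubsetCycle

/-! ### Counting the strings all of whose rotations are small -/

/-- The lists of length `l` with sum at most `s`. -/
def boundedLists : ℕ → ℕ → Finset (List ℕ)
  | 0, _ => {[]}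
  | l + 1, s => (Finset.range (s + 1)).biUnion fun a => (boundedLists l (s - a)).image (List.cons a)

theorem mem_boundedLists {l s : ℕ} {z : List ℕ} :
    z ∈ boundedLists l s ↔ z.length = l ∧ z.sum ≤ s := by
  induction l generalizing s z with
  | zero =>
    simp only [boundedLists, Finset.mem_singleton, List.length_eq_zero_iff]
    constructor
    · rintro rfl; simp
    · exact fun h => h.1
  | succ l ih =>
    simp only [boundedLists, Finset.mem_biUnion, Finset.mem_range, Finset.mem_image, ih]
    constructor
    · rintro ⟨a, ha, z, ⟨h1, h2⟩, rfl⟩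
      simp only [List.length_cons, List.sum_cons]
      omega
    · rintro ⟨h1, h2⟩
      cases z with
      | nil => simp at h1
      | cons a z =>
        simp only [List.length_cons, List.sum_cons] at h1 h2
        exact ⟨a, by omega, z, ⟨by omega, by omega⟩, rfl⟩

/-- The prefix of length `f` of the sequence `y`. -/
def pre (y : ℕ → ℕ) (f : ℕ) : List ℕ := (List.range f).map y

theorem length_pre (y : ℕ → ℕ) (f : ℕ) : (pre y f).length = f := by simp [pre]

theorem pre_succ (y : ℕ → ℕ) (f : ℕ) : pre y (f + 1) = pre y f ++ [y f] := by
  simp [pre, List.range_succ]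

theorem pre_succ_suffix {y : ℕ → ℕ} {f a : ℕ} {h : List ℕ} :
    pre y (f + 1) <:+ h ++ [a] ↔ pre y f <:+ h ∧ y f = a := by
  rw [pre_succ, List.suffix_concat_iff]
  constructor
  · rintro (h1 | ⟨z, h1, h2⟩)
    · simp at h1
    · obtain ⟨rfl, h3⟩ := List.append_inj' h1 rfl
      exact ⟨h2, by simpa using h3⟩
  · rintro ⟨h1, rfl⟩
    exact Or.inr ⟨_, rfl, h1⟩

theorem pre_prefix_pre (y : ℕ → ℕ) {b f : ℕ} (h : b ≤ f) : pre y b <+: pre y f := by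
  obtain ⟨e, rfl⟩ := Nat.exists_eq_add_of_le h
  rw [pre, pre, List.range_add, List.map_append]
  exact List.prefix_append _ _

/-- An auxiliary function for `delta`: only the borders shorter than the last argument count. -/
def deltaAux (t : ℕ) (y : ℕ → ℕ) (i a : ℕ) : ℕ → ℕ
  | 0 => if i = t then t else 0
  | b + 1 =>
    if pre y b <:+ pre y i then
      if y b < a then t
      else if a = y b then if deltaAux t y i a b = t then t else b + 1
      else deltaAux t y i a b
    else deltaAux t y i a b

/-- The transition function of the automaton which reads a text and remembers the length `i < t` of
the longest prefix of `y` that is a suffix of the text. The state `t` is reached if the text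
contains a string of length `t` that is at least as large as the prefix of `y`. -/
def delta (t : ℕ) (y : ℕ → ℕ) (i a : ℕ) : ℕ := deltaAux t y i a t

theorem deltaAux_self (t : ℕ) (y : ℕ → ℕ) (a b : ℕ) : deltaAux t y t a b = t := by
  induction b with
  | zero => simp [deltaAux]
  | succ b ih => simp [deltaAux, ih]

/-- The prefixes of y that end `pre y i` are treated in the order of their lengths: a longer match
overrides the state set by a shorter one, but the state t is kept once it is set. -/
theorem deltaAux_spec {t i : ℕ} (hi : i < t) (y : ℕ → ℕ) (a b : ℕ) (hb : b ≤ t) :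
    (deltaAux t y i a b = t ∧ ((∃ f < b, pre y f <:+ pre y i ∧ y f < a) ∨
      ∃ f < b, f + 1 = t ∧ pre y f <:+ pre y i ∧ a = y f)) ∨
    (deltaAux t y i a b < t ∧ (∀ f < b, pre y f <:+ pre y i → a ≤ y f) ∧
      (∀ f < b, pre y f <:+ pre y i → a = y f → f + 1 ≤ deltaAux t y i a b) ∧
      (deltaAux t y i a b ≤ b) ∧
      (deltaAux t y i a b = 0 ∨
        ∃ f < b, pre y f <:+ pre y i ∧ a = y f ∧ deltaAux t y i a b = f + 1)) := by
  induction b with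
  | zero =>
    right
    simp only [deltaAux, hi.ne, if_false]
    refine ⟨by omega, by simp, by simp, le_rfl, Or.inl trivial⟩
  | succ b ih =>
    have ih := ih (by omega)
    rw [deltaAux]
    split_ifs with h1 h2 h3 h4
    · exact Or.inl ⟨rfl, Or.inl ⟨b, by omega, h1, h2⟩⟩
    · left
      refine ⟨rfl, ?_⟩
      rcases ih with ⟨-, ⟨f, hf, h⟩ | ⟨f, hf, h⟩⟩ | ⟨h, -⟩
      · exact Or.inl ⟨f, by omega, h⟩
      · exact Or.inr ⟨f, by omega, h⟩
      · omega
    · rcases ih with ⟨h, -⟩ | ⟨h5, h6, h7, h8, h9⟩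
      · exact absurd h h4
      · rcases Nat.eq_or_lt_of_le hb with hbt | hbt
        · exact Or.inl ⟨hbt, Or.inr ⟨b, by omega, hbt, h1, h3⟩⟩
        · right
          refine ⟨hbt, ?_, ?_, le_rfl, Or.inr ⟨b, by omega, h1, h3, rfl⟩⟩
          · intro f hf hpf
            rcases Nat.lt_succ_iff_lt_or_eq.1 hf with h | rfl
            · exact h6 f h hpf
            · omega
          · intro f hf _ _
            omega
    · rcases ih with ⟨h, ⟨f, hf, h'⟩ | ⟨f, hf, h'⟩⟩ | ⟨h5, h6, h7, h8, h9⟩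
      · exact Or.inl ⟨h, Or.inl ⟨f, by omega, h'⟩⟩
      · exact Or.inl ⟨h, Or.inr ⟨f, by omega, h'⟩⟩
      · right
        refine ⟨h5, ?_, ?_, by omega, ?_⟩
        · intro f hf hpf
          rcases Nat.lt_succ_iff_lt_or_eq.1 hf with h | rfl
          · exact h6 f h hpf
          · omega
        · intro f hf hpf hpa
          rcases Nat.lt_succ_iff_lt_or_eq.1 hf with h | rfl
          · exact h7 f h hpf hpa
          · exact absurd hpa h3
        · rcases h9 with h9 | ⟨f, hf, h9⟩
          · exact Or.inl h9
          · exact Or.inr ⟨f, by omega, h9⟩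
    · rcases ih with ⟨h, ⟨f, hf, h'⟩ | ⟨f, hf, h'⟩⟩ | ⟨h5, h6, h7, h8, h9⟩
      · exact Or.inl ⟨h, Or.inl ⟨f, by omega, h'⟩⟩
      · exact Or.inl ⟨h, Or.inr ⟨f, by omega, h'⟩⟩
      · right
        refine ⟨h5, ?_, ?_, by omega, ?_⟩
        · intro f hf hpf
          rcases Nat.lt_succ_iff_lt_or_eq.1 hf with h | rfl
          · exact h6 f h hpf
          · exact absurd hpf h1
        · intro f hf hpf hpa
          rcases Nat.lt_succ_iff_lt_or_eq.1 hf with h | rfl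
          · exact h7 f h hpf hpa
          · exact absurd hpf h1
        · rcases h9 with h9 | ⟨f, hf, h9⟩
          · exact Or.inl h9
          · exact Or.inr ⟨f, by omega, h9⟩

section

variable (t : ℕ) (y : ℕ → ℕ)

/-- Reading `z` after `pre y c`, one meets a string of length `t` that is at least as large as
`pre y t`. -/
def Exceeds (c : ℕ) (z : List ℕ) : Prop :=
  ∃ z' a, z' ++ [a] <+: z ∧
    ((∃ b < t, pre y b <:+ pre y c ++ z' ∧ y b < a) ∨ pre y t <:+ pre y c ++ z' ++ [a])

variable {t y}

/-- Below t the state is the longest proper prefix of y that ends the text. The other prefixes that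
end the text are then borders of this one, so the state tells against which letters of y the next
letter must be compared. -/
theorem foldl_delta_spec {c : ℕ} (hc : c < t) (z : List ℕ) :
    (z.foldl (delta t y) c = t ∧ Exceeds t y c z) ∨
    (z.foldl (delta t y) c < t ∧ ¬ Exceeds t y c z ∧
      pre y (z.foldl (delta t y) c) <:+ pre y c ++ z ∧
      ∀ f < t, pre y f <:+ pre y c ++ z → f ≤ z.foldl (delta t y) c) := by
  induction z using List.reverseRecOn with
  | nil =>
    right
    refine ⟨hc, ?_, by simp, ?_⟩
    · rintro ⟨z', a, h, -⟩
      simp at h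
    · intro f _ h
      have := h.length_le
      simpa [length_pre] using this
  | append_singleton z a ih =>
    rw [List.foldl_append, List.foldl_cons, List.foldl_nil]
    rcases ih with ⟨h1, z', a', h2, h3⟩ | ⟨h1, h2, h3, h4⟩
    · left
      rw [h1]
      exact ⟨deltaAux_self _ _ _ _, z', a', h2.trans (List.prefix_append _ _), h3⟩
    · have hbord : ∀ f < t, pre y f <:+ pre y (z.foldl (delta t y) c) ↔
          pre y f <:+ pre y c ++ z := fun f hf =>
        ⟨fun h => h.trans h3, fun h => List.suffix_of_suffix_length_le h h3
          (by simpa [length_pre] using h4 f hf h)⟩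
      have hd := deltaAux_spec h1 y a t le_rfl
      rw [show deltaAux t y (z.foldl (delta t y) c) a t = delta t y (z.foldl (delta t y) c) a
        from rfl] at hd
      rcases hd with ⟨h5, ⟨f, hf, h6, h7⟩ | ⟨f, hf, hft, h6, h7⟩⟩ | ⟨h5, h6, h7, -, h8⟩
      · left
        exact ⟨h5, z, a, List.prefix_rfl, Or.inl ⟨f, hf, (hbord f hf).1 h6, h7⟩⟩
      · left
        refine ⟨h5, z, a, List.prefix_rfl, Or.inr ?_⟩
        subst hft
        exact pre_succ_suffix.2 ⟨(hbord f hf).1 h6, h7.symm⟩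
      · right
        refine ⟨h5, ?_, ?_, ?_⟩
        · rintro ⟨z', a', h9, h10⟩
          rw [List.prefix_concat_iff] at h9
          rcases h9 with h9 | h9
          · obtain ⟨rfl, h11⟩ := List.append_inj' h9 rfl
            simp only [List.cons.injEq, and_true] at h11
            subst h11
            rcases h10 with ⟨b, hb, h12, h13⟩ | h12
            · exact absurd (h6 b hb ((hbord b hb).2 h12)) (not_le.2 h13)
            · obtain ⟨u, rfl⟩ : ∃ u, t = u + 1 := ⟨t - 1, by omega⟩
              obtain ⟨h13, h14⟩ := pre_succ_suffix.1 h12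
              have := h7 u (by omega) ((hbord u (by omega)).2 h13) h14.symm
              omega
          · exact h2 ⟨z', a', h9, h10⟩
        · rcases h8 with h8 | ⟨f, hf, h9, h10, h11⟩
          · rw [h8]; simp [pre]
          · rw [h11, ← List.append_assoc]
            exact pre_succ_suffix.2 ⟨(hbord f hf).1 h9, h10.symm⟩
        · intro f hf hpf
          rcases f with _ | f
          · omega
          · rw [← List.append_assoc] at hpf
            obtain ⟨h9, h10⟩ := pre_succ_suffix.1 hpf
            exact h7 f (by omega) ((hbord f (by omega)).2 h9) h10.symm

/-! ### Closed walks and strings with small rotations. -/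

theorem eq_or_exists_of_pre_le {w : List ℕ} (hw : w.length = t) (h : pre y t ≤ w) :
    w = pre y t ∨ ∃ b < t, ∃ a, y b < a ∧ pre y b ++ [a] <+: w := by
  rcases h.eq_or_lt with h | h
  · exact Or.inl h.symm
  · right
    rcases List.lt_iff_exists.1 h with ⟨-, h⟩ | ⟨b, h1, h2, h3, h4⟩
    · rw [length_pre] at h; omega
    · rw [length_pre] at h1
      refine ⟨b, h1, w[b], by simpa [pre] using h4, ?_⟩
      have : pre y b = w.take b := by
        apply List.ext_getElem
        · rw [length_pre, List.length_take]; omega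
        · intro i h5 h6
          rw [length_pre] at h5
          rw [List.getElem_take, ← h3 i h5]
          simp [pre]
      rw [this, List.take_append_getElem]
      exact List.take_prefix _ _

/-- A closed walk can be traversed twice, reading x x without ever entering the absorbing state. All
rotations of x are factors of x x, so a rotation that is not below `pre y t` would have been
noticed. -/
theorem rotate_lt_of_foldl_eq {x : List ℕ} (hx : x.length = t) {c : ℕ} (hc : c < t)
    (h : x.foldl (delta t y) c = c) {p : ℕ} (hp : p < t) : x.rotate p < pre y t := by
  by_contra hcon
  rw [not_lt] at hcon
  have h2 : (x ++ x).foldl (delta t y) c = c := by rw [List.foldl_append, h, h]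
  have hsplit : x ++ x = x.take p ++ (x.rotate p ++ x.drop p) := by
    rw [List.rotate_eq_drop_append_take (by omega)]
    simp only [List.append_assoc, List.take_append_drop]
    rw [← List.append_assoc, List.take_append_drop]
  rcases foldl_delta_spec hc (x ++ x) (y := y) with ⟨h3, -⟩ | ⟨-, h3, -⟩
  · omega
  · apply h3
    rcases eq_or_exists_of_pre_le (by simpa using hx) hcon with h4 | ⟨b, hb, a, hab, h4⟩
    · obtain ⟨u, hu⟩ : ∃ u, t = u + 1 := ⟨t - 1, by omega⟩
      refine ⟨x.take p ++ pre y u, y u, ?_, Or.inr ?_⟩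
      · rw [List.append_assoc, ← pre_succ, ← hu, ← h4, hsplit, List.prefix_append_right_inj]
        exact List.prefix_append _ _
      · rw [List.append_assoc, List.append_assoc, ← pre_succ, ← hu, ← List.append_assoc]
        exact List.suffix_append _ _
    · refine ⟨x.take p ++ pre y b, a, ?_, Or.inl ⟨b, hb, ?_, hab⟩⟩
      · rw [List.append_assoc, hsplit, List.prefix_append_right_inj]
        exact h4.trans (List.prefix_append _ _)
      · rw [← List.append_assoc]
        exact List.suffix_append _ _

/-- This determines c from x and so shows that at most one state carries a closed walk for x. The
prefix of length c < t is short enough to lie inside x. -/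
theorem suffix_of_foldl_eq {x : List ℕ} (hx : x.length = t) {c : ℕ} (hc : c < t)
    (h : x.foldl (delta t y) c = c) :
    pre y c <:+ x ∧ ∀ f < t, pre y f <:+ x → f ≤ c := by
  rcases foldl_delta_spec hc x (y := y) with ⟨h3, -⟩ | ⟨-, -, h3, h4⟩
  · omega
  · rw [h] at h3 h4
    refine ⟨List.suffix_of_suffix_length_le h3 (List.suffix_append _ _) ?_, fun f hf hfx =>
      h4 f hf (hfx.trans (List.suffix_append _ _))⟩
    rw [length_pre]; omega

/-- The state is the longest proper prefix of y that ends x. Starting there amounts to having read x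
before: every factor that could exceed y extends to a rotation of x, and after reading x the longest
matching suffix is the same again. -/
theorem exists_foldl_eq (ht : 1 ≤ t) {x : List ℕ} (hx : x.length = t)
    (h : ∀ p < t, x.rotate p < pre y t) : ∃ c < t, x.foldl (delta t y) c = c := by
  classical
  have hrot : ∀ p, x.rotate p < pre y t := by
    intro p
    rw [← List.rotate_mod]
    exact h _ (hx ▸ Nat.mod_lt _ (by omega))
  obtain ⟨c, hc, hmax⟩ := Finset.exists_max_image
    ((Finset.range t).filter fun f => pre y f <:+ x) id
    ⟨0, Finset.mem_filter.2 ⟨Finset.mem_range.2 ht, List.nil_suffix⟩⟩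
  simp only [Finset.mem_filter, Finset.mem_range, id] at hc hmax
  refine ⟨c, hc.1, ?_⟩
  rcases foldl_delta_spec hc.1 x (y := y) with ⟨-, z', a, hz, hE⟩ | ⟨h2, -, h3, h4⟩
  · exfalso
    have hle := hz.length_le
    obtain ⟨m, hm, hmz⟩ : ∃ m, m ≤ t ∧ z' ++ [a] = x.take m :=
      ⟨_, hx ▸ hle, List.prefix_iff_eq_take.1 hz⟩
    -- Since `pre y c` ends x, the text read so far ends `x ++ x.take m`, which in turn ends with
    -- `x.rotate m`. So l ends a rotation of x, and therefore begins another one.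
    have key : ∀ l : List ℕ, l.length ≤ t → l <:+ pre y c ++ (z' ++ [a]) → l < pre y t ∨
        ∃ w, l ++ w < pre y t := by
      intro l hl hls
      have h5 : l <:+ x ++ x.take m := by
        rw [← hmz]
        obtain ⟨u, hu⟩ := hc.2
        refine hls.trans ⟨u, ?_⟩
        rw [← List.append_assoc, hu]
      have h6 : x.rotate m <:+ x ++ x.take m := by
        rw [List.rotate_eq_drop_append_take (by omega)]
        refine ⟨x.take m, ?_⟩
        rw [← List.append_assoc, List.take_append_drop]
      obtain ⟨u, hu⟩ := List.suffix_of_suffix_length_le h5 h6 (by simpa [hx] using hl)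
      right
      refine ⟨u, ?_⟩
      rw [← List.rotate_append_length_eq, hu, List.rotate_rotate]
      exact hrot _
    rcases hE with ⟨b, hb, hs, hya⟩ | hs
    · have hs' : pre y b ++ [a] <:+ pre y c ++ (z' ++ [a]) := by
        obtain ⟨u, hu⟩ := hs
        exact ⟨u, by rw [← List.append_assoc, hu, List.append_assoc]⟩
      have hbad : ∀ w, ¬ (pre y b ++ [a] ++ w < pre y t) := by
        intro w
        rw [not_lt]
        refine (lt_of_take_lt_take (b + 1) ?_).le
        rw [List.take_left' (by simp [length_pre])]
        have : (pre y t).take (b + 1) = pre y (b + 1) := by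
          have := List.prefix_iff_eq_take.1 (pre_prefix_pre y (show b + 1 ≤ t by omega))
          rw [length_pre] at this
          exact this.symm
        rw [this, pre_succ]
        apply List.append_left_lt
        exact cons_lt_cons.2 (Or.inl hya)
      rcases key _ (by simp [length_pre]; omega) hs' with h7 | ⟨w, h7⟩
      · exact hbad [] (by simpa using h7)
      · exact hbad w h7
    · rw [List.append_assoc] at hs
      rcases key _ (by simp [length_pre]) hs with h7 | ⟨w, h7⟩
      · exact lt_irrefl _ h7
      · exact absurd h7 (not_lt.2 (le_append _ _))
  · refine le_antisymm (hmax _ ⟨h2, ?_⟩) (h4 c hc.1 (hc.2.trans (List.suffix_append _ _)))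
    refine List.suffix_of_suffix_length_le h3 (List.suffix_append _ _) ?_
    rw [length_pre]; omega

variable (t y)

/-- The number of lists of length `l` and sum at most `s` that lead from state `i` to `c`. -/
def pathCount (c : ℕ) : ℕ → ℕ → ℕ → ℕ
  | 0, i, _ => if i = c then 1 else 0
  | l + 1, i, s => ∑ a ∈ Finset.range (s + 1), pathCount c l (delta t y i a) (s - a)

/-- The number of closed walks of length `t` and weight at most `M` in the automaton. -/
def closedCount (M : ℕ) : ℕ := ∑ c ∈ Finset.range t, pathCount t y c t c M

theorem pathCount_eq_card (c l i s : ℕ) : pathCount t y c l i s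
    = ((boundedLists l s).filter fun z => z.foldl (delta t y) i = c).card := by
  induction l generalizing i s with
  | zero =>
    rw [pathCount, boundedLists, Finset.filter_singleton]
    split_ifs with h1 h2 h2
    · rfl
    · exact absurd h1 h2
    · exact absurd h2 h1
    · rfl
  | succ l ih =>
    rw [pathCount, boundedLists, Finset.filter_biUnion, Finset.card_biUnion]
    · refine Finset.sum_congr rfl fun a _ => ?_
      rw [ih, Finset.filter_image, Finset.card_image_of_injective _ (List.cons_injective)]
      rfl
    · intro a _ b _ hab
      rw [Function.onFun, Finset.disjoint_left]
      intro z hz hz'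
      simp only [Finset.mem_filter, Finset.mem_image] at hz hz'
      obtain ⟨⟨u, _, rfl⟩, _⟩ := hz
      obtain ⟨⟨v, _, h⟩, _⟩ := hz'
      exact hab (List.cons.inj h).1.symm

theorem closedCount_eq_card (ht : 1 ≤ t) (M : ℕ) : closedCount t y M
    = ((boundedLists t M).filter fun x => ∀ p < t, x.rotate p < pre y t).card := by
  classical
  simp only [closedCount, pathCount_eq_card, Finset.card_filter]
  rw [Finset.sum_comm]
  refine Finset.sum_congr rfl fun x hx => ?_
  have hlen := (mem_boundedLists.1 hx).1
  split_ifs with h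
  · obtain ⟨c, hc, hcx⟩ := exists_foldl_eq ht hlen h
    rw [Finset.sum_eq_single c]
    · rw [if_pos hcx]
    · intro b hb hbc
      rw [if_neg]
      intro hbx
      rw [Finset.mem_range] at hb
      obtain ⟨h1, h2⟩ := suffix_of_foldl_eq hlen hc hcx
      obtain ⟨h3, h4⟩ := suffix_of_foldl_eq hlen hb hbx
      exact hbc (le_antisymm (h2 b hb h3) (h4 c hc h1))
    · intro h'
      exact absurd (Finset.mem_range.2 hc) h'
  · refine Finset.sum_eq_zero fun c hc => ?_
    rw [if_neg]
    intro hcx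
    exact h fun p hp => rotate_lt_of_foldl_eq hlen (Finset.mem_range.1 hc) hcx hp

/-- Only the letters of x need a bound: a letter of z above M is complemented to 0, below everything
that comes from x. This admits M + 1 as the counterpart of the letter 0, and candidates above M in
the binary search. -/
theorem map_sub_lt_map_sub {M : ℕ} {x z : List ℕ} (hlen : x.length = z.length)
    (hx : ∀ a ∈ x, a ≤ M) :
    z.map (fun a => M + 1 - a) < x.map (fun a => M + 1 - a) ↔ x < z := by
  induction x generalizing z with
  | nil =>
    cases z with
    | nil => simp
    | cons => simp at hlen
  | cons a x ih =>
    cases z with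
    | nil => simp at hlen
    | cons b z =>
      have ha := hx a (by simp)
      rw [List.map_cons, List.map_cons, cons_lt_cons, cons_lt_cons,
        ih (by simpa using hlen) fun c hc => hx c (by simp [hc])]
      have h1 : M + 1 - b < M + 1 - a ↔ a < b := by omega
      have h2 : M + 1 - b = M + 1 - a ↔ a = b := by omega
      rw [h1, h2]

/-- The automaton counts the strings all of whose rotations exceed a given string. -/
theorem closedCount_eq_countAbove (ht : 1 ≤ t) (M : ℕ) : closedCount t y M
    = countAbove (M + 1) t ((M + 1) * (t - 1) + 1) ((pre y t).map fun a => M + 1 - a) := by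
  rw [closedCount_eq_card t y ht, countAbove]
  have hle : ∀ {x : List ℕ}, x.sum ≤ M → ∀ a ∈ x, a ≤ M := fun h a ha =>
    (List.single_le_sum (fun _ _ => Nat.zero_le _) a ha).trans h
  have hsum : ∀ x : List ℕ, (∀ a ∈ x, a ≤ M) →
      (x.map fun a => M + 1 - a).sum + x.sum = (M + 1) * x.length := by
    intro x hx
    induction x with
    | nil => simp
    | cons a x ih =>
      have := ih fun b hb => hx b (by simp [hb])
      have ha := hx a (by simp)
      simp only [List.map_cons, List.sum_cons, List.length_cons, mul_add, mul_one] at *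
      omega
  obtain ⟨u, rfl⟩ : ∃ u, t = u + 1 := ⟨t - 1, by omega⟩
  have hinv : ∀ x : List ℕ, (∀ a ∈ x, a ≤ M + 1) →
      (x.map fun a => M + 1 - a).map (fun a => M + 1 - a) = x := by
    intro x hx
    rw [List.map_map]
    conv_rhs => rw [← List.map_id x]
    refine List.map_congr_left fun a ha => ?_
    have := hx a ha
    simp only [Function.comp, id]
    omega
  refine Finset.card_bij (fun x _ => x.map fun a => M + 1 - a) ?_ ?_ ?_
  · intro x hx
    rw [Finset.mem_filter, mem_boundedLists] at hx
    obtain ⟨⟨hlen, hs⟩, hr⟩ := hx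
    have hl := hle hs
    have h1 := hsum x hl
    rw [Finset.mem_filter, mem_heavy]
    refine ⟨⟨by simpa using hlen, ?_, ?_⟩, ?_⟩
    · intro a ha
      rw [List.mem_map] at ha
      obtain ⟨b, hb, rfl⟩ := ha
      have := hl b hb
      omega
    · rw [hlen] at h1
      simp only [mul_add, mul_one, Nat.add_sub_cancel] at h1 ⊢
      omega
    · intro p hp
      rw [← List.map_rotate]
      refine (map_sub_lt_map_sub (by simpa [length_pre] using hlen) ?_).2 (hr p hp)
      intro a ha
      exact hl a (List.mem_rotate.1 ha)
  · intro x hx z hz h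
    rw [Finset.mem_filter, mem_boundedLists] at hx hz
    rw [← hinv x fun a ha => (hle hx.1.2 a ha).trans (by omega), h,
      hinv z fun a ha => (hle hz.1.2 a ha).trans (by omega)]
  · intro x hx
    rw [Finset.mem_filter, mem_heavy] at hx
    obtain ⟨⟨hlen, hl, hs⟩, hr⟩ := hx
    have hi := hinv x fun a ha => (hl a ha).2
    have hM : ∀ a ∈ x.map (fun a => M + 1 - a), a ≤ M := by
      intro a ha
      rw [List.mem_map] at ha
      obtain ⟨b, hb, rfl⟩ := ha
      have := (hl b hb).1
      omega
    refine ⟨x.map fun a => M + 1 - a, ?_, hi⟩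
    rw [Finset.mem_filter, mem_boundedLists]
    refine ⟨⟨by simpa using hlen, ?_⟩, ?_⟩
    · have h1 := hsum _ hM
      rw [hi, List.length_map, hlen] at h1
      simp only [mul_add, mul_one, Nat.add_sub_cancel] at h1 hs
      omega
    · intro p hp
      refine (map_sub_lt_map_sub (M := M) (by simpa [length_pre] using hlen) ?_).1 ?_
      · intro a ha
        exact hM a (List.mem_rotate.1 ha)
      · rw [List.map_rotate, hi]
        exact hr p hp

end

end SubsetCycle

namespace SubsetCycle

/-! ### A structured language on top of the random access machine -/

/-- Expressions over numbered variables and numbered two-dimensional arrays. -/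
inductive Expr : Type
  | lit (c : ℕ)
  | var (x : ℕ)
  | add (a b : Expr)
  | sub (a b : Expr)
  | mul (a b : Expr)
  | half (a : Expr)
  | get (j : ℕ) (a b : Expr)

/-- Commands. `ifz e c d` executes `c` if `e` is zero and `d` otherwise; `loop x y c` executes `c`
for `x = 0, …, y - 1`. -/
inductive Cmd : Type
  | skip
  | assign (x : ℕ) (e : Expr)
  | put (j : ℕ) (a b e : Expr)
  | seq (c d : Cmd)
  | ifz (e : Expr) (c d : Cmd)
  | loop (x y : ℕ) (c : Cmd)

/-- The values of the variables and of the arrays. -/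
structure State : Type where
  v : ℕ → ℕ
  A : ℕ → ℕ → ℕ → ℕ

namespace State

def set (s : State) (x a : ℕ) : State := ⟨fun y => if y = x then a else s.v y, s.A⟩

def setA (s : State) (j i c a : ℕ) : State :=
  ⟨s.v, fun j' i' c' => if j' = j ∧ i' = i ∧ c' = c then a else s.A j' i' c'⟩

@[simp] theorem set_v (s : State) (x a y : ℕ) : (s.set x a).v y = if y = x then a else s.v y := rfl
@[simp] theorem set_A (s : State) (x a : ℕ) : (s.set x a).A = s.A := rfl
@[simp] theorem setA_v (s : State) (j i c a : ℕ) : (s.setA j i c a).v = s.v := rfl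
@[simp] theorem setA_A (s : State) (j i c a j' i' c' : ℕ) : (s.setA j i c a).A j' i' c'
    = if j' = j ∧ i' = i ∧ c' = c then a else s.A j' i' c' := rfl

end State

/-! ### Semantics of commands, and what a command may change. -/

section semantics

variable (h w : ℕ)

/-- The value of an expression. Row and column indices are cut off at `h` and `w`. -/
def Expr.eval (s : State) : Expr → ℕ
  | .lit c => c
  | .var x => s.v x
  | .add a b => a.eval s + b.eval s
  | .sub a b => a.eval s - b.eval s
  | .mul a b => a.eval s * b.eval s
  | .half a => a.eval s / 2
  | .get j a b => s.A j (min (a.eval s) h) (min (b.eval s) w)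

/-- The effect of a command. -/
def Cmd.exec : Cmd → State → State
  | .skip, s => s
  | .assign x e, s => s.set x (e.eval h w s)
  | .put j a b e, s => s.setA j (min (a.eval h w s) h) (min (b.eval h w s) w) (e.eval h w s)
  | .seq c d, s => d.exec (c.exec s)
  | .ifz e c d, s => if e.eval h w s = 0 then c.exec s else d.exec s
  | .loop x y c, s => (fun u => (c.exec u).set x ((c.exec u).v x + 1))^[s.v y] (s.set x 0)

end semantics

/-- The variables that a command assigns. -/
def Cmd.writes : Cmd → List ℕ
  | .skip => []
  | .assign x _ => [x]
  | .put _ _ _ _ => []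
  | .seq c d => c.writes ++ d.writes
  | .ifz _ c d => c.writes ++ d.writes
  | .loop x _ c => x :: c.writes

/-- The arrays that a command modifies. -/
def Cmd.arrays : Cmd → List ℕ
  | .skip => []
  | .assign _ _ => []
  | .put j _ _ _ => [j]
  | .seq c d => c.arrays ++ d.arrays
  | .ifz _ c d => c.arrays ++ d.arrays
  | .loop _ _ c => c.arrays

/-- The variables that bound the loops of a command. -/
def Cmd.bounds : Cmd → List ℕ
  | .skip => []
  | .assign _ _ => []
  | .put _ _ _ _ => []
  | .seq c d => c.bounds ++ d.bounds
  | .ifz _ c d => c.bounds ++ d.bounds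
  | .loop _ y c => y :: c.bounds

/-- Together with `Cmd.exec_A`, this frame property reduces the preservation of values to a
decidable check of the syntax. -/
theorem Cmd.exec_v (h w : ℕ) (c : Cmd) (s : State) {z : ℕ} (hz : z ∉ c.writes) :
    (c.exec h w s).v z = s.v z := by
  induction c generalizing s with
  | skip => rfl
  | assign x e =>
    simp only [writes, List.mem_singleton] at hz
    simp [exec, hz]
  | put j a b e => rfl
  | seq c d ihc ihd =>
    simp only [writes, List.mem_append, not_or] at hz
    rw [exec, ihd _ hz.2, ihc _ hz.1]
  | ifz e c d ihc ihd =>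
    simp only [writes, List.mem_append, not_or] at hz
    rw [exec]
    split_ifs
    · exact ihc _ hz.1
    · exact ihd _ hz.2
  | loop x y c ih =>
    simp only [writes, List.mem_cons, not_or] at hz
    rw [exec]
    generalize s.v y = n
    induction n with
    | zero => simp [hz.1]
    | succ n ihn =>
      rw [Function.iterate_succ_apply', State.set_v, if_neg hz.1, ih _ hz.2, ihn]

theorem Cmd.exec_A (h w : ℕ) (c : Cmd) (s : State) {j : ℕ} (hj : j ∉ c.arrays) :
    (c.exec h w s).A j = s.A j := by
  induction c generalizing s with
  | skip => rfl
  | assign x e => rfl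
  | put j a b e =>
    simp only [arrays, List.mem_singleton] at hj
    funext i k
    simp [exec, hj]
  | seq c d ihc ihd =>
    simp only [arrays, List.mem_append, not_or] at hj
    rw [exec, ihd _ hj.2, ihc _ hj.1]
  | ifz e c d ihc ihd =>
    simp only [arrays, List.mem_append, not_or] at hj
    rw [exec]
    split_ifs
    · exact ihc _ hj.1
    · exact ihd _ hj.2
  | loop x y c ih =>
    rw [exec]
    generalize s.v y = n
    induction n with
    | zero => simp
    | succ n ihn =>
      rw [Function.iterate_succ_apply', State.set_A, ih _ hj, ihn]

/-- `s'` agrees with `s` on everything that `c` does not modify. -/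
def Cmd.Agree (c : Cmd) (s s' : State) : Prop :=
  (∀ z, z ∉ c.writes → s'.v z = s.v z) ∧ ∀ j, j ∉ c.arrays → s'.A j = s.A j

theorem Cmd.agree_exec (h w : ℕ) (c : Cmd) (s : State) : c.Agree s (c.exec h w s) :=
  ⟨fun _ hz => c.exec_v h w s hz, fun _ hj => c.exec_A h w s hj⟩

/-- The rule for loops: an invariant that holds initially and is preserved holds finally. -/
theorem Cmd.exec_loop {h w : ℕ} {x y : ℕ} {c : Cmd} {s : State} (Q : ℕ → State → Prop)
    (hx : x ∉ c.writes) (h0 : Q 0 (s.set x 0))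
    (hs : ∀ i u, i < s.v y → u.v x = i → (loop x y c).Agree s u → Q i u →
      Q (i + 1) ((c.exec h w u).set x (i + 1))) :
    Q (s.v y) ((loop x y c).exec h w s) := by
  -- The value of the counter and the frame property are carried along, so that invariants need not
  -- mention them.
  have key : ∀ i, i ≤ s.v y →
      let u := (fun u => (c.exec h w u).set x ((c.exec h w u).v x + 1))^[i] (s.set x 0)
      u.v x = i ∧ (loop x y c).Agree s u ∧ Q i u := by
    intro i hi
    induction i with
    | zero =>
      refine ⟨by simp, ⟨fun z hz => ?_, fun j _ => rfl⟩, h0⟩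
      simp only [writes, List.mem_cons, not_or] at hz
      simp [hz.1]
    | succ i ih =>
      obtain ⟨h1, h2, h3⟩ := ih (by omega)
      simp only [Function.iterate_succ_apply']
      generalize (fun u => (c.exec h w u).set x ((c.exec h w u).v x + 1))^[i] (s.set x 0) = u at *
      have hxv : (c.exec h w u).v x = i := by rw [c.exec_v h w u hx, h1]
      rw [hxv]
      refine ⟨by simp, ⟨fun z hz => ?_, fun j hj => ?_⟩, hs i u (by omega) h1 h2 h3⟩
      · have hz' := hz
        simp only [writes, List.mem_cons, not_or] at hz
        rw [State.set_v, if_neg hz.1, c.exec_v h w u hz.2, h2.1 z hz']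
      · rw [State.set_A, c.exec_A h w u hj, h2.2 j hj]
  exact (key _ le_rfl).2.2

/-! ### Compilation

Registers `0, …, 39` hold the variables, registers `40, …, 43` the bounds `h`, `h + 1`, `w`, `w + 1`
for the array indices, registers `44, …, 63` intermediate results; the arrays follow. -/

/-- The register that holds an entry of an array. -/
def addr (h w j i c : ℕ) : ℕ := 64 + ((j * (h + 1) + i) * (w + 1) + c)

theorem addr_inj {h w j i c j' i' c' : ℕ} (hi : i ≤ h) (hc : c ≤ w) (hi' : i' ≤ h) (hc' : c' ≤ w)
    (he : addr h w j i c = addr h w j' i' c') : j = j' ∧ i = i' ∧ c = c' := by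
  have key : ∀ {m a b a' b' : ℕ}, b ≤ m → b' ≤ m → a * (m + 1) + b = a' * (m + 1) + b' →
      a = a' ∧ b = b' := by
    intro m a b a' b' hb hb' h
    have h1 : (a * (m + 1) + b) / (m + 1) = a := by
      rw [Nat.add_comm, Nat.add_mul_div_right _ _ (by omega), Nat.div_eq_of_lt (by omega)]; omega
    have h2 : (a' * (m + 1) + b') / (m + 1) = a' := by
      rw [Nat.add_comm, Nat.add_mul_div_right _ _ (by omega), Nat.div_eq_of_lt (by omega)]; omega
    have h3 : a = a' := by rw [← h1, h, h2]
    subst h3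
    exact ⟨rfl, by omega⟩
  obtain ⟨h1, h2⟩ := key hc hc' (Nat.add_left_cancel he)
  obtain ⟨h3, h4⟩ := key hi hi' h1
  exact ⟨h3, h4, h2⟩

/-- There are eight arrays, and indices are cut off at h and w, so the space bound holds for every
command without any analysis of the indices it uses. -/
theorem addr_lt {h w j i c : ℕ} (hj : j < 8) (hi : i ≤ h) (hc : c ≤ w) :
    addr h w j i c < 64 + 8 * (h + 1) * (w + 1) := by
  have h1 : j * (h + 1) + i + 1 ≤ 8 * (h + 1) := by nlinarith
  have h2 := Nat.mul_le_mul_right (w + 1) h1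
  rw [addr]
  nlinarith

/-- The instructions that replace the indices in registers `d` and `d + 1` by the address of the
corresponding entry of the array `j`, which is left in register `d`. -/
def addrCode (j d : ℕ) : List Instr :=
  [.sub (d + 2) d 40, .sub d d (d + 2), .sub (d + 2) (d + 1) 42, .sub (d + 1) (d + 1) (d + 2),
    .const (d + 2) j, .mul (d + 2) (d + 2) 41, .add d (d + 2) d, .mul d d 43, .add d d (d + 1),
    .const (d + 1) 64, .add d (d + 1) d]

/-- The instructions that compute the value of an expression in register `d`. -/
def Expr.code : Expr → ℕ → List Instr
  | .lit c, d => [.const d c]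
  | .var x, d => [.copy d x]
  | .add a b, d => a.code d ++ b.code (d + 1) ++ [.add d d (d + 1)]
  | .sub a b, d => a.code d ++ b.code (d + 1) ++ [.sub d d (d + 1)]
  | .mul a b, d => a.code d ++ b.code (d + 1) ++ [.mul d d (d + 1)]
  | .half a, d => a.code d ++ [.half d d]
  | .get j a b, d => a.code d ++ b.code (d + 1) ++ addrCode j d ++ [.load d d]

/-- The expression can be evaluated in the registers `d, …, 63`. -/
def Expr.wf : Expr → ℕ → Bool
  | .lit _, d => d < 64
  | .var x, d => d < 64 && x < 40
  | .add a b, d => a.wf d && b.wf (d + 1)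
  | .sub a b, d => a.wf d && b.wf (d + 1)
  | .mul a b, d => a.wf d && b.wf (d + 1)
  | .half a, d => a.wf d
  | .get j a b, d => a.wf d && b.wf (d + 1) && d + 2 < 64 && j < 8

def Cmd.size : Cmd → ℕ
  | .skip => 0
  | .assign _ e => (e.code 44).length + 1
  | .put j a b e => (a.code 44 ++ b.code 45 ++ addrCode j 44 ++ e.code 45).length + 1
  | .seq c d => c.size + d.size
  | .ifz e c d => (e.code 44).length + 1 + d.size + 1 + c.size
  | .loop _ _ c => 3 + c.size + 3

/-- The machine program for a command, to be placed at position `p`. -/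
def Cmd.compile : Cmd → ℕ → List Instr
  | .skip, _ => []
  | .assign x e, _ => e.code 44 ++ [.copy x 44]
  | .put j a b e, _ => a.code 44 ++ b.code 45 ++ addrCode j 44 ++ e.code 45 ++ [.store 44 45]
  | .seq c d, p => c.compile p ++ d.compile (p + c.size)
  | .ifz e c d, p => e.code 44 ++ ([.jumpZero 44 (p + (e.code 44).length + 1 + d.size + 1)] ++
      (d.compile (p + (e.code 44).length + 1) ++
      ([.jump (p + (e.code 44).length + 1 + d.size + 1 + c.size)] ++
      c.compile (p + (e.code 44).length + 1 + d.size + 1))))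
  | .loop x y c, p => [.const x 0, .sub 44 y x, .jumpZero 44 (p + 3 + c.size + 3)] ++
      (c.compile (p + 3) ++ [.const 44 1, .add x x 44, .jump (p + 1)])

theorem Cmd.length_compile (c : Cmd) (p : ℕ) : (c.compile p).length = c.size := by
  induction c generalizing p with
  | skip => rfl
  | assign x e => simp [compile, size]
  | put j a b e => simp [compile, size]; omega
  | seq c d ihc ihd => simp [compile, size, ihc, ihd]
  | ifz e c d ihc ihd => simp [compile, size, ihc, ihd]; omega
  | loop x y c ih => simp [compile, size, ih]; omega

/-- The body of a loop assigns neither the counter nor the bound, so the number of iterations is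
known on entry. Expressions must fit into the registers for intermediate results. -/
def Cmd.wf : Cmd → Bool
  | .skip => true
  | .assign x e => x < 40 && e.wf 44
  | .put j a b e => a.wf 44 && b.wf 45 && e.wf 45 && j < 8
  | .seq c d => c.wf && d.wf
  | .ifz e c d => e.wf 44 && c.wf && d.wf
  | .loop x y c => x < 40 && y < 40 && x != y && !c.writes.contains x && !c.writes.contains y && c.wf

/-- An upper bound for the number of steps, if `σ` gives the values of the variables that bound the
loops. -/
def Cmd.cost (σ : ℕ → ℕ) : Cmd → ℕ
  | .skip => 0
  | .assign _ e => (e.code 44).length + 1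
  | .put j a b e => (a.code 44 ++ b.code 45 ++ addrCode j 44 ++ e.code 45).length + 1
  | .seq c d => c.cost σ + d.cost σ
  | .ifz e c d => (e.code 44).length + 2 + c.cost σ + d.cost σ
  | .loop _ y c => 3 + σ y * (c.cost σ + 5)

/-! ### Straight-line code -/

/-- The instruction does not jump. -/
def Instr.straight : Instr → Bool
  | .jump _ => false
  | .jumpZero _ _ => false
  | _ => true

/-- The effect of an instruction on the registers. -/
def Instr.effect (i : Instr) (m : ℕ → ℕ) : ℕ → ℕ := (i.exec ⟨0, m⟩).reg

/-- The effect of a list of instructions on the registers. -/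
def effects : List Instr → (ℕ → ℕ) → (ℕ → ℕ)
  | [], m => m
  | i :: l, m => effects l (i.effect m)

/-- Straight-line code that uses only registers with index less than `S`. -/
def SafeCode (S : ℕ) : List Instr → (ℕ → ℕ) → Prop
  | [], _ => True
  | i :: l, m => i.straight = true ∧ (∀ a ∈ i.accessed ⟨0, m⟩, a < S) ∧ SafeCode S l (i.effect m)

theorem effects_append (a b : List Instr) (m : ℕ → ℕ) :
    effects (a ++ b) m = effects b (effects a m) := by
  induction a generalizing m with
  | nil => rfl
  | cons i a ih => exact ih _

theorem safeCode_append {S : ℕ} {a b : List Instr} {m : ℕ → ℕ} :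
    SafeCode S (a ++ b) m ↔ SafeCode S a m ∧ SafeCode S b (effects a m) := by
  induction a generalizing m with
  | nil => simp [SafeCode, effects]
  | cons i a ih => simp only [List.cons_append, SafeCode, effects, ih, and_assoc]

/-- The program `P` contains the list `l` of instructions at position `p`. -/
def CodeAt (P : Program) (p : ℕ) (l : List Instr) : Prop :=
  ∀ k i, l[k]? = some i → P[p + k]? = some i

theorem CodeAt.left {P : Program} {p : ℕ} {a b : List Instr} (h : CodeAt P p (a ++ b)) :
    CodeAt P p a := by
  intro k i hk
  apply h
  have := (List.getElem?_eq_some_iff.1 hk).1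
  rwa [List.getElem?_append_left this]

theorem CodeAt.right {P : Program} {p : ℕ} {a b : List Instr} (h : CodeAt P p (a ++ b)) :
    CodeAt P (p + a.length) b := by
  intro k i hk
  rw [Nat.add_assoc]
  apply h
  rwa [List.getElem?_append_right (by omega), Nat.add_sub_cancel_left]

theorem codeAt_append (a b c : List Instr) : CodeAt (a ++ b ++ c) a.length b := by
  intro k i hk
  have := (List.getElem?_eq_some_iff.1 hk).1
  rw [List.append_assoc, List.getElem?_append_right (by omega), Nat.add_sub_cancel_left,
    List.getElem?_append_left this, hk]

theorem Run.trans {P : Program} {S T T' : ℕ} {c c' c'' : Config} (h : Run P S T c c')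
    (h' : Run P S T' c' c'') : Run P S (T + T') c c'' := by
  induction h with
  | refl => simpa using h'
  | @step T i c c' hi hS _ ih =>
    rw [Nat.add_right_comm]
    exact Run.step hi hS (ih h')

theorem Run.one {P : Program} {S p : ℕ} {m : ℕ → ℕ} {i : Instr} (hi : P[p]? = some i)
    (hS : ∀ a ∈ i.accessed ⟨p, m⟩, a < S) : Run P S 1 ⟨p, m⟩ (i.exec ⟨p, m⟩) :=
  Run.step hi hS (Run.refl _)

/-- Instructions that do not jump act on the registers in the same way at every position, so their
effect may be computed with program counter 0. -/
theorem run_straight {P : Program} {S p : ℕ} {l : List Instr} {m : ℕ → ℕ} (hP : CodeAt P p l)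
    (hl : SafeCode S l m) : Run P S l.length ⟨p, m⟩ ⟨p + l.length, effects l m⟩ := by
  induction l generalizing p m with
  | nil => exact Run.refl _
  | cons i l ih =>
    obtain ⟨h1, h2, h3⟩ := hl
    have hexec : i.exec ⟨p, m⟩ = ⟨p + 1, i.effect m⟩ := by cases i <;> first | rfl | simp [Instr.straight] at h1
    have hacc : i.accessed ⟨p, m⟩ = i.accessed ⟨0, m⟩ := by cases i <;> rfl
    refine Run.step (i := i) ?_ (by rw [hacc]; exact h2) ?_
    · exact hP 0 i rfl
    · rw [hexec, List.length_cons, Nat.add_comm l.length 1, ← Nat.add_assoc]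
      exact ih (CodeAt.right (a := [i]) hP) h3

/-! ### Representation of states in registers, and compiled expressions. -/

section compile

variable {h w : ℕ}

/-- The registers represent a state. -/
structure Rel (h w : ℕ) (s : State) (m : ℕ → ℕ) : Prop where
  vars : ∀ r, r < 40 → m r = s.v r
  h40 : m 40 = h
  h41 : m 41 = h + 1
  h42 : m 42 = w
  h43 : m 43 = w + 1
  arr : ∀ j i c, i ≤ h → c ≤ w → m (addr h w j i c) = s.A j i c

/-- Registers 44 to 63 hold intermediate results and are not part of the state. -/
theorem Rel.congr {s : State} {m m' : ℕ → ℕ} (hR : Rel h w s m)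
    (hm : ∀ r, r < 44 ∨ 64 ≤ r → m' r = m r) : Rel h w s m' where
  vars r hr := by rw [hm r (by omega), hR.vars r hr]
  h40 := by rw [hm _ (by omega), hR.h40]
  h41 := by rw [hm _ (by omega), hR.h41]
  h42 := by rw [hm _ (by omega), hR.h42]
  h43 := by rw [hm _ (by omega), hR.h43]
  arr j i c hi hc := by rw [hm _ (Or.inr (by simp [addr])), hR.arr j i c hi hc]

theorem Rel.set {s : State} {m : ℕ → ℕ} (hR : Rel h w s m) {x a : ℕ} (hx : x < 40) :
    Rel h w (s.set x a) (Function.update m x a) where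
  vars r hr := by
    rw [Function.update_apply, State.set_v, hR.vars r hr]
  h40 := by rw [Function.update_of_ne (by omega), hR.h40]
  h41 := by rw [Function.update_of_ne (by omega), hR.h41]
  h42 := by rw [Function.update_of_ne (by omega), hR.h42]
  h43 := by rw [Function.update_of_ne (by omega), hR.h43]
  arr j i c hi hc := by
    rw [Function.update_of_ne (by simp only [addr]; omega), hR.arr j i c hi hc]; rfl

theorem Rel.setA {s : State} {m : ℕ → ℕ} (hR : Rel h w s m) {j i c a : ℕ} (hi : i ≤ h)
    (hc : c ≤ w) : Rel h w (s.setA j i c a) (Function.update m (addr h w j i c) a) where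
  vars r hr := by
    rw [Function.update_of_ne (by simp only [addr]; omega), hR.vars r hr]; rfl
  h40 := by rw [Function.update_of_ne (by simp only [addr]; omega), hR.h40]
  h41 := by rw [Function.update_of_ne (by simp only [addr]; omega), hR.h41]
  h42 := by rw [Function.update_of_ne (by simp only [addr]; omega), hR.h42]
  h43 := by rw [Function.update_of_ne (by simp only [addr]; omega), hR.h43]
  arr j' i' c' hi' hc' := by
    rw [Function.update_apply, State.setA_A, hR.arr j' i' c' hi' hc']
    refine if_congr ⟨fun he => addr_inj hi' hc' hi hc he, ?_⟩ rfl rfl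
    rintro ⟨rfl, rfl, rfl⟩
    rfl

/-- The way in which `addrCode` cuts off an index by truncated subtraction. -/
theorem sub_sub_eq_min (a b : ℕ) : a - (a - b) = min a b := by omega

theorem addrCode_spec {m : ℕ → ℕ} {j d S : ℕ} (hd : 44 ≤ d) (hd' : d + 2 < 64) (hS : 64 ≤ S)
    (h40 : m 40 = h) (h41 : m 41 = h + 1) (h42 : m 42 = w) (h43 : m 43 = w + 1) :
    SafeCode S (addrCode j d) m ∧
    effects (addrCode j d) m d = addr h w j (min (m d) h) (min (m (d + 1)) w) ∧
    ∀ r, r < d ∨ 64 ≤ r → effects (addrCode j d) m r = m r := by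
  refine ⟨?_, ?_, ?_⟩
  · simp only [addrCode, SafeCode, Instr.straight, Instr.accessed, List.mem_cons, List.not_mem_nil,
      or_false, forall_eq_or_imp, forall_eq, and_true, true_and]
    omega
  · have e1 : d ≠ 40 := by omega
    have e2 : d ≠ 41 := by omega
    have e3 : d ≠ 42 := by omega
    have e4 : d ≠ 43 := by omega
    simp only [addrCode, effects, Instr.effect, Instr.exec, Config.write, Function.update_apply]
    have f1 : (42 : ℕ) ≠ d + 2 := by omega
    have f2 : (41 : ℕ) ≠ d + 2 := by omega
    have f3 : (43 : ℕ) ≠ d + 2 := by omega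
    have f4 : (42 : ℕ) ≠ d := by omega
    have f5 : (41 : ℕ) ≠ d := by omega
    have f6 : (43 : ℕ) ≠ d := by omega
    have f8 : (41 : ℕ) ≠ d + 1 := by omega
    have f9 : (43 : ℕ) ≠ d + 1 := by omega
    simp [f1, f2, f3, f4, f5, f6, f8, f9, h40, h41, h42, h43, addr, sub_sub_eq_min]
  · intro r hr
    have e1 : r ≠ d := by omega
    have e2 : r ≠ d + 1 := by omega
    have e3 : r ≠ d + 2 := by omega
    simp only [addrCode, effects, Instr.effect, Instr.exec, Config.write, Function.update_apply,
      e1, e2, e3, if_false]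

/-- Evaluation into register d leaves all registers below d alone, so the value of a left operand in
register d survives the evaluation of the right operand into register d + 1. -/
theorem Expr.code_spec {S : ℕ} (hS : S = 64 + 8 * (h + 1) * (w + 1)) (e : Expr) {d : ℕ}
    {s : State} {m : ℕ → ℕ} (hd : 44 ≤ d) (hR : Rel h w s m) (hwf : e.wf d = true) :
    SafeCode S (e.code d) m ∧ effects (e.code d) m d = e.eval h w s ∧
    ∀ r, r < d ∨ 64 ≤ r → effects (e.code d) m r = m r := by
  have hS64 : 64 ≤ S := by omega
  have two : ∀ (a b : Expr) (d : ℕ) (m : ℕ → ℕ), 44 ≤ d → Rel h w s m →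
      (∀ {d : ℕ} {m : ℕ → ℕ}, 44 ≤ d → Rel h w s m → a.wf d = true →
        SafeCode S (a.code d) m ∧ effects (a.code d) m d = a.eval h w s ∧
        ∀ r, r < d ∨ 64 ≤ r → effects (a.code d) m r = m r) →
      (∀ {d : ℕ} {m : ℕ → ℕ}, 44 ≤ d → Rel h w s m → b.wf d = true →
        SafeCode S (b.code d) m ∧ effects (b.code d) m d = b.eval h w s ∧
        ∀ r, r < d ∨ 64 ≤ r → effects (b.code d) m r = m r) →
      a.wf d = true → b.wf (d + 1) = true →
      SafeCode S (a.code d ++ b.code (d + 1)) m ∧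
      effects (a.code d ++ b.code (d + 1)) m d = a.eval h w s ∧
      effects (a.code d ++ b.code (d + 1)) m (d + 1) = b.eval h w s ∧
      ∀ r, r < d ∨ 64 ≤ r → effects (a.code d ++ b.code (d + 1)) m r = m r := by
    intro a b d m hd hR iha ihb ha hb
    obtain ⟨a1, a2, a3⟩ := iha hd hR ha
    obtain ⟨b1, b2, b3⟩ := ihb (by omega) (hR.congr fun r hr => a3 r (by omega)) hb
    rw [safeCode_append, effects_append]
    refine ⟨⟨a1, b1⟩, by rw [b3 d (by omega), a2], b2, fun r hr => ?_⟩
    rw [b3 r (by omega), a3 r hr]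
  have bin : ∀ (f : ℕ → Instr) (g : ℕ → ℕ → ℕ) (l : List Instr) (d : ℕ) (m : ℕ → ℕ) (x y : ℕ),
      d < 64 → d + 1 < 64 →
      (∀ d, (f d).straight = true) → (∀ d m, (f d).accessed ⟨0, m⟩ = [d, d, d + 1]) →
      (∀ d m, (f d).effect m = Function.update m d (g (m d) (m (d + 1)))) →
      SafeCode S l m ∧ effects l m d = x ∧ effects l m (d + 1) = y ∧
        (∀ r, r < d ∨ 64 ≤ r → effects l m r = m r) →
      SafeCode S (l ++ [f d]) m ∧ effects (l ++ [f d]) m d = g x y ∧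
        ∀ r, r < d ∨ 64 ≤ r → effects (l ++ [f d]) m r = m r := by
    intro f g l d m x y hd hd1 hf1 hf2 hf3 ⟨l1, l2, l3, l4⟩
    rw [safeCode_append, effects_append]
    simp only [SafeCode, effects, hf1, hf2, hf3, l2, l3, Function.update_self, and_true, true_and]
    refine ⟨⟨l1, fun a ha => ?_⟩, fun r hr => ?_⟩
    · simp only [List.mem_cons, List.not_mem_nil, or_false] at ha
      omega
    · rw [Function.update_of_ne (by omega), l4 r hr]
  have hwfd : ∀ (e : Expr) (d : ℕ), e.wf d = true → d < 64 := by
    intro e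
    induction e with
    | lit c => intro d h; simpa [wf] using h
    | var x => intro d h; simp [wf] at h; exact h.1
    | add a b iha _ => intro d h; simp [wf] at h; exact iha d h.1
    | sub a b iha _ => intro d h; simp [wf] at h; exact iha d h.1
    | mul a b iha _ => intro d h; simp [wf] at h; exact iha d h.1
    | half a iha => intro d h; exact iha d h
    | get j a b iha _ => intro d h; simp [wf] at h; omega
  induction e generalizing d m with
  | lit c =>
    have := hwfd _ _ hwf
    simp only [code, SafeCode, effects, Instr.straight, Instr.accessed, Instr.effect, Instr.exec,
      Config.write, eval, List.mem_singleton, forall_eq, Function.update_self]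
    refine ⟨⟨trivial, by omega, trivial⟩, trivial, fun r hr => ?_⟩
    rw [Function.update_of_ne (by omega)]
  | var x =>
    have := hwfd _ _ hwf
    simp only [wf, Bool.and_eq_true, decide_eq_true_eq] at hwf
    simp only [code, SafeCode, effects, Instr.straight, Instr.accessed, Instr.effect, Instr.exec,
      Config.write, eval, List.mem_cons, List.not_mem_nil, or_false, forall_eq_or_imp, forall_eq,
      Function.update_self]
    refine ⟨⟨trivial, ⟨by omega, by omega⟩, trivial⟩, hR.vars x hwf.2, fun r hr => ?_⟩
    rw [Function.update_of_ne (by omega)]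
  | add a b iha ihb =>
    simp only [wf, Bool.and_eq_true] at hwf
    exact bin (fun d => .add d d (d + 1)) (· + ·) _ d m _ _ (hwfd _ _ hwf.1) (hwfd _ _ hwf.2)
      (fun _ => rfl) (fun _ _ => rfl) (fun _ _ => rfl) (two a b d m hd hR iha ihb hwf.1 hwf.2)
  | sub a b iha ihb =>
    simp only [wf, Bool.and_eq_true] at hwf
    exact bin (fun d => .sub d d (d + 1)) (· - ·) _ d m _ _ (hwfd _ _ hwf.1) (hwfd _ _ hwf.2)
      (fun _ => rfl) (fun _ _ => rfl) (fun _ _ => rfl) (two a b d m hd hR iha ihb hwf.1 hwf.2)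
  | mul a b iha ihb =>
    simp only [wf, Bool.and_eq_true] at hwf
    exact bin (fun d => .mul d d (d + 1)) (· * ·) _ d m _ _ (hwfd _ _ hwf.1) (hwfd _ _ hwf.2)
      (fun _ => rfl) (fun _ _ => rfl) (fun _ _ => rfl) (two a b d m hd hR iha ihb hwf.1 hwf.2)
  | half a iha =>
    have := hwfd _ _ hwf
    obtain ⟨a1, a2, a3⟩ := iha hd hR hwf
    rw [code, safeCode_append, effects_append]
    simp only [SafeCode, effects, Instr.straight, Instr.accessed, Instr.effect, Instr.exec,
      Config.write, eval, List.mem_cons, List.not_mem_nil, or_false, forall_eq_or_imp, forall_eq,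
      Function.update_self, a2]
    refine ⟨⟨a1, trivial, ⟨by omega, by omega⟩, trivial⟩, trivial, fun r hr => ?_⟩
    rw [Function.update_of_ne (by omega), a3 r hr]
  | get j a b iha ihb =>
    simp only [wf, Bool.and_eq_true, decide_eq_true_eq] at hwf
    obtain ⟨⟨⟨wa, wb⟩, hd2⟩, hj⟩ := hwf
    obtain ⟨t1, t2, t3, t4⟩ := two a b d m hd hR iha ihb wa wb
    have hR' := hR.congr (m' := effects (a.code d ++ b.code (d + 1)) m)
      fun r hr => t4 r (by omega)
    obtain ⟨u1, u2, u3⟩ := addrCode_spec (j := j) hd hd2 hS64 hR'.h40 hR'.h41 hR'.h42 hR'.h43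
    rw [t2, t3] at u2
    rw [code]
    generalize addrCode j d = l at *
    generalize a.code d ++ b.code (d + 1) = l' at *
    simp only [safeCode_append, effects_append]
    generalize effects l' m = m₁ at *
    generalize effects l m₁ = m₂ at *
    have hlt := addr_lt (h := h) (w := w) hj (min_le_right (a.eval h w s) h)
      (min_le_right (b.eval h w s) w)
    have hge : 64 ≤ addr h w j (min (a.eval h w s) h) (min (b.eval h w s) w) :=
      Nat.le_add_right _ _
    have harr := hR'.arr j _ _ (min_le_right (a.eval h w s) h) (min_le_right (b.eval h w s) w)
    rw [← hS] at hlt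
    rw [← u3 _ (Or.inr hge), ← u2] at harr
    rw [← u2] at hlt
    refine ⟨⟨⟨t1, u1⟩, rfl, ?_, trivial⟩, ?_, fun r hr => ?_⟩
    · intro x hx
      simp only [Instr.accessed, List.mem_cons, List.not_mem_nil, or_false] at hx
      rcases hx with rfl | rfl | rfl
      · omega
      · omega
      · exact hlt
    · change Function.update m₂ d (m₂ (m₂ d)) d = _
      rw [Function.update_self, harr]
      rfl
    · change Function.update m₂ d (m₂ (m₂ d)) r = _
      rw [Function.update_of_ne (by omega), u3 r hr, t4 r hr]

end compile

end SubsetCycle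

/-! ### Correctness and running time of compiled commands. -/

namespace SubsetCycle

section

variable {h w : ℕ}

theorem Expr.run {S : ℕ} (hS : S = 64 + 8 * (h + 1) * (w + 1)) (e : Expr) {P : Program} {p : ℕ}
    {s : State} {m : ℕ → ℕ} (hP : CodeAt P p (e.code 44)) (hR : Rel h w s m)
    (hwf : e.wf 44 = true) : ∃ m', Run P S (e.code 44).length ⟨p, m⟩ ⟨p + (e.code 44).length, m'⟩ ∧
      Rel h w s m' ∧ m' 44 = e.eval h w s := by
  obtain ⟨h1, h2, h3⟩ := e.code_spec hS le_rfl hR hwf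
  exact ⟨_, run_straight hP h1, hR.congr h3, h2⟩

/-- Compiled commands do what they should, within the time given by `Cmd.cost`. -/
theorem Cmd.run {S : ℕ} (hS : S = 64 + 8 * (h + 1) * (w + 1)) {P : Program} (σ : ℕ → ℕ) (c : Cmd) :
    ∀ {p : ℕ} {s : State} {m : ℕ → ℕ}, CodeAt P p (c.compile p) → Rel h w s m → c.wf = true →
      (∀ y ∈ c.bounds, s.v y = σ y ∧ y ∉ c.writes) →
      ∃ T m', Run P S T ⟨p, m⟩ ⟨p + c.size, m'⟩ ∧ Rel h w (c.exec h w s) m' ∧ T ≤ c.cost σ := by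
  induction c with
  | skip =>
    intro p s m _ hR _ _
    exact ⟨0, m, Run.refl _, hR, le_rfl⟩
  | assign x e =>
    intro p s m hP hR hwf _
    simp only [wf, Bool.and_eq_true, decide_eq_true_eq] at hwf
    obtain ⟨m', h1, h2, h3⟩ := e.run hS hP.left hR hwf.2
    have hi : P[p + (e.code 44).length]? = some (.copy x 44) := hP.right 0 _ rfl
    refine ⟨_, _, h1.trans (Run.one hi ?_), ?_, le_rfl⟩
    · simp only [Instr.accessed, List.mem_cons, List.not_mem_nil, or_false]
      omega
    · change Rel h w _ (Function.update m' x (m' 44))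
      rw [h3]
      exact h2.set hwf.1
  | put j a b e =>
    intro p s m hP hR hwf _
    simp only [wf, Bool.and_eq_true, decide_eq_true_eq] at hwf
    obtain ⟨⟨⟨wa, wb⟩, we⟩, hj⟩ := hwf
    have hS64 : 64 ≤ S := by omega
    obtain ⟨a1, a2, a3⟩ := a.code_spec hS le_rfl hR wa
    have hR1 := hR.congr a3
    obtain ⟨b1, b2, b3⟩ := b.code_spec hS (d := 45) (by omega) hR1 wb
    have hR2 := hR1.congr fun r hr => b3 r (by omega)
    obtain ⟨u1, u2, u3⟩ := addrCode_spec (j := j) (d := 44) le_rfl (by omega) hS64 hR2.h40 hR2.h41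
      hR2.h42 hR2.h43
    have hR3 := hR2.congr u3
    obtain ⟨e1, e2, e3⟩ := e.code_spec hS (d := 45) (by omega) hR3 we
    have hR4 := hR3.congr fun r hr => e3 r (by omega)
    rw [b2, b3 44 (by omega), a2] at u2
    rw [← e3 44 (by omega)] at u2
    have hsafe : SafeCode S (a.code 44 ++ b.code 45 ++ addrCode j 44 ++ e.code 45) m := by
      simp only [safeCode_append, effects_append]
      exact ⟨⟨⟨a1, b1⟩, u1⟩, e1⟩
    have hrun := run_straight hP.left hsafe
    have hi := hP.right 0 _ rfl
    simp only [effects_append] at hrun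
    have hlt := addr_lt (h := h) (w := w) hj (min_le_right (a.eval h w s) h)
      (min_le_right (b.eval h w s) w)
    rw [← u2, ← hS] at hlt
    have hfin := hR4.setA (j := j) (a := e.eval h w s) (min_le_right (a.eval h w s) h)
      (min_le_right (b.eval h w s) w)
    rw [← u2] at hfin
    rw [← e2] at hfin
    generalize effects (e.code 45) _ = m4 at *
    refine ⟨_, _, hrun.trans (Run.one hi ?_), ?_, le_rfl⟩
    · simp only [Instr.accessed, List.mem_cons, List.not_mem_nil, or_false]
      rintro x (rfl | rfl | rfl)
      · omega
      · omega
      · exact hlt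
    · change Rel h w _ (Function.update m4 (m4 44) (m4 45))
      rw [exec, ← e2]
      exact hfin
  | seq c d ihc ihd =>
    intro p s m hP hR hwf hb
    simp only [wf, Bool.and_eq_true] at hwf
    simp only [bounds, writes, List.mem_append, not_or] at hb
    obtain ⟨T1, m1, r1, hR1, hT1⟩ := ihc hP.left hR hwf.1
      fun y hy => ⟨(hb y (Or.inl hy)).1, (hb y (Or.inl hy)).2.1⟩
    have hP2 := hP.right
    rw [length_compile] at hP2
    obtain ⟨T2, m2, r2, hR2, hT2⟩ := ihd hP2 hR1 hwf.2 fun y hy => by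
      have := hb y (Or.inr hy)
      exact ⟨by rw [c.exec_v h w s this.2.1, this.1], this.2.2⟩
    rw [Nat.add_assoc] at r2
    exact ⟨T1 + T2, m2, r1.trans r2, hR2, Nat.add_le_add hT1 hT2⟩
  | ifz e c d ihc ihd =>
    intro p s m hP hR hwf hb
    simp only [wf, Bool.and_eq_true] at hwf
    obtain ⟨⟨we, wc⟩, wd⟩ := hwf
    simp only [bounds, writes, List.mem_append, not_or] at hb
    obtain ⟨m1, r1, hR1, h44⟩ := e.run hS hP.left hR we
    have hP1 := hP.right
    have hj1 : P[p + (e.code 44).length]? = _ := hP1.left 0 _ rfl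
    have hP2 := hP1.right
    have hP3 := hP2.right
    have hj2 : P[_]? = _ := hP3.left 0 _ rfl
    have hP4 := hP3.right
    simp only [length_compile, List.length_singleton, Nat.add_zero] at hP2 hP3 hP4 hj2
    have hone := Run.one (S := S) (m := m1) hj1 (by
      simp only [Instr.accessed, List.mem_singleton, forall_eq]; omega)
    have hexec : ∀ l, (Instr.jumpZero 44 l).exec ⟨p + (e.code 44).length, m1⟩
        = ⟨if e.eval h w s = 0 then l else p + (e.code 44).length + 1, m1⟩ := by
      intro l
      simp [Instr.exec, h44]
    rw [hexec] at hone
    rw [exec]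
    by_cases h0 : e.eval h w s = 0
    · rw [if_pos h0] at hone ⊢
      obtain ⟨T1, m2, r2, hR2, hT⟩ := ihc hP4 hR1 wc
        fun y hy => ⟨(hb y (Or.inl hy)).1, (hb y (Or.inl hy)).2.1⟩
      have e1 : p + (ifz e c d).size = p + (e.code 44).length + 1 + d.size + 1 + c.size := by
        simp only [size]; omega
      rw [← e1] at r2
      exact ⟨_, m2, (r1.trans hone).trans r2, hR2, by simp only [cost]; omega⟩
    · rw [if_neg h0] at hone ⊢
      obtain ⟨T1, m2, r2, hR2, hT⟩ := ihd hP2.left hR1 wd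
        fun y hy => ⟨(hb y (Or.inr hy)).1, (hb y (Or.inr hy)).2.2⟩
      have hjump := Run.one (S := S) (m := m2) hj2 (by simp [Instr.accessed])
      have e1 : p + (ifz e c d).size = p + (e.code 44).length + 1 + d.size + 1 + c.size := by
        simp only [size]; omega
      rw [e1]
      exact ⟨_, m2, (r1.trans hone).trans (r2.trans hjump), hR2, by simp only [cost]; omega⟩
  | loop x y c ih =>
    intro p s m hP hR hwf hb
    simp only [wf, Bool.and_eq_true, decide_eq_true_eq, Bool.not_eq_true', bne_iff_ne, ne_eq,
      List.contains_eq_mem, decide_eq_false_iff_not] at hwf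
    obtain ⟨⟨⟨⟨⟨hx, hy⟩, hxy⟩, hxw⟩, hyw⟩, hc⟩ := hwf
    simp only [bounds, writes, List.mem_cons, not_or] at hb
    have hS64 : 64 ≤ S := by omega
    have hPh := hP.left
    have hi0 : P[p]? = _ := hPh 0 _ rfl
    have hi1 : P[p + 1]? = _ := hPh 1 _ rfl
    have hi2 : P[p + 2]? = _ := hPh 2 _ rfl
    have hPb := hP.right.left
    have hPt := hP.right.right
    simp only [length_compile, List.length_cons, List.length_nil, zero_add, Nat.reduceAdd]
      at hPb hPt
    have hi3 : P[p + 3 + c.size]? = _ := hPt 0 _ rfl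
    have hi4 : P[p + 3 + c.size + 1]? = _ := hPt 1 _ rfl
    have hi5 : P[p + 3 + c.size + 2]? = _ := hPt 2 _ rfl
    set f : State → State := fun u => (c.exec h w u).set x ((c.exec h w u).v x + 1) with hf
    -- The claim starts at the test, after the counter has been initialised, and k is the number of
    -- remaining iterations.
    have key : ∀ k (u : State) (m : ℕ → ℕ), Rel h w u m → u.v y = σ y → u.v x + k = σ y →
        (∀ z ∈ c.bounds, u.v z = σ z) →
        ∃ T m', Run P S T ⟨p + 1, m⟩ ⟨p + (loop x y c).size, m'⟩ ∧ Rel h w (f^[k] u) m' ∧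
          T ≤ k * (c.cost σ + 5) + 2 := by
      intro k
      induction k with
      | zero =>
        intro u m hR huy hux _
        have s1 := Run.one (S := S) (m := m) hi1 (by
          simp only [Instr.accessed, List.mem_cons, List.not_mem_nil, or_false, forall_eq_or_imp,
            forall_eq]
          omega)
        have hR' : Rel h w u (Function.update m 44 (m y - m x)) := hR.congr fun r hr =>
          Function.update_of_ne (by omega) _ _
        have s2 := Run.one (S := S) (m := Function.update m 44 (m y - m x)) hi2 (by
          simp only [Instr.accessed, List.mem_singleton, forall_eq]; omega)
        have e2 : (Instr.jumpZero 44 (p + 3 + c.size + 3)).exec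
            ⟨p + 2, Function.update m 44 (m y - m x)⟩
            = ⟨p + (loop x y c).size, Function.update m 44 (m y - m x)⟩ := by
          simp only [Instr.exec, Function.update_self, hR.vars x hx, hR.vars y hy]
          rw [if_pos (by omega)]
          simp only [size]
          congr 1; omega
        rw [e2] at s2
        exact ⟨1 + 1, _, s1.trans s2, hR', by omega⟩
      | succ k ihk =>
        intro u m hR huy hux hub
        have s1 := Run.one (S := S) (m := m) hi1 (by
          simp only [Instr.accessed, List.mem_cons, List.not_mem_nil, or_false, forall_eq_or_imp,
            forall_eq]
          omega)
        have hR' : Rel h w u (Function.update m 44 (m y - m x)) := hR.congr fun r hr =>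
          Function.update_of_ne (by omega) _ _
        have s2 := Run.one (S := S) (m := Function.update m 44 (m y - m x)) hi2 (by
          simp only [Instr.accessed, List.mem_singleton, forall_eq]; omega)
        have e2 : (Instr.jumpZero 44 (p + 3 + c.size + 3)).exec
            ⟨p + 2, Function.update m 44 (m y - m x)⟩
            = ⟨p + 3, Function.update m 44 (m y - m x)⟩ := by
          simp only [Instr.exec, Function.update_self, hR.vars x hx, hR.vars y hy]
          rw [if_neg (by omega)]
        rw [e2] at s2
        obtain ⟨T, m2, s3, hR2, hT⟩ := ih hPb hR' hc
          fun z hz => ⟨hub z hz, (hb z (Or.inr hz)).2.2⟩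
        have s4 := Run.one (S := S) (m := m2) hi3 (by
          simp only [Instr.accessed, List.mem_singleton, forall_eq]; omega)
        have hR3 : Rel h w (c.exec h w u) (Function.update m2 44 1) := hR2.congr fun r hr =>
          Function.update_of_ne (by omega) _ _
        have s5 := Run.one (S := S) (m := Function.update m2 44 1) hi4 (by
          simp only [Instr.accessed, List.mem_cons, List.not_mem_nil, or_false, forall_eq_or_imp,
            forall_eq]
          omega)
        have hR4 : Rel h w (f u) (Function.update (Function.update m2 44 1) x
            (Function.update m2 44 1 x + Function.update m2 44 1 44)) := by
          rw [hR3.vars x hx, Function.update_self]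
          exact hR3.set hx
        have s6 := Run.one (S := S) (m := Function.update (Function.update m2 44 1) x
            (Function.update m2 44 1 x + Function.update m2 44 1 44)) hi5 (by
              simp [Instr.accessed])
        obtain ⟨T', m5, s7, hR5, hT'⟩ := ihk (f u) _ hR4
          (by rw [hf]; simp only [State.set_v]; rw [if_neg (Ne.symm hxy), c.exec_v h w u hyw, huy])
          (by rw [hf]; simp only [State.set_v]; rw [if_pos trivial, c.exec_v h w u hxw]; omega)
          (fun z hz => by
            have h1 := hb z (Or.inr hz)
            rw [hf]; simp only [State.set_v]
            rw [if_neg h1.2.1, c.exec_v h w u h1.2.2, hub z hz])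
        refine ⟨1 + (1 + (T + (1 + (1 + (1 + T'))))), m5, ?_, ?_, ?_⟩
        · exact s1.trans (s2.trans (s3.trans (s4.trans (s5.trans (s6.trans s7)))))
        · rw [Function.iterate_succ_apply]; exact hR5
        · have : (k + 1) * (c.cost σ + 5) = k * (c.cost σ + 5) + (c.cost σ + 5) := by ring
          omega
    have hby := (hb y (Or.inl rfl)).1
    have s0 := Run.one (S := S) (m := m) hi0 (by
      simp only [Instr.accessed, List.mem_singleton, forall_eq]; omega)
    obtain ⟨T, m', h1, h2, h3⟩ := key (s.v y) (s.set x 0) (Function.update m x 0) (hR.set hx)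
      (by rw [State.set_v, if_neg (Ne.symm hxy), hby]) (by rw [State.set_v, if_pos rfl]; omega)
      (fun z hz => by
        have h1 := hb z (Or.inr hz)
        rw [State.set_v, if_neg h1.2.1, h1.1])
    refine ⟨1 + T, m', s0.trans h1, h2, ?_⟩
    simp only [cost]
    rw [hby] at h3
    omega

end

end SubsetCycle

namespace SubsetCycle

/-! ### A bound for the number of steps -/

/-- The largest product of the bounds of nested loops. -/
def Cmd.weight (g : ℕ → ℕ) : Cmd → ℕ
  | .skip => 1
  | .assign _ _ => 1
  | .put _ _ _ _ => 1
  | .seq c d => max (c.weight g) (d.weight g)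
  | .ifz _ c d => max (c.weight g) (d.weight g)
  | .loop _ y c => g y * c.weight g

theorem Cmd.one_le_weight {g : ℕ → ℕ} (c : Cmd) (hg : ∀ y ∈ c.bounds, 1 ≤ g y) :
    1 ≤ c.weight g := by
  induction c with
  | skip => exact le_rfl
  | assign => exact le_rfl
  | put => exact le_rfl
  | seq c d ihc _ => exact (ihc fun y hy => hg y (List.mem_append_left _ hy)).trans (le_max_left _ _)
  | ifz e c d ihc _ =>
    exact (ihc fun y hy => hg y (List.mem_append_left _ hy)).trans (le_max_left _ _)
  | loop x y c ih =>
    exact Nat.mul_pos (hg y (List.mem_cons_self ..)) (ih fun z hz => hg z (List.mem_cons_of_mem _ hz))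

/-- The cost arises from constants by sums and by multiplication with loop bounds. Each bound is at
most twice its g, so the cost with all bounds equal to 2, which depends on the command alone, times
the largest product of nested g's is an upper bound. -/
theorem Cmd.cost_le {g σ : ℕ → ℕ} (c : Cmd) (hg : ∀ y ∈ c.bounds, 1 ≤ g y)
    (hσ : ∀ y ∈ c.bounds, σ y ≤ 2 * g y) :
    c.cost σ ≤ c.cost (fun _ => 2) * c.weight g := by
  induction c with
  | skip => simp [cost]
  | assign => simp [cost, weight]
  | put => simp [cost, weight]
  | seq c d ihc ihd =>
    have h1 := ihc (fun y hy => hg y (List.mem_append_left _ hy))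
      fun y hy => hσ y (List.mem_append_left _ hy)
    have h2 := ihd (fun y hy => hg y (List.mem_append_right _ hy))
      fun y hy => hσ y (List.mem_append_right _ hy)
    simp only [cost, weight]
    rw [Nat.add_mul]
    exact Nat.add_le_add (h1.trans (Nat.mul_le_mul_left _ (le_max_left _ _)))
      (h2.trans (Nat.mul_le_mul_left _ (le_max_right _ _)))
  | ifz e c d ihc ihd =>
    have h1 := ihc (fun y hy => hg y (List.mem_append_left _ hy))
      fun y hy => hσ y (List.mem_append_left _ hy)
    have h2 := ihd (fun y hy => hg y (List.mem_append_right _ hy))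
      fun y hy => hσ y (List.mem_append_right _ hy)
    have h0 := (ifz e c d).one_le_weight hg
    simp only [cost, weight] at h0 ⊢
    rw [Nat.add_mul, Nat.add_mul]
    exact Nat.add_le_add (Nat.add_le_add (Nat.le_mul_of_pos_right _ h0)
      (h1.trans (Nat.mul_le_mul_left _ (le_max_left _ _))))
      (h2.trans (Nat.mul_le_mul_left _ (le_max_right _ _)))
  | loop x y c ih =>
    have hgc : ∀ z ∈ c.bounds, 1 ≤ g z := fun z hz => hg z (List.mem_cons_of_mem _ hz)
    have h1 := ih hgc fun z hz => hσ z (List.mem_cons_of_mem _ hz)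
    have h2 := c.one_le_weight hgc
    have h3 := hg y (List.mem_cons_self ..)
    have h4 := hσ y (List.mem_cons_self ..)
    simp only [cost, weight]
    calc 3 + σ y * (c.cost σ + 5)
        ≤ 3 * (g y * c.weight g) + 2 * g y * ((c.cost fun _ => 2) * c.weight g + 5 * c.weight g) := by
          refine Nat.add_le_add ?_ (Nat.mul_le_mul h4 (Nat.add_le_add h1 (by omega)))
          exact Nat.le_mul_of_pos_right _ (Nat.mul_pos h3 h2)
      _ = (3 + 2 * ((c.cost fun _ => 2) + 5)) * (g y * c.weight g) := by ring

/-! ### Loops that fill a table -/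

/-- The table is filled row by row: the computation of an entry may use all lexicographically
earlier ones, and in array j it may change that entry only. -/
theorem Cmd.exec_fill {h w : ℕ} {i b N M j : ℕ} {c : Cmd} {s : State} (f : ℕ → ℕ → ℕ)
    (hi : i ∉ (loop b M c).writes) (hb : b ∉ c.writes) (hM : M ∉ (loop i N (loop b M c)).writes)
    (step : ∀ p q u, p < s.v N → q < s.v M → u.v i = p → u.v b = q →
      (loop i N (loop b M c)).Agree s u →
      (∀ p' q', p' < s.v N → q' < s.v M → (p' < p ∨ p' = p ∧ q' < q) → u.A j p' q' = f p' q') →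
      ∀ p' q', (c.exec h w u).A j p' q' = if p' = p ∧ q' = q then f p q else u.A j p' q')
    {p q : ℕ} (hp : p < s.v N) (hq : q < s.v M) :
    ((loop i N (loop b M c)).exec h w s).A j p q = f p q := by
  refine Cmd.exec_loop (Q := fun n u => ∀ p q, p < n → q < s.v M → u.A j p q = f p q) hi
    (fun p q hp => absurd hp (Nat.not_lt_zero _)) ?_ p q hp hq
  intro p u hp hup hu hQ p' q' hp' hq'
  rw [State.set_A]
  have hM1 : u.v M = s.v M := hu.1 M hM
  have hw : i ∉ c.writes := fun hc => hi (List.mem_cons_of_mem _ hc)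
  have hib : i ≠ b := fun hc => hi (hc ▸ List.mem_cons_self ..)
  refine Cmd.exec_loop (s := u) (y := M) (Q := fun n v => ∀ p' q', p' ≤ p → q' < s.v M →
    (p' < p ∨ q' < n) → v.A j p' q' = f p' q') hb ?_ ?_ p' q' (by omega) hq' (Or.inr (by omega))
  · intro p' q' hp' hq' hc
    exact hQ p' q' (by omega) hq'
  · intro q v hq hvb hv hQv p' q' hp' hq' hc
    have hvi : v.v i = p := by rw [hv.1 i (by simpa [writes] using ⟨hib, hw⟩), hup]
    have hag : (loop i N (loop b M c)).Agree s v := by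
      refine ⟨fun z hz => ?_, fun z hz => ?_⟩
      · rw [hv.1 z fun hc => hz (List.mem_cons_of_mem _ hc), hu.1 z hz]
      · rw [hv.2 z hz, hu.2 z hz]
    rw [State.set_A, step p q v hp (by omega) hvi hvb hag]
    · split_ifs with hpq
      · rw [hpq.1, hpq.2]
      · exact hQv p' q' hp' hq' (by omega)
    · intro p'' q'' _ h2 h3
      exact hQv p'' q'' (by omega) h2 (by omega)

/-- A loop that fills a row of a table. -/
theorem Cmd.exec_fillRow {h w : ℕ} {b M j r : ℕ} {c : Cmd} {s : State} (f : ℕ → ℕ)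
    (hb : b ∉ c.writes)
    (step : ∀ q u, q < s.v M → u.v b = q → (loop b M c).Agree s u →
      (∀ q' < q, u.A j r q' = f q') →
      ∀ q', (c.exec h w u).A j r q' = if q' = q then f q else u.A j r q')
    {q : ℕ} (hq : q < s.v M) : ((loop b M c).exec h w s).A j r q = f q := by
  refine Cmd.exec_loop (Q := fun n u => ∀ q, q < n → u.A j r q = f q) hb
    (fun q hq => absurd hq (Nat.not_lt_zero _)) ?_ q hq
  intro q u hq huq hu hQ q' hq'
  rw [State.set_A, step q u hq huq hu hQ]
  split_ifs with hc
  · rw [hc]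
  · exact hQ q' (by omega)

end SubsetCycle

namespace SubsetCycle

/-! ### The program for `closedCount`

Variables `1, …, 4` hold `t`, `t + 1`, `M` and `M + 1`; the string `y` is row `0` of array `2`. -/

/-- Array `3` receives the table of borders of `y`. -/
def borderCmd : Cmd :=
  .loop 10 2 (.loop 11 1 (.ifz (.var 11) (.put 3 (.var 10) (.var 11) (.lit 1))
    (.ifz (.var 10) (.put 3 (.var 10) (.var 11) (.lit 0))
      (.put 3 (.var 10) (.var 11) (.mul
        (.get 3 (.sub (.var 10) (.lit 1)) (.sub (.var 11) (.lit 1)))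
        (.sub (.lit 1) (.add
          (.sub (.get 2 (.lit 0) (.sub (.var 10) (.lit 1))) (.get 2 (.lit 0) (.sub (.var 11) (.lit 1))))
          (.sub (.get 2 (.lit 0) (.sub (.var 11) (.lit 1)))
            (.get 2 (.lit 0) (.sub (.var 10) (.lit 1)))))))))))

/-- Array `4` receives the table of `delta`. -/
def deltaCmd : Cmd :=
  .loop 10 2 (.loop 12 4 (.seq (.seq
    (.assign 16 (.mul (.sub (.lit 1) (.sub (.var 1) (.var 10))) (.var 1)))
    (.loop 11 1 (.ifz (.get 3 (.var 10) (.var 11)) .skip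
      (.ifz (.sub (.var 12) (.get 2 (.lit 0) (.var 11)))
        (.ifz (.sub (.get 2 (.lit 0) (.var 11)) (.var 12))
          (.ifz (.add (.sub (.var 1) (.var 16)) (.sub (.var 16) (.var 1))) .skip
            (.assign 16 (.add (.var 11) (.lit 1)))) .skip)
        (.assign 16 (.var 1))))))
    (.put 4 (.var 10) (.var 12) (.var 16))))

/-- One step of the recursion for `pathCount`, from array `5` to array `6` and back. -/
def stepCmd : Cmd :=
  .seq
    (.loop 10 2 (.loop 13 4 (.seq (.put 6 (.var 10) (.var 13) (.lit 0))
      (.loop 12 4 (.ifz (.sub (.var 12) (.var 13))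
        (.put 6 (.var 10) (.var 13) (.add (.get 6 (.var 10) (.var 13))
          (.get 5 (.get 4 (.var 10) (.var 12)) (.sub (.var 13) (.var 12))))) .skip)))))
    (.loop 10 2 (.loop 13 4 (.put 5 (.var 10) (.var 13) (.get 6 (.var 10) (.var 13)))))

/-- Variable `17` receives `closedCount`. -/
def countCmd : Cmd :=
  .seq (.assign 17 (.lit 0)) (.loop 14 1 (.seq (.seq
    (.loop 10 2 (.loop 13 4 (.put 5 (.var 10) (.var 13)
      (.sub (.lit 1) (.add (.sub (.var 10) (.var 14)) (.sub (.var 14) (.var 10)))))))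
    (.loop 15 1 stepCmd))
    (.assign 17 (.add (.var 17) (.get 5 (.var 14) (.var 3))))))

def closedCmd : Cmd := .seq (.seq borderCmd deltaCmd) countCmd

/-- The parameters of the problem are in their places. -/
structure Params (h w t M : ℕ) (s : State) : Prop where
  ht : t ≤ h
  hw : t ≤ w
  hM : M ≤ w
  v1 : s.v 1 = t
  v2 : s.v 2 = t + 1
  v3 : s.v 3 = M
  v4 : s.v 4 = M + 1

theorem Params.agree {h w t M : ℕ} {s s' : State} {c : Cmd} (hs : Params h w t M s)
    (hc : c.Agree s s') (hd : ∀ z ∈ [1, 2, 3, 4], z ∉ c.writes) : Params h w t M s' where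
  ht := hs.ht
  hw := hs.hw
  hM := hs.hM
  v1 := (hc.1 1 (hd 1 (by decide))).trans hs.v1
  v2 := (hc.1 2 (hd 2 (by decide))).trans hs.v2
  v3 := (hc.1 3 (hd 3 (by decide))).trans hs.v3
  v4 := (hc.1 4 (hd 4 (by decide))).trans hs.v4

/-! ### Correctness of the counting program. -/

section

variable {h w t M : ℕ} {s : State}

theorem sub_add_sub_eq_zero {a b : ℕ} : a - b + (b - a) = 0 ↔ a = b := by omega

/-- An equality test by arithmetic: the two truncated differences add up to the distance. -/
theorem one_sub_eq {a b : ℕ} : 1 - (a - b + (b - a)) = if a = b then 1 else 0 := by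
  split_ifs <;> omega

/-- By `pre_succ_suffix`, an entry with both indices positive is the preceding entry on its diagonal
times the test whether the two last letters agree. -/
theorem borderCmd_spec (hs : Params h w t M s) {i b : ℕ} (hi : i ≤ t) (hb : b < t) :
    (borderCmd.exec h w s).A 3 i b = if pre (s.A 2 0) b <:+ pre (s.A 2 0) i then 1 else 0 := by
  refine Cmd.exec_fill (fun i b => if pre (s.A 2 0) b <:+ pre (s.A 2 0) i then 1 else 0)
    (by decide) (by decide) (by decide) ?_ (by rw [hs.v2]; omega) (by rw [hs.v1]; exact hb)
  intro p q u hp hq hup huq hu hprev p' q'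
  rw [hs.v2] at hp hprev
  rw [hs.v1] at hq hprev
  have h2 : u.A 2 = s.A 2 := hu.2 2 (by decide)
  have hht := hs.ht
  have hhw := hs.hw
  have e1 : min p h = p := by omega
  have e2 : min q w = q := by omega
  rcases q with _ | q
  · simp [Cmd.exec, Expr.eval, hup, huq, e1, pre]
  rcases p with _ | p
  · have : ¬ pre (s.A 2 0) (q + 1) <:+ pre (s.A 2 0) 0 := by simp [pre]
    simp [Cmd.exec, Expr.eval, hup, huq, e2, this]
  · have e3 : min p h = p := by omega
    have e4 : min q w = q := by omega
    have e5 : min p w = p := by omega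
    have h3 := hprev p q (by omega) (by omega) (by omega)
    simp only [Cmd.exec, Expr.eval, hup, huq, e1, e2, Nat.add_sub_cancel, Nat.add_one_ne_zero,
      if_false, State.setA_A, true_and, h2, h3, e3, e4, e5, one_sub_eq, Nat.zero_min]
    split_ifs <;> grind [pre_succ_suffix, pre_succ]

theorem delta_le {i : ℕ} (hi : i ≤ t) (y : ℕ → ℕ) (a : ℕ) : delta t y i a ≤ t := by
  rcases hi.lt_or_eq with hi | rfl
  · rcases deltaAux_spec hi y a t le_rfl with h | h
    · exact h.1.le
    · exact h.1.le
  · exact (deltaAux_self _ _ _ _).le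

theorem deltaCmd_spec (hs : Params h w t M s)
    (hB : ∀ i b, i ≤ t → b < t → s.A 3 i b = if pre (s.A 2 0) b <:+ pre (s.A 2 0) i then 1 else 0)
    {i a : ℕ} (hi : i ≤ t) (ha : a ≤ M) :
    (deltaCmd.exec h w s).A 4 i a = delta t (s.A 2 0) i a := by
  refine Cmd.exec_fill (fun i a => delta t (s.A 2 0) i a)
    (by decide) (by decide) (by decide) ?_ (by rw [hs.v2]; omega) (by rw [hs.v4]; omega)
  intro p q u hp hq hup huq hu hprev p' q'
  have hht := hs.ht
  have hhw := hs.hw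
  have hhM := hs.hM
  have hu' := hs.agree hu (by decide)
  rw [hs.v2] at hp
  rw [hs.v4] at hq
  have e1 : min p h = p := by omega
  have e2 : min q w = q := by omega
  have h2 : u.A 2 = s.A 2 := hu.2 2 (by decide)
  have h3 : u.A 3 = s.A 3 := hu.2 3 (by decide)
  rw [Cmd.exec, Cmd.exec, State.setA_A]
  rw [Cmd.exec]
  set u0 := (Cmd.assign 16 (.mul (.sub (.lit 1) (.sub (.var 1) (.var 10))) (.var 1))).exec h w u
    with hu0
  have a1 : u0.v 1 = t := by simp [hu0, Cmd.exec, hu'.v1]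
  have a10 : u0.v 10 = p := by simp [hu0, Cmd.exec, hup]
  have a12 : u0.v 12 = q := by simp [hu0, Cmd.exec, huq]
  have aA : u0.A = u.A := by simp [hu0, Cmd.exec]
  generalize hc : (Cmd.ifz (.get 3 (.var 10) (.var 11)) .skip
      (.ifz (.sub (.var 12) (.get 2 (.lit 0) (.var 11)))
        (.ifz (.sub (.get 2 (.lit 0) (.var 11)) (.var 12))
          (.ifz (.add (.sub (.var 1) (.var 16)) (.sub (.var 16) (.var 1))) .skip
            (.assign 16 (.add (.var 11) (.lit 1)))) .skip)
        (.assign 16 (.var 1)))) = c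
  have hw : c.writes = [16, 16] := by rw [← hc]; rfl
  have ha : c.arrays = [] := by rw [← hc]; rfl
  have h16 : ((Cmd.loop 11 1 c).exec h w u0).v 16 = delta t (s.A 2 0) p q := by
    rw [delta]
    conv_rhs => rw [← a1]
    refine Cmd.exec_loop (Q := fun b v => v.v 16 = deltaAux (u0.v 1) (s.A 2 0) p q b)
      (by simp [hw]) ?_ ?_
    -- The start value (1 - (t - p)) * t is t for p = t and 0 for p < t, as in the base case of
    -- `deltaAux`.
    · rw [a1]
      simp only [hu0, Cmd.exec, Expr.eval, State.set_v, hup, hu'.v1, deltaAux]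
      grind
    · intro b v hb hvb hv hQ
      rw [a1] at hb hQ ⊢
      have w1 : v.v 1 = t := by rw [hv.1 1 (by simp [Cmd.writes, hw]), a1]
      have w10 : v.v 10 = p := by rw [hv.1 10 (by simp [Cmd.writes, hw]), a10]
      have w12 : v.v 12 = q := by rw [hv.1 12 (by simp [Cmd.writes, hw]), a12]
      have wA : ∀ j, v.A j = u.A j := fun j => by rw [hv.2 j (by simp [Cmd.arrays, ha]), aA]
      have e3 : min b w = b := by omega
      rw [State.set_v, if_neg (by decide), ← hc, deltaAux]
      simp only [Cmd.exec, Expr.eval, w1, w10, w12, wA, hvb, e1, e3, Nat.zero_min, h2, h3,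
        sub_add_sub_eq_zero, hB p b (by omega) hb, hQ, Nat.sub_eq_zero_iff_le]
      by_cases hbp : pre (s.A 2 0) b <:+ pre (s.A 2 0) p
      · rw [if_pos hbp, if_pos hbp, if_neg one_ne_zero]
        rcases lt_trichotomy (s.A 2 0 b) q with hlt | heq | hgt
        · rw [if_neg (not_le.2 hlt), if_pos hlt, State.set_v, if_pos rfl]
        · have n1 : ¬ s.A 2 0 b < q := by omega
          rw [if_pos heq.ge, if_pos heq.le, if_neg n1, if_pos heq.symm]
          by_cases hd : deltaAux t (s.A 2 0) p q b = t
          · rw [if_pos hd.symm, if_pos hd, hQ, hd]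
          · rw [if_neg (Ne.symm hd), if_neg hd, State.set_v, if_pos rfl]
        · have n1 : ¬ s.A 2 0 b < q := by omega
          have n2 : ¬ q = s.A 2 0 b := by omega
          rw [if_pos hgt.le, if_neg (not_le.2 hgt), if_neg n1, if_neg n2, hQ]
      · rw [if_neg hbp, if_neg hbp, if_pos rfl, hQ]
  have hA : ∀ j, ((Cmd.loop 11 1 c).exec h w u0).A j = u.A j := fun j => by
    rw [Cmd.exec_A _ _ _ _ (by simp [Cmd.arrays, ha]), aA]
  have b10 : ((Cmd.loop 11 1 c).exec h w u0).v 10 = p := by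
    rw [Cmd.exec_v _ _ _ _ (by simp [Cmd.writes, hw]), a10]
  have b12 : ((Cmd.loop 11 1 c).exec h w u0).v 12 = q := by
    rw [Cmd.exec_v _ _ _ _ (by simp [Cmd.writes, hw]), a12]
  simp only [Expr.eval, b10, b12, h16, hA, e1, e2, true_and]

/-- The table of `pathCount` for paths of length `l`. -/
def IsTable (t M : ℕ) (y : ℕ → ℕ) (c l : ℕ) (T : ℕ → ℕ → ℕ) : Prop :=
  ∀ i s, i ≤ t → s ≤ M → T i s = pathCount t y c l i s

/-- Loop bounds are fixed variables, so the sum over a ≤ s is taken over all a ≤ M with a test. The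
new table is built in a separate array, because entries of the old one are needed until the end. -/
theorem stepCmd_spec (hs : Params h w t M s) {y : ℕ → ℕ} {c l : ℕ}
    (hD : ∀ i a, i ≤ t → a ≤ M → s.A 4 i a = delta t y i a) (hW : IsTable t M y c l (s.A 5)) :
    IsTable t M y c (l + 1) ((stepCmd.exec h w s).A 5) := by
  have hht := hs.ht
  have hhM := hs.hM
  rw [stepCmd, Cmd.exec]
  generalize hc1 : (Cmd.loop 10 2 (.loop 13 4 (.seq (.put 6 (.var 10) (.var 13) (.lit 0))
      (.loop 12 4 (.ifz (.sub (.var 12) (.var 13))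
        (.put 6 (.var 10) (.var 13) (.add (.get 6 (.var 10) (.var 13))
          (.get 5 (.get 4 (.var 10) (.var 12)) (.sub (.var 13) (.var 12))))) .skip))))) = c1
  have hs1 : Params h w t M (c1.exec h w s) := hs.agree (c1.agree_exec h w s) (by subst hc1; decide)
  have h1 : ∀ p q, p ≤ t → q ≤ M → (c1.exec h w s).A 6 p q = pathCount t y c (l + 1) p q := by
    intro p q hp hq
    rw [← hc1]
    refine Cmd.exec_fill (fun p q => pathCount t y c (l + 1) p q)
      (by decide) (by decide) (by decide) ?_ (by rw [hs.v2]; omega) (by rw [hs.v4]; omega)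
    intro p q u hp hq hup huq hu hprev
    have hu' := hs.agree hu (by decide)
    rw [hs.v2] at hp
    rw [hs.v4] at hq
    have h4 : u.A 4 = s.A 4 := hu.2 4 (by decide)
    have h5 : u.A 5 = s.A 5 := hu.2 5 (by decide)
    have e1 : min p h = p := by omega
    have e2 : min q w = q := by omega
    have hrec : pathCount t y c (l + 1) p q
        = ∑ a ∈ Finset.range (M + 1),
          if a ≤ q then pathCount t y c l (delta t y p a) (q - a) else 0 := by
      rw [pathCount, ← Finset.sum_filter]
      congr 1
      ext a
      simp only [Finset.mem_range, Finset.mem_filter]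
      omega
    rw [hrec, ← hu'.v4, Cmd.exec]
    set u0 := (Cmd.put 6 (.var 10) (.var 13) (.lit 0)).exec h w u with hu0
    have u0v : u0.v = u.v := rfl
    have u0A : ∀ j, j ≠ 6 → u0.A j = u.A j := fun j hj => Cmd.exec_A _ _ _ _ (by simpa [Cmd.arrays])
    rw [← u0v]
    refine Cmd.exec_loop (Q := fun n v => ∀ p' q', v.A 6 p' q' = if p' = p ∧ q' = q then
      ∑ a ∈ Finset.range n, if a ≤ q then pathCount t y c l (delta t y p a) (q - a) else 0
      else u.A 6 p' q') (by decide) ?_ ?_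
    · intro p' q'
      simp [hu0, Cmd.exec, Expr.eval, hup, huq, e1, e2]
    · intro a v ha hva hv hQ p' q'
      rw [u0v, hu'.v4] at ha
      have v10 : v.v 10 = p := by rw [hv.1 10 (by decide), u0v, hup]
      have v13 : v.v 13 = q := by rw [hv.1 13 (by decide), u0v, huq]
      have v4 : v.A 4 = s.A 4 := by rw [hv.2 4 (by decide), u0A 4 (by decide), h4]
      have v5 : v.A 5 = s.A 5 := by rw [hv.2 5 (by decide), u0A 5 (by decide), h5]
      rw [Finset.sum_range_succ, State.set_A]
      simp only [Cmd.exec, Expr.eval, v10, v13, hva, e1, e2, v4, v5, Nat.sub_eq_zero_iff_le]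
      by_cases haq : a ≤ q
      · have e3 : min a w = a := by omega
        have hd := delta_le (t := t) (i := p) (by omega) y a
        have e4 : min (delta t y p a) h = delta t y p a := by omega
        have e5 : min (q - a) w = q - a := by omega
        rw [if_pos haq, if_pos haq, State.setA_A, e3, hD p a (by omega) (by omega), e4, e5,
          hW _ _ hd (by omega)]
        by_cases hpq : p' = p ∧ q' = q
        · simp only [hpq, and_self, if_true, hQ]
        · rw [if_neg (fun hc => hpq hc.2), hQ, if_neg hpq, if_neg hpq]
      · rw [if_neg haq, if_neg haq, Nat.add_zero, hQ]
  intro p q hp hq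
  refine Cmd.exec_fill (fun p q => pathCount t y c (l + 1) p q)
    (by decide) (by decide) (by decide) ?_ (by rw [hs1.v2]; omega) (by rw [hs1.v4]; omega)
  intro p q u hp hq hup huq hu hprev p' q'
  rw [hs1.v2] at hp
  rw [hs1.v4] at hq
  have h6 : u.A 6 = (c1.exec h w s).A 6 := hu.2 6 (by decide)
  have e1 : min p h = p := by omega
  have e2 : min q w = q := by omega
  simp only [Cmd.exec, Expr.eval, State.setA_A, hup, huq, e1, e2, true_and, h6,
    h1 p q (by omega) (by omega)]

/-- For each state c the table starts as the indicator of c. After t steps of the recursion its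
entry at state c and weight M counts the closed walks at c. -/
theorem countCmd_spec (hs : Params h w t M s) {y : ℕ → ℕ}
    (hD : ∀ i a, i ≤ t → a ≤ M → s.A 4 i a = delta t y i a) :
    (countCmd.exec h w s).v 17 = closedCount t y M := by
  have hht := hs.ht
  have hhM := hs.hM
  rw [countCmd, Cmd.exec]
  set s0 := (Cmd.assign 17 (.lit 0)).exec h w s with hs0d
  have hs0 : Params h w t M s0 := hs.agree (Cmd.agree_exec h w _ s) (by decide)
  rw [show closedCount t y M = ∑ c ∈ Finset.range (s0.v 1), pathCount t y c t c M by
    rw [hs0.v1, closedCount]]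
  refine Cmd.exec_loop (Q := fun n v => v.v 17 = ∑ c ∈ Finset.range n, pathCount t y c t c M)
    (by decide) (by simp [hs0d, Cmd.exec, Expr.eval]) ?_
  intro c u hc huc hu hQ
  have hu' := hs0.agree hu (by decide)
  rw [hs0.v1] at hc
  rw [Cmd.exec, Cmd.exec, State.set_v, if_neg (by decide), Finset.sum_range_succ]
  generalize hc1 : (Cmd.loop 10 2 (.loop 13 4 (.put 5 (.var 10) (.var 13)
      (.sub (.lit 1) (.add (.sub (.var 10) (.var 14)) (.sub (.var 14) (.var 10))))))) = c1
  have hu1 : Params h w t M (c1.exec h w u) := hu'.agree (c1.agree_exec h w u) (by subst hc1; decide)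
  have h0 : IsTable t M y c 0 ((c1.exec h w u).A 5) := by
    intro p q hp hq
    rw [← hc1]
    refine Cmd.exec_fill (fun p q => pathCount t y c 0 p q)
      (by decide) (by decide) (by decide) ?_ (by rw [hu'.v2]; omega) (by rw [hu'.v4]; omega)
    intro p q v hp hq hvp hvq hv hprev p' q'
    rw [hu'.v2] at hp
    rw [hu'.v4] at hq
    have h14 : v.v 14 = c := by rw [hv.1 14 (by decide), huc]
    have e1 : min p h = p := by omega
    have e2 : min q w = q := by omega
    simp only [Cmd.exec, Expr.eval, State.setA_A, hvp, hvq, e1, e2, true_and, h14, one_sub_eq,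
      pathCount]
  have hD1 : (c1.exec h w u).A 4 = s.A 4 := by
    rw [c1.exec_A h w u (by subst hc1; decide), hu.2 4 (by decide)]
    rfl
  have h2 : IsTable t M y c ((c1.exec h w u).v 1)
      (((Cmd.loop 15 1 stepCmd).exec h w (c1.exec h w u)).A 5) := by
    refine Cmd.exec_loop (Q := fun n v => IsTable t M y c n (v.A 5)) (by decide) h0 ?_
    intro l v _ _ hv hQ
    refine stepCmd_spec (hu1.agree hv (by decide)) (fun i a hi ha => ?_) hQ
    rw [hv.2 4 (by decide), hD1, hD i a hi ha]
  have h3 : ((Cmd.loop 15 1 stepCmd).exec h w (c1.exec h w u)).v 17 = u.v 17 := by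
    rw [Cmd.exec_v _ _ _ _ (by decide), Cmd.exec_v _ _ _ _ (by subst hc1; decide)]
  have h4 : ((Cmd.loop 15 1 stepCmd).exec h w (c1.exec h w u)).v 14 = c := by
    rw [Cmd.exec_v _ _ _ _ (by decide), Cmd.exec_v _ _ _ _ (by subst hc1; decide), huc]
  have h5 := (hu1.agree (Cmd.agree_exec h w (Cmd.loop 15 1 stepCmd) _) (by decide)).v3
  rw [hu1.v1] at h2
  have e1 : min c h = c := by omega
  have e2 : min M w = M := by omega
  rw [Cmd.exec]
  simp only [Cmd.exec, Expr.eval, State.set_v, if_true] at h2 h3 h4 h5 ⊢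
  rw [h3, h4, h5, e1, e2, h2 c M (by omega) le_rfl, hQ]

theorem closedCmd_spec (hs : Params h w t M s) :
    (closedCmd.exec h w s).v 17 = closedCount t (s.A 2 0) M := by
  rw [closedCmd, Cmd.exec, Cmd.exec]
  have h1 : (borderCmd.exec h w s).A 2 = s.A 2 := Cmd.exec_A _ _ _ _ (by decide)
  have hs1 := hs.agree (borderCmd.agree_exec h w s) (by decide)
  have hs2 := hs1.agree (deltaCmd.agree_exec h w _) (by decide)
  refine countCmd_spec hs2 fun i a hi ha => ?_
  rw [← h1]
  refine deltaCmd_spec hs1 (fun i b hi hb => ?_) hi ha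
  rw [h1]
  exact borderCmd_spec hs hi hb

end

end SubsetCycle

namespace SubsetCycle

/-! ### Correctness of the ranking and unranking procedures -/

/-- The string over `{1, …, M + 1}` that corresponds to the first `t` terms of a sequence. -/
def word (t M : ℕ) (y : ℕ → ℕ) : List ℕ := (pre y t).map fun a => M + 1 - a

section

variable {t M : ℕ}

theorem length_word (y : ℕ → ℕ) : (word t M y).length = t := by simp [word, pre]

theorem getElem_word (y : ℕ → ℕ) {i : ℕ} (hi : i < (word t M y).length) :
    (word t M y)[i] = M + 1 - y i := by simp [word, pre]

theorem pre_congr {y z : ℕ → ℕ} {f : ℕ} (h : ∀ i < f, y i = z i) : pre y f = pre z f :=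
  List.map_congr_left fun i hi => h i (List.mem_range.1 hi)

theorem word_congr {y z : ℕ → ℕ} (h : ∀ i < t, y i = z i) : word t M y = word t M z := by
  rw [word, word, pre_congr h]

theorem countAbove_word (ht : 1 ≤ t) (y : ℕ → ℕ) :
    countAbove (M + 1) t ((M + 1) * (t - 1) + 1) (word t M y) = closedCount t y M :=
  (closedCount_eq_countAbove t y ht M).symm

theorem closedCount_congr (ht : 1 ≤ t) {y z : ℕ → ℕ} (h : ∀ i < t, y i = z i) :
    closedCount t y M = closedCount t z M := by
  rw [← countAbove_word ht, ← countAbove_word ht, word_congr h]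

/-- Rotations become segments of a doubled string, which is why the program stores two copies of its
input. -/
theorem rotate_word {Z : ℕ → ℕ} (hZ : ∀ i < t, Z (i + t) = Z i) {j : ℕ} (hj : j ≤ t) :
    (word t M Z).rotate j = word t M fun m => Z (j + m) := by
  refine List.ext_getElem (by simp [length_word]) fun i h1 h2 => ?_
  rw [List.getElem_rotate, getElem_word, getElem_word]
  simp only [length_word, List.length_rotate] at h1 h2 ⊢
  congr 1
  by_cases hij : i + j < t
  · rw [Nat.mod_eq_of_lt hij, Nat.add_comm]
  · rw [Nat.mod_eq_sub_mod (by omega), Nat.mod_eq_of_lt (by omega), ← hZ _ (by omega)]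
    congr 1; omega

/-- Complementing reverses the order, so in terms of sequences a necklace is a largest rotation. -/
theorem word_lt_word {y z : ℕ → ℕ} (hy : ∀ i < t, y i ≤ M) :
    word t M z < word t M y ↔ pre y t < pre z t :=
  map_sub_lt_map_sub (by simp [pre]) (by simpa [pre] using hy)

theorem le_of_mem_heavy {W : ℕ} {y : ℕ → ℕ} (h : word t M y ∈ heavy (M + 1) t W) :
    ∀ i < t, y i ≤ M := by
  intro i hi
  have h1 := ((mem_heavy.1 h).2.1 (M + 1 - y i) (by
    rw [word]; exact List.mem_map_of_mem (List.mem_map_of_mem (List.mem_range.2 hi)))).1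
  omega

/-- The word is 0^t, which lies below every string over the alphabet, so all heavy strings are
counted. The programs obtain the length of the cycle in this way, without computing a binomial
coefficient. -/
theorem closedCount_top (ht : 1 ≤ t) {y : ℕ → ℕ} (hy : ∀ i < t, y i = M + 1) :
    closedCount t y M = (grandUp (M + 1) t ((M + 1) * (t - 1) + 1)).length := by
  rw [length_grandUp ht, ← countAbove_word ht, countAbove]
  congr 1
  refine Finset.filter_true_of_mem fun x hx c _ => ?_
  obtain ⟨h1, h2, _⟩ := mem_heavy.1 (rotate_mem_heavy hx c)
  generalize x.rotate c = z at h1 h2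
  obtain ⟨s, rfl⟩ := Nat.exists_eq_add_of_le' ht
  rw [word, pre, List.range_succ_eq_map]
  cases z with
  | nil => simp at h1
  | cons a z =>
    have := (h2 a (List.mem_cons_self ..)).1
    rw [List.map_cons, List.map_cons, hy 0 (by omega), cons_lt_cons]
    omega

/-- Unless x = k^t, the hypotheses say that j is the least rotation amount leading to the necklace.
The target y of the count is the necklace itself or, if x starts with k^j, the string v0^j of
`window_replicate_append`, where the letter 0 corresponds to M + 1. The second branch of `hr` covers
windows that wrap around. It also covers k^t, which is treated with j = t: the target is 0^t, the
count is N, and the position is N - t. -/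
theorem rank_correct (ht : 1 ≤ t) {Z : ℕ → ℕ} (hZ : ∀ i < t, Z (i + t) = Z i)
    (hx : word t M Z ∈ heavy (M + 1) t ((M + 1) * (t - 1) + 1)) {j : ℕ} (hj1 : 1 ≤ j) (hj : j ≤ t)
    (hmax : ∀ i, 1 ≤ i → i ≤ t → pre (fun m => Z (i + m)) t ≤ pre (fun m => Z (j + m)) t)
    (hmin : (∀ i < t, Z i = 0) ∧ j = t ∨ (¬ ∀ i < t, Z i = 0) ∧
      ∀ i, 1 ≤ i → i < j → pre (fun m => Z (i + m)) t < pre (fun m => Z (j + m)) t)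
    {y : ℕ → ℕ} (hy : ∀ i < t, y i = if (∀ m < j, Z m = 0) ∧ t ≤ j + i then M + 1 else Z (j + i))
    {N r : ℕ} (hN : N = (grandUp (M + 1) t ((M + 1) * (t - 1) + 1)).length)
    (hr : r = (if closedCount t y M + j ≤ N then N - closedCount t y M - j
      else N + N - closedCount t y M - j) + 1) :
    1 ≤ r ∧ r ≤ N ∧
      window (grandUp (M + 1) t ((M + 1) * (t - 1) + 1)) t (r - 1) = word t M Z := by
  have hle := le_of_mem_heavy hx
  have hle' : ∀ j ≤ t, ∀ i < t, Z (j + i) ≤ M := by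
    intro j hj i hi
    by_cases h : j + i < t
    · exact hle _ h
    · have := hZ (j + i - t) (by omega)
      rw [Nat.sub_add_cancel (by omega)] at this
      rw [this]
      exact hle _ (by omega)
  have hN1 : 1 ≤ N := by
    rw [hN]
    obtain ⟨q, hq, _⟩ := exists_window (k := M + 1) (by omega) ht hx
    omega
  have hr1 : 1 ≤ r := by omega
  have hrN : r ≤ N := by
    rw [hr]
    split_ifs <;> omega
  refine ⟨hr1, hrN, ?_⟩
  rcases hmin with ⟨h0, rfl⟩ | ⟨h0, hmin⟩
  · have hg : closedCount j y M = N := by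
      rw [hN]
      refine closedCount_top ht fun i hi => ?_
      rw [hy i hi, if_pos ⟨h0, by omega⟩]
    have hw : word j M Z = List.replicate j (M + 1) := by
      rw [word_congr (z := fun _ => 0) h0]
      simp [word, pre]
    rw [hr, if_neg (by omega), hw, ← window_replicate (by omega) ht, hg, Nat.add_sub_cancel,
      Nat.add_sub_cancel, hN]
  · have hrot : ∀ i, ((word t M Z).rotate j).rotate i = (word t M Z).rotate (j + i) :=
      fun i => List.rotate_rotate _ _ _
    have hneck : IsNecklace ((word t M Z).rotate j) := by
      intro i hi
      rw [List.length_rotate, length_word] at hi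
      have key : ∀ i', 1 ≤ i' → i' ≤ t → (word t M Z).rotate j ≤ (word t M Z).rotate i' := by
        intro i' h1 h2
        rw [rotate_word hZ hj, rotate_word hZ h2, ← not_lt, word_lt_word (hle' j hj), not_lt]
        exact hmax i' h1 h2
      rw [hrot]
      by_cases hij : j + i ≤ t
      · exact key _ (by omega) hij
      · rw [show j + i = t + (j + i - t) by omega, ← List.rotate_rotate]
        have hfull := List.rotate_length (word t M Z)
        rw [length_word] at hfull
        rw [hfull]
        exact key _ (by omega) (by omega)
    have hmin' : ∀ i, 1 ≤ i → i < j → ¬ IsNecklace ((word t M Z).rotate i) := by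
      intro i h1 h2 hc
      have h3 := hc (j - i) (by rw [List.length_rotate, length_word]; omega)
      rw [List.rotate_rotate, show i + (j - i) = j by omega, rotate_word hZ hj,
        rotate_word hZ (by omega), ← not_lt, word_lt_word (hle' i (by omega))] at h3
      exact h3 (hmin i h1 h2)
    have htake : (word t M Z).take j = List.replicate j (M + 1) ↔ ∀ m < j, Z m = 0 := by
      rw [List.eq_replicate_iff]
      simp only [word, pre, ← List.map_take, List.take_range,
        List.mem_map, List.mem_range]
      constructor
      · intro h m hm
        have := h.2 (M + 1 - Z m) ⟨Z m, ⟨m, by omega, rfl⟩, rfl⟩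
        have := hle m (by omega)
        omega
      · intro h
        refine ⟨by simp; omega, ?_⟩
        rintro b ⟨a, ⟨m, hm, rfl⟩, rfl⟩
        rw [h m (by omega)]; omega
    by_cases hB : ∀ m < j, Z m = 0
    · have hjt : j < t := by
        rcases hj.lt_or_eq with h | h
        · exact h
        · subst h; exact absurd hB h0
      have hne : word t M Z ≠ List.replicate t (M + 1) := by
        intro hc
        apply h0
        intro m hm
        have h1 := getElem_word (M := M) (t := t) Z (i := m) (by rw [length_word]; exact hm)
        have h2 := hle m hm
        simp only [hc, List.getElem_replicate] at h1
        omega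
      obtain ⟨E, hE, hcase⟩ := window_replicate_append (by omega) ht hx hj1 hjt hneck
        (htake.2 hB) hne
      have hyw : (word t M Z).drop j ++ List.replicate j 0 = word t M y := by
        refine List.ext_getElem (by simp [length_word]; omega) fun i h1 h2 => ?_
        rw [getElem_word]
        rw [length_word] at h2
        rw [hy i h2, List.getElem_append]
        simp only [List.length_drop, length_word, List.getElem_drop, getElem_word,
          List.getElem_replicate]
        by_cases hi : i < t - j
        · rw [dif_pos hi, if_neg (by omega)]
        · rw [dif_neg hi, if_pos ⟨hB, by omega⟩]; omega
      rw [hyw, countAbove_word ht, ← hN] at hE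
      have hgN : closedCount t y M ≤ N := by
        rw [← countAbove_word ht, hN]; exact countAbove_le ht _
      rcases hcase with ⟨h1, h2⟩ | ⟨h1, _, h2⟩
      · rw [hr, if_pos (by omega), Nat.add_sub_cancel, ← hE, h2]
      · rw [hr, if_neg (by omega), Nat.add_sub_cancel, ← h2, ← hN]
        congr 1
        omega
    · have hyw : (word t M Z).rotate j = word t M y := by
        rw [rotate_word hZ hj]
        refine word_congr fun i hi => ?_
        rw [hy i hi, if_neg (fun hc => hB hc.1)]
      obtain ⟨h1, h2⟩ := window_rotate (by omega) ht hx hj1 hj hneck hmin' (fun hc => hB (htake.1 hc))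
      rw [hyw, countAbove_word ht, ← hN] at h1 h2
      rw [hr, if_pos h1, Nat.add_sub_cancel, h2]

theorem exists_word_eq {x : List ℕ} (hx : x.length = t) (h : ∀ a ∈ x, 1 ≤ a ∧ a ≤ M + 1) :
    ∃ c : ℕ → ℕ, (∀ i, c i ≤ M) ∧ word t M c = x := by
  refine ⟨fun i => M + 1 - x.getD i (M + 1), fun i => ?_, ?_⟩
  · dsimp only
    by_cases hi : i < x.length
    · have := h _ (List.getElem_mem hi)
      rw [List.getD_eq_getElem _ _ hi]; omega
    · rw [List.getD_eq_default _ _ (by omega)]; omega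
  · refine List.ext_getElem (by simp [length_word, hx]) fun i h1 h2 => ?_
    have := h _ (List.getElem_mem h2)
    rw [getElem_word, List.getD_eq_getElem _ _ h2]; omega

/-- The test that the search for the next necklace uses. -/
theorem pre_le_iff_lt (ht : 1 ≤ t) {q N : ℕ} {c : ℕ → ℕ} (hc : ∀ i, c i ≤ M)
    (h : ∀ y, word t M c ≤ y ↔ q < N - countAbove (M + 1) t ((M + 1) * (t - 1) + 1) y)
    (y : ℕ → ℕ) : pre y t ≤ pre c t ↔ q < N - closedCount t y M := by
  rw [← countAbove_word ht, ← h, ← not_lt, ← not_lt, word_lt_word fun i _ => hc i]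

/-- Zeros are the least possible continuation, so position p decides the comparison. This permits a
search letter by letter, with a candidate letter after the known prefix. -/
theorem pre_le_pre_iff {y c : ℕ → ℕ} {p : ℕ} (hp : p < t) (h : ∀ i < p, y i = c i)
    (h0 : ∀ i, p < i → i < t → y i = 0) : pre y t ≤ pre c t ↔ y p ≤ c p := by
  have e : ∀ z : ℕ → ℕ, pre z t = pre z p ++ z p :: (List.range (t - p - 1)).map fun i => z (p + 1 + i) := by
    intro z
    have : t = p + 1 + (t - p - 1) := by omega
    conv_lhs => rw [pre, this, List.range_add, List.range_succ]
    simp [pre]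
  have hz : ∀ l m : List ℕ, l.length = m.length → (∀ a ∈ l, a = 0) → l ≤ m := by
    intro l
    induction l with
    | nil => intro m _ _; exact nil_le m
    | cons a l ih =>
      intro m hm ha
      cases m with
      | nil => simp at hm
      | cons b m =>
        rw [cons_le_cons, ha a (List.mem_cons_self ..)]
        have := ih m (by simpa using hm) fun a h => ha a (List.mem_cons_of_mem _ h)
        rcases Nat.eq_zero_or_pos b with hb | hb
        · exact Or.inr ⟨hb.symm, this⟩
        · exact Or.inl hb
  have happ : ∀ u l m : List ℕ, u ++ l ≤ u ++ m ↔ l ≤ m := by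
    intro u l m
    induction u with
    | nil => rfl
    | cons a u ih => rw [List.cons_append, List.cons_append, cons_le_cons, ih]; simp
  rw [e y, e c, pre_congr h, happ, cons_le_cons]
  have := hz ((List.range (t - p - 1)).map fun i => y (p + 1 + i))
    ((List.range (t - p - 1)).map fun i => c (p + 1 + i)) (by simp) (by
      simp only [List.mem_map, List.mem_range]
      rintro a ⟨i, hi, rfl⟩
      exact h0 _ (by omega) (by omega))
  simp only [this, and_true]
  omega

/-- The hypotheses `ha` and `hb` describe the results of the searches at q and at q + j. Near the
end of the cycle no search is needed: by `window_tail` the complemented window is 0 except for the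
letter M at index N - q. -/
theorem unrank_correct (ht : 1 ≤ t) {q N j : ℕ}
    (hN : N = (grandUp (M + 1) t ((M + 1) * (t - 1) + 1)).length) (hq : q < N) {a b e : ℕ → ℕ}
    (ha : q + t < N → ∀ α ∈ necklacesUp (M + 1) t ((M + 1) * (t - 1) + 1),
      (∀ y, α ≤ y ↔ q < N - countAbove (M + 1) t ((M + 1) * (t - 1) + 1) y) → word t M a = α)
    (hj : j = N - closedCount t a M - q)
    (hb : q + t < N → ∀ α ∈ necklacesUp (M + 1) t ((M + 1) * (t - 1) + 1),
      (∀ y, α ≤ y ↔ q + j < N - countAbove (M + 1) t ((M + 1) * (t - 1) + 1) y) → word t M b = α)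
    (he : ∀ i < t, e i = if N ≤ q + t then if i = N - q then M else 0
      else if i < j then a (t - j + i) else b (i - j)) :
    window (grandUp (M + 1) t ((M + 1) * (t - 1) + 1)) t q = word t M e := by
  by_cases hqt : q + t < N
  · obtain ⟨α, hα, β, hβ, j', h1, h2, h3, h4, h5, h6⟩ :=
      window_eq_of_lt (k := M + 1) (by omega) ht (q := q) (by rw [← hN]; exact hqt)
    rw [← hN] at h3 h4 h5
    have ha' := ha hqt α hα h3
    have hjj : j' = j := by rw [h4, hj, ← ha', countAbove_word ht]
    subst hjj
    have hb' := hb hqt β hβ h5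
    rw [h6, ← ha', ← hb']
    refine List.ext_getElem (by simp [length_word]) fun i hi1 hi2 => ?_
    rw [length_word] at hi2
    rw [getElem_word, he i hi2, if_neg (by omega), List.getElem_append]
    simp only [List.length_drop, length_word, List.getElem_drop, getElem_word, List.getElem_take]
    by_cases hij : i < j'
    · rw [dif_pos (by omega), if_pos hij]
    · rw [dif_neg (by omega), if_neg hij]
      congr 2; omega
  · have he' : ∀ i < t, e i = if i = N - q then M else 0 := fun i hi => by
      rw [he i hi, if_pos (by omega)]
    -- For M = 0 there is only one string over the alphabet, whereas `window_tail` needs two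
    -- letters.
    rcases Nat.eq_zero_or_pos M with rfl | hM
    · obtain ⟨h1, h2, -⟩ := mem_heavy.1 ((window_bijOn (k := 0 + 1) (by omega) ht).mapsTo
        (Finset.mem_coe.2 (Finset.mem_range.2 (hN ▸ hq))))
      refine List.ext_getElem (by rw [h1, length_word]) fun i hi1 hi2 => ?_
      have h3 := h2 _ (List.getElem_mem hi1)
      rw [length_word] at hi2
      rw [getElem_word, he' i hi2]
      split_ifs <;> omega
    · obtain ⟨-, h1⟩ := window_tail (k := M + 1) (by omega) ht (j := N - q) (by omega) (by omega)
      rw [← hN, Nat.sub_sub_self hq.le] at h1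
      rw [h1]
      refine List.ext_getElem (by simp [length_word]; omega) fun i hi1 hi2 => ?_
      rw [length_word] at hi2
      rw [getElem_word, he' i hi2, List.getElem_append]
      simp only [List.length_replicate, List.getElem_replicate, List.getElem_take]
      by_cases h1 : i < N - q
      · rw [dif_pos h1, if_neg (by omega)]; rfl
      · rw [dif_neg h1]
        rcases Nat.eq_or_lt_of_not_lt h1 with h2 | h2
        · rw [if_pos h2]
          simp [h2]
        · rw [if_neg (by omega), List.getElem_cons, dif_neg (by omega), List.getElem_replicate]
          rfl

end

end SubsetCycle

namespace SubsetCycle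

/-! ### The program for ranking -/

/-- Row `0` of array `1` receives two copies of the string that is obtained from the input by
subtracting `1` from each symbol. -/
def readCmd : Cmd :=
  .loop 23 1 (.seq
    (.ifz (.sub (.lit 62) (.var 23))
      (.put 1 (.lit 0) (.var 23)
        (.sub (.get 0 (.lit 0) (.sub (.var 23) (.lit 62))) (.lit 1)))
      (.put 1 (.lit 0) (.var 23)
        (.sub (.get 0 (.lit 0) (.add (.mul (.lit 64) (.sub (.var 1) (.lit 1))) (.var 23))) (.lit 1))))
    (.put 1 (.lit 0) (.add (.var 23) (.var 1)) (.get 1 (.lit 0) (.var 23))))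

/-- Variable `22` receives `0`, `1` or `2` according as the rotation given by variable `20` is equal
to, less than or greater than the next one after that given by variable `21`. -/
def compareCmd : Cmd :=
  .seq (.assign 22 (.lit 0)) (.loop 23 1 (.ifz (.var 22)
    (.assign 22 (.add
      (.sub (.lit 1) (.sub (.lit 1) (.sub
        (.get 1 (.lit 0) (.add (.add (.var 21) (.lit 1)) (.var 23)))
        (.get 1 (.lit 0) (.add (.var 20) (.var 23))))))
      (.mul (.lit 2) (.sub (.lit 1) (.sub (.lit 1) (.sub
        (.get 1 (.lit 0) (.add (.var 20) (.var 23)))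
        (.get 1 (.lit 0) (.add (.add (.var 21) (.lit 1)) (.var 23)))))))))
    .skip))

/-- Variable `20` receives the number of the first rotation that is largest. -/
def rotateCmd : Cmd :=
  .seq (.assign 20 (.lit 1)) (.loop 21 1 (.seq compareCmd
    (.ifz (.add (.sub (.var 22) (.lit 1)) (.sub (.lit 1) (.var 22)))
      (.assign 20 (.add (.var 21) (.lit 1))) .skip)))

/-- Variable `24` receives the sum of the first symbols, up to the number in variable `20`. -/
def sumCmd : Cmd :=
  .seq (.assign 24 (.lit 0)) (.loop 23 1 (.ifz (.sub (.add (.var 23) (.lit 1)) (.var 20))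
    (.assign 24 (.add (.var 24) (.get 1 (.lit 0) (.var 23)))) .skip))

/-- Array `2` receives the string to which the counting is applied. -/
def targetCmd : Cmd :=
  .loop 23 1 (.ifz (.var 24)
    (.ifz (.sub (.add (.add (.var 20) (.var 23)) (.lit 1)) (.var 1))
      (.put 2 (.lit 0) (.var 23) (.get 1 (.lit 0) (.add (.var 20) (.var 23))))
      (.put 2 (.lit 0) (.var 23) (.var 4)))
    (.put 2 (.lit 0) (.var 23) (.get 1 (.lit 0) (.add (.var 20) (.var 23)))))

/-- Variable `26` receives the length of the universal cycle. -/
def totalCmd : Cmd :=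
  .seq (.seq (.loop 23 1 (.put 2 (.lit 0) (.var 23) (.var 4))) closedCmd) (.assign 26 (.var 17))

/-- The choice of the rotation. -/
def chooseCmd : Cmd :=
  .seq (.seq (.seq (.seq rotateCmd (.assign 25 (.var 20))) (.seq (.assign 20 (.var 1)) sumCmd))
    (.ifz (.var 24) .skip (.assign 20 (.var 25)))) sumCmd

/-- Variables 25, 20 and 26 hold the count, the rotation amount and the length of the cycle. The
final 1 accounts for ranks counted from 1. -/
def resultCmd : Cmd :=
  .ifz (.sub (.add (.var 25) (.var 20)) (.var 26))
    (.assign 0 (.add (.sub (.sub (.var 26) (.var 25)) (.var 20)) (.lit 1)))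
    (.assign 0 (.add (.sub (.sub (.add (.var 26) (.var 26)) (.var 25)) (.var 20)) (.lit 1)))

def rankCmd : Cmd :=
  .seq (.seq (.seq (.seq readCmd chooseCmd) (.seq (.seq targetCmd closedCmd) (.assign 25 (.var 17))))
    totalCmd) resultCmd

/-! ### Correctness of the ranking program. -/

section

variable {h w t M : ℕ} {s : State}

/-- The hypothesis `hd` describes the input as the machine code leaves it: the first 62 symbols,
whose registers are needed otherwise, have been moved to the columns from 64(t - 1) on, and symbol i
≥ 62 is still in its register i + 2, which is column i - 62. -/
theorem readCmd_spec (hs : Params h w t M s) (hwide : 64 * t ≤ w) {d : ℕ → ℕ}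
    (hd : ∀ i < t, (if i < 62 then s.A 0 0 (64 * (t - 1) + i) else s.A 0 0 (i - 62)) = d i) :
    ∀ i < t, (readCmd.exec h w s).A 1 0 i = d i - 1 ∧ (readCmd.exec h w s).A 1 0 (i + t) = d i - 1 := by
  rw [show t = s.v 1 from hs.v1.symm]
  refine Cmd.exec_loop (Q := fun n u => ∀ i < n, u.A 1 0 i = d i - 1 ∧ u.A 1 0 (i + s.v 1) = d i - 1)
    (by decide) (fun i hi => absurd hi (Nat.not_lt_zero _)) ?_
  intro p u hp hup hu hQ i hi
  have hu' := hs.agree hu (by decide)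
  have h0 : u.A 0 = s.A 0 := hu.2 0 (by decide)
  have h1 := hu'.v1
  rw [hs.v1] at hp hQ ⊢
  have e1 : min p w = p := by omega
  have e2 : min (p - 62) w = p - 62 := by omega
  have e4 : min (p + t) w = p + t := by omega
  have hdp := hd p hp
  simp only [Cmd.exec, Expr.eval, hup, h1, h0, e1, e2, Nat.zero_min, State.set_A]
  have key : ∀ v : State, v.v 23 = p → v.v 1 = t → v.A = (u.setA 1 0 p (d p - 1)).A →
      (v.setA 1 0 (min (v.v 23 + v.v 1) w) (v.A 1 0 (min (v.v 23) w))).A 1 0 i = d i - 1 ∧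
      (v.setA 1 0 (min (v.v 23 + v.v 1) w) (v.A 1 0 (min (v.v 23) w))).A 1 0 (i + t) = d i - 1 := by
    intro v hv1 hv2 hv
    simp only [hv1, hv2, hv, State.setA_A, e1, e4, true_and, and_true]
    rcases Nat.lt_succ_iff_lt_or_eq.1 hi with hip | rfl
    · rw [if_neg (by omega), if_neg (by omega), if_neg (by omega), if_neg (by omega)]
      exact hQ i hip
    · rw [if_neg (by omega), if_pos rfl, if_pos rfl]
      simp
  by_cases hp62 : p < 62
  · rw [if_pos hp62] at hdp
    rw [if_neg (by omega), show min (64 * (t - 1) + p) w = 64 * (t - 1) + p by omega, hdp]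
    exact key _ hup h1 rfl
  · rw [if_neg hp62] at hdp
    rw [if_pos (by omega), hdp]
    exact key _ hup h1 rfl

theorem compareCmd_spec (hs : Params h w t M s) (hwide : 64 * t ≤ w) {b c : ℕ} (hb : s.v 20 = b)
    (hc : s.v 21 = c) (hbt : b ≤ t) (hct : c < t) :
    (compareCmd.exec h w s).v 22 = 1 ↔
      pre (fun m => s.A 1 0 (b + m)) t < pre (fun m => s.A 1 0 (c + 1 + m)) t := by
  have key : ((compareCmd.exec h w s).v 22 = 0 ∧
      pre (fun m => s.A 1 0 (b + m)) t = pre (fun m => s.A 1 0 (c + 1 + m)) t) ∨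
      ((compareCmd.exec h w s).v 22 = 1 ∧
      pre (fun m => s.A 1 0 (b + m)) t < pre (fun m => s.A 1 0 (c + 1 + m)) t) ∨
      ((compareCmd.exec h w s).v 22 = 2 ∧
      pre (fun m => s.A 1 0 (c + 1 + m)) t < pre (fun m => s.A 1 0 (b + m)) t) := by
    rw [compareCmd, Cmd.exec]
    set s0 := (Cmd.assign 22 (.lit 0)).exec h w s with hs0d
    have hs0 : Params h w t M s0 := hs.agree (Cmd.agree_exec h w _ s) (by decide)
    have hn : t = s0.v 1 := hs0.v1.symm
    have h20 : s0.v 20 = b := by rw [hs0d, Cmd.exec_v _ _ _ _ (by decide), hb]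
    have h21 : s0.v 21 = c := by rw [hs0d, Cmd.exec_v _ _ _ _ (by decide), hc]
    have hA : s0.A = s.A := rfl
    rw [hn]
    refine Cmd.exec_loop (s := s0) (y := 1) (Q := fun n v => (v.v 22 = 0 ∧
      pre (fun m => s.A 1 0 (b + m)) n = pre (fun m => s.A 1 0 (c + 1 + m)) n) ∨
      (v.v 22 = 1 ∧
      pre (fun m => s.A 1 0 (b + m)) n < pre (fun m => s.A 1 0 (c + 1 + m)) n) ∨
      (v.v 22 = 2 ∧
      pre (fun m => s.A 1 0 (c + 1 + m)) n < pre (fun m => s.A 1 0 (b + m)) n)) (by decide) ?_ ?_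
    · exact Or.inl ⟨rfl, rfl⟩
    · intro p u hp hup hu hQ
      have h20 : u.v 20 = b := by rw [hu.1 20 (by decide), h20]
      have h21 : u.v 21 = c := by rw [hu.1 21 (by decide), h21]
      have hA : u.A 1 = s.A 1 := by rw [hu.2 1 (by decide), hA]
      have e1 : min (c + 1 + p) w = c + 1 + p := by omega
      have e2 : min (b + p) w = b + p := by omega
      have happ : ∀ x y : ℕ → ℕ, pre x p < pre y p → pre x (p + 1) < pre y (p + 1) := by
        intro x y hxy
        refine lt_of_take_lt_take p ?_
        simpa [pre, ← List.map_take, List.take_range] using hxy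
      have happ' : ∀ x y : ℕ → ℕ, pre x p = pre y p → x p < y p → pre x (p + 1) < pre y (p + 1) := by
        intro x y hxy hlt
        rw [pre_succ, pre_succ, hxy]
        generalize pre y p = l
        induction l with
        | nil => exact cons_lt_cons.2 (Or.inl hlt)
        | cons a l ih => exact cons_lt_cons.2 (Or.inr ⟨rfl, ih⟩)
      rw [State.set_v, if_neg (by decide)]
      simp only [Cmd.exec, Expr.eval, h20, h21, hA, e1, e2, hup, Nat.zero_min]
      rcases hQ with ⟨h1, h2⟩ | ⟨h1, h2⟩ | ⟨h1, h2⟩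
      · rw [if_pos h1, State.set_v, if_pos rfl]
        rcases lt_trichotomy (s.A 1 0 (b + p)) (s.A 1 0 (c + 1 + p)) with hlt | heq | hgt
        · exact Or.inr (Or.inl ⟨by omega, happ' _ _ h2 hlt⟩)
        · refine Or.inl ⟨by omega, ?_⟩
          rw [pre_succ, pre_succ, h2, heq]
        · exact Or.inr (Or.inr ⟨by omega, happ' _ _ h2.symm hgt⟩)
      · rw [if_neg (by omega)]
        exact Or.inr (Or.inl ⟨h1, happ _ _ h2⟩)
      · rw [if_neg (by omega)]
        exact Or.inr (Or.inr ⟨h1, happ _ _ h2⟩)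
  rcases key with ⟨h1, h2⟩ | ⟨h1, h2⟩ | ⟨h1, h2⟩
  · simp [h1, h2]
  · simp [h1, h2]
  · simp [h1, not_lt_of_gt h2]

/-- A candidate replaces the current rotation only if it is strictly larger, so the first among the
largest rotations remains. -/
theorem rotateCmd_spec (hs : Params h w t M s) (hwide : 64 * t ≤ w) (ht : 1 ≤ t) {Z : ℕ → ℕ}
    (hZ : s.A 1 0 = Z) : ∃ j, (rotateCmd.exec h w s).v 20 = j ∧ 1 ≤ j ∧ j ≤ t ∧
      (∀ i, 1 ≤ i → i ≤ t → pre (fun m => Z (i + m)) t ≤ pre (fun m => Z (j + m)) t) ∧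
      ∀ i, 1 ≤ i → i < j → pre (fun m => Z (i + m)) t < pre (fun m => Z (j + m)) t := by
  rw [rotateCmd, Cmd.exec]
  set s0 := (Cmd.assign 20 (.lit 1)).exec h w s with hs0d
  have hs0 : Params h w t M s0 := hs.agree (Cmd.agree_exec h w _ s) (by decide)
  have hA : s0.A = s.A := rfl
  have key := Cmd.exec_loop (h := h) (w := w) (s := s0) (x := 21) (y := 1) (c := .seq compareCmd
    (.ifz (.add (.sub (.var 22) (.lit 1)) (.sub (.lit 1) (.var 22)))
      (.assign 20 (.add (.var 21) (.lit 1))) .skip)) (Q := fun n v => ∃ j, v.v 20 = j ∧ 1 ≤ j ∧ j ≤ t ∧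
      (∀ i, 1 ≤ i → i ≤ n → pre (fun m => Z (i + m)) t ≤ pre (fun m => Z (j + m)) t) ∧
      ∀ i, 1 ≤ i → i < j → pre (fun m => Z (i + m)) t < pre (fun m => Z (j + m)) t)
    (by decide) ?_ ?_
  · rwa [hs0.v1] at key
  · exact ⟨1, rfl, le_rfl, ht, fun i h1 h2 => by omega, fun i h1 h2 => by omega⟩
  · rintro p u hp hup hu ⟨j, hj, hj1, hjt, hmax, hmin⟩
    have hu' := hs0.agree hu (by decide)
    have hA : u.A 1 0 = Z := by rw [hu.2 1 (by decide), hA, hZ]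
    rw [hs0.v1] at hp
    have hcmp := compareCmd_spec hu' hwide hj hup hjt hp
    rw [hA] at hcmp
    have h20 : (compareCmd.exec h w u).v 20 = j := by rw [Cmd.exec_v _ _ _ _ (by decide), hj]
    have h21 : (compareCmd.exec h w u).v 21 = p := by rw [Cmd.exec_v _ _ _ _ (by decide), hup]
    simp only [Cmd.exec, Expr.eval, sub_add_sub_eq_zero, State.set_v]
    by_cases h1 : (compareCmd.exec h w u).v 22 = 1
    · have hlt := hcmp.1 h1
      simp only [if_pos h1, State.set_v, h21]
      refine ⟨p + 1, by simp, by omega, by omega, fun i hi1 hi2 => ?_, fun i hi1 hi2 => ?_⟩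
      · rcases Nat.lt_succ_iff_lt_or_eq.1 (Nat.lt_succ_of_le hi2) with hi | rfl
        · exact (hmax i hi1 (by omega)).trans hlt.le
        · exact le_rfl
      · exact (hmax i hi1 (by omega)).trans_lt hlt
    · have hlt := not_lt.1 (mt hcmp.2 h1)
      simp only [if_neg h1]
      refine ⟨j, by simpa using h20, hj1, hjt, fun i hi1 hi2 => ?_, hmin⟩
      rcases Nat.lt_succ_iff_lt_or_eq.1 (Nat.lt_succ_of_le hi2) with hi | rfl
      · exact hmax i hi1 (by omega)
      · exact hlt

theorem sumCmd_spec (hs : Params h w t M s) (hw : t ≤ w) {Z : ℕ → ℕ} {j : ℕ} (hj : s.v 20 = j)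
    (hjt : j ≤ t) (hZ : s.A 1 0 = Z) :
    (sumCmd.exec h w s).v 24 = 0 ↔ ∀ m < j, Z m = 0 := by
  rw [sumCmd, Cmd.exec]
  set s0 := (Cmd.assign 24 (.lit 0)).exec h w s with hs0d
  have hs0 : Params h w t M s0 := hs.agree (Cmd.agree_exec h w _ s) (by decide)
  have key := Cmd.exec_loop (h := h) (w := w) (s := s0) (x := 23) (y := 1)
    (c := .ifz (.sub (.add (.var 23) (.lit 1)) (.var 20))
      (.assign 24 (.add (.var 24) (.get 1 (.lit 0) (.var 23)))) .skip)
    (Q := fun n v => v.v 24 = 0 ↔ ∀ m < n, m < j → Z m = 0)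
    (by decide) ?_ ?_
  · rw [hs0.v1] at key
    exact key.trans ⟨fun h m hm => h m (by omega) hm, fun h m _ hm => h m hm⟩
  · simp [hs0d, Cmd.exec, Expr.eval]
  · intro p u hp hup hu hQ
    rw [hs0.v1] at hp
    have h20 : u.v 20 = j := by rw [hu.1 20 (by decide), hs0d, Cmd.exec_v _ _ _ _ (by decide), hj]
    have hA : u.A 1 0 = Z := by rw [hu.2 1 (by decide)]; exact hZ
    have e1 : min p w = p := by omega
    rw [State.set_v, if_neg (by decide)]
    simp only [Cmd.exec, Expr.eval, h20, hA, hup, e1, Nat.zero_min]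
    by_cases hpj : p + 1 - j = 0
    · rw [if_pos hpj, State.set_v, if_pos rfl, Nat.add_eq_zero_iff, hQ]
      constructor
      · rintro ⟨h1, h2⟩ m hm hmj
        rcases Nat.lt_succ_iff_lt_or_eq.1 hm with h | rfl
        · exact h1 m h hmj
        · exact h2
      · exact fun h => ⟨fun m hm => h m (by omega), h p (by omega) (by omega)⟩
    · rw [if_neg hpj, hQ]
      exact ⟨fun h m hm hmj => h m (by omega) hmj, fun h m hm => h m (by omega)⟩

theorem targetCmd_spec (hs : Params h w t M s) (hwide : 64 * t ≤ w) {Z : ℕ → ℕ} {j : ℕ}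
    (hj : s.v 20 = j) (hjt : j ≤ t) (hZ : s.A 1 0 = Z) (h24 : s.v 24 = 0 ↔ ∀ m < j, Z m = 0) :
    ∀ i < t, (targetCmd.exec h w s).A 2 0 i
      = if (∀ m < j, Z m = 0) ∧ t ≤ j + i then M + 1 else Z (j + i) := by
  intro i hi
  refine Cmd.exec_fillRow (fun i => if (∀ m < j, Z m = 0) ∧ t ≤ j + i then M + 1 else Z (j + i))
    (by decide) ?_ (by rw [hs.v1]; exact hi)
  intro q u hq huq hu _ q'
  have hu' := hs.agree hu (by decide)
  rw [hs.v1] at hq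
  have h20 : u.v 20 = j := by rw [hu.1 20 (by decide), hj]
  have h24' : u.v 24 = s.v 24 := hu.1 24 (by decide)
  have hA : u.A 1 0 = Z := by rw [hu.2 1 (by decide), hZ]
  have e1 : min q w = q := by omega
  have e2 : min (j + q) w = j + q := by omega
  simp only [Cmd.exec, Expr.eval, h20, hA, huq, e1, e2, Nat.zero_min, h24', hu'.v1, hu'.v4]
  by_cases hB : ∀ m < j, Z m = 0
  · rw [if_pos (h24.2 hB)]
    by_cases hjq : t ≤ j + q
    · have hf : (if (∀ m < j, Z m = 0) ∧ t ≤ j + q then M + 1 else Z (j + q)) = M + 1 :=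
        if_pos ⟨hB, hjq⟩
      rw [if_neg (by omega), hf]
      simp
    · have hf : (if (∀ m < j, Z m = 0) ∧ t ≤ j + q then M + 1 else Z (j + q)) = Z (j + q) :=
        if_neg fun hc => hjq hc.2
      rw [if_pos (by omega), hf]
      simp
  · have hf : (if (∀ m < j, Z m = 0) ∧ t ≤ j + q then M + 1 else Z (j + q)) = Z (j + q) :=
      if_neg fun hc => hB hc.1
    rw [if_neg (fun hc => hB (h24.1 hc)), hf]
    simp

theorem totalCmd_spec (hs : Params h w t M s) (ht : 1 ≤ t) :
    (totalCmd.exec h w s).v 26 = (grandUp (M + 1) t ((M + 1) * (t - 1) + 1)).length := by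
  rw [totalCmd, Cmd.exec, Cmd.exec, Cmd.exec, State.set_v, if_pos rfl, Expr.eval,
    closedCmd_spec (hs.agree (Cmd.agree_exec h w _ s) (by decide))]
  refine closedCount_top ht fun i hi => ?_
  refine Cmd.exec_fillRow (fun _ => M + 1) (by decide) ?_ (by rw [hs.v1]; exact hi)
  intro q u hq huq hu _ q'
  have hu' := hs.agree hu (by decide)
  rw [hs.v1] at hq
  have hhw := hs.hw
  have e1 : min q w = q := by omega
  simp [Cmd.exec, Expr.eval, huq, e1, hu'.v4]

/-- For the zero string the search keeps j = 1, while the rank formula wants j = t. The first sum,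
over all t symbols, detects this case; the second one tests the first j symbols for the final j. -/
theorem chooseCmd_spec (hs : Params h w t M s) (hwide : 64 * t ≤ w) (ht : 1 ≤ t) {Z : ℕ → ℕ}
    (hZ : s.A 1 0 = Z) (hper : ∀ i < t, Z (i + t) = Z i) : ∃ j, (chooseCmd.exec h w s).v 20 = j ∧ 1 ≤ j ∧ j ≤ t ∧
      (∀ i, 1 ≤ i → i ≤ t → pre (fun m => Z (i + m)) t ≤ pre (fun m => Z (j + m)) t) ∧
      ((∀ i < t, Z i = 0) ∧ j = t ∨ (¬ ∀ i < t, Z i = 0) ∧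
        ∀ i, 1 ≤ i → i < j → pre (fun m => Z (i + m)) t < pre (fun m => Z (j + m)) t) ∧
      ((chooseCmd.exec h w s).v 24 = 0 ↔ ∀ m < j, Z m = 0) := by
  obtain ⟨j, hj, hj1, hjt, hmax, hmin⟩ := rotateCmd_spec hs hwide ht hZ
  rw [chooseCmd, Cmd.exec, Cmd.exec, Cmd.exec]
  generalize hs1 : (Cmd.seq rotateCmd (.assign 25 (.var 20))).exec h w s = s1
  have p1 : Params h w t M s1 := hs1 ▸ hs.agree (Cmd.agree_exec h w _ s) (by decide)
  have h25 : s1.v 25 = j := by rw [← hs1, Cmd.exec, Cmd.exec, State.set_v, if_pos rfl, Expr.eval, hj]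
  have hZ1 : s1.A 1 0 = Z := by rw [← hs1, Cmd.exec_A _ _ _ _ (by decide), hZ]
  rw [Cmd.exec]
  generalize hs2 : (Cmd.assign 20 (.var 1)).exec h w s1 = s2
  have p2 : Params h w t M s2 := hs2 ▸ p1.agree (Cmd.agree_exec h w _ s1) (by decide)
  have h25' : s2.v 25 = j := by rw [← hs2, Cmd.exec_v _ _ _ _ (by decide), h25]
  have h20 : s2.v 20 = t := by rw [← hs2, Cmd.exec, State.set_v, if_pos rfl, Expr.eval, p1.v1]
  have hZ2 : s2.A 1 0 = Z := by rw [← hs2, Cmd.exec_A _ _ _ _ (by decide), hZ1]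
  have hsum := sumCmd_spec p2 hs.hw h20 le_rfl hZ2
  generalize hs3 : sumCmd.exec h w s2 = s3 at *
  have p3 : Params h w t M s3 := hs3 ▸ p2.agree (Cmd.agree_exec h w _ s2) (by decide)
  have h25'' : s3.v 25 = j := by rw [← hs3, Cmd.exec_v _ _ _ _ (by decide), h25']
  have h20' : s3.v 20 = t := by rw [← hs3, Cmd.exec_v _ _ _ _ (by decide), h20]
  have hZ3 : s3.A 1 0 = Z := by rw [← hs3, Cmd.exec_A _ _ _ _ (by decide), hZ2]
  generalize hs4 : (Cmd.ifz (.var 24) .skip (.assign 20 (.var 25))).exec h w s3 = s4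
  have p4 : Params h w t M s4 := hs4 ▸ p3.agree (Cmd.agree_exec h w _ s3) (by decide)
  have hZ4 : s4.A 1 0 = Z := by rw [← hs4, Cmd.exec_A _ _ _ _ (by decide), hZ3]
  have hfin : ∀ i, s4.v 20 = i → i ≤ t →
      (sumCmd.exec h w s4).v 20 = i ∧ ((sumCmd.exec h w s4).v 24 = 0 ↔ ∀ m < i, Z m = 0) :=
    fun i h1 h2 => ⟨by rw [Cmd.exec_v _ _ _ _ (by decide), h1], sumCmd_spec p4 hs.hw h1 h2 hZ4⟩
  by_cases h0 : ∀ i < t, Z i = 0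
  · have h1 : s4.v 20 = t := by
      rw [← hs4, Cmd.exec, Expr.eval, if_pos (hsum.2 h0), Cmd.exec, h20']
    refine ⟨t, (hfin t h1 le_rfl).1, ht, le_rfl, fun i _ hi => ?_, Or.inl ⟨h0, rfl⟩, (hfin t h1 le_rfl).2⟩
    have hz : ∀ i ≤ t, ∀ m < t, Z (i + m) = 0 := by
      intro i hi m hm
      by_cases h : i + m < t
      · exact h0 _ h
      · rw [show i + m = i + m - t + t by omega, hper _ (by omega), h0 _ (by omega)]
    refine (pre_congr fun m hm => ?_).le
    rw [hz i hi m hm, hz t le_rfl m hm]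
  · have h1 : s4.v 20 = j := by
      rw [← hs4, Cmd.exec, Expr.eval, if_neg (mt hsum.1 h0), Cmd.exec, State.set_v, if_pos rfl,
        Expr.eval, h25'']
    exact ⟨j, (hfin j h1 hjt).1, hj1, hjt, hmax, Or.inr ⟨h0, hmin⟩, (hfin j h1 hjt).2⟩

theorem rankCmd_spec (hs : Params h w t M s) (hwide : 64 * t ≤ w) (ht : 1 ≤ t) {d : ℕ → ℕ}
    (hd : ∀ i < t, (if i < 62 then s.A 0 0 (64 * (t - 1) + i) else s.A 0 0 (i - 62)) = d i)
    (hx : word t M (fun i => d i - 1) ∈ heavy (M + 1) t ((M + 1) * (t - 1) + 1)) :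
    1 ≤ (rankCmd.exec h w s).v 0 ∧
    (rankCmd.exec h w s).v 0 ≤ (grandUp (M + 1) t ((M + 1) * (t - 1) + 1)).length ∧
    window (grandUp (M + 1) t ((M + 1) * (t - 1) + 1)) t ((rankCmd.exec h w s).v 0 - 1)
      = word t M fun i => d i - 1 := by
  have hread := readCmd_spec hs hwide hd
  have hexec : rankCmd.exec h w s = resultCmd.exec h w (totalCmd.exec h w
    ((Cmd.assign 25 (.var 17)).exec h w (closedCmd.exec h w (targetCmd.exec h w
      (chooseCmd.exec h w (readCmd.exec h w s)))))) := rfl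
  rw [hexec]
  generalize hs1 : readCmd.exec h w s = s1 at hread ⊢
  have p1 : Params h w t M s1 := hs1 ▸ hs.agree (Cmd.agree_exec h w _ s) (by decide)
  generalize hZ : s1.A 1 0 = Z at hread
  have hx' : word t M Z = word t M fun i => d i - 1 := word_congr fun i hi => (hread i hi).1
  have hper : ∀ i < t, Z (i + t) = Z i := fun i hi => by rw [(hread i hi).1, (hread i hi).2]
  rw [← hx'] at hx ⊢
  obtain ⟨j, hj, hj1, hjt, hmax, hmin, h24⟩ := chooseCmd_spec p1 hwide ht hZ hper
  generalize hs2 : chooseCmd.exec h w s1 = s2 at hj h24 ⊢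
  have p2 : Params h w t M s2 := hs2 ▸ p1.agree (Cmd.agree_exec h w _ s1) (by decide)
  have hZ2 : s2.A 1 0 = Z := by rw [← hs2, Cmd.exec_A _ _ _ _ (by decide), hZ]
  have htar := targetCmd_spec p2 hwide hj hjt hZ2 h24
  generalize hs3 : targetCmd.exec h w s2 = s3 at htar ⊢
  have p3 : Params h w t M s3 := hs3 ▸ p2.agree (Cmd.agree_exec h w _ s2) (by decide)
  have h20 : s3.v 20 = j := by rw [← hs3, Cmd.exec_v _ _ _ _ (by decide), hj]
  have hcl := closedCmd_spec p3
  generalize hs4 : closedCmd.exec h w s3 = s4 at hcl ⊢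
  have p4 : Params h w t M s4 := hs4 ▸ p3.agree (Cmd.agree_exec h w _ s3) (by decide)
  have h20 : s4.v 20 = j := by rw [← hs4, Cmd.exec_v _ _ _ _ (by decide), h20]
  generalize hs5 : (Cmd.assign 25 (.var 17)).exec h w s4 = s5 at ⊢
  have p5 : Params h w t M s5 := hs5 ▸ p4.agree (Cmd.agree_exec h w _ s4) (by decide)
  have h20 : s5.v 20 = j := by rw [← hs5, Cmd.exec_v _ _ _ _ (by decide), h20]
  have h25 : s5.v 25 = closedCount t (s3.A 2 0) M := by
    rw [← hs5, Cmd.exec, State.set_v, if_pos rfl, Expr.eval, hcl]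
  have h26 := totalCmd_spec p5 ht
  have h20 : (totalCmd.exec h w s5).v 20 = j := by rw [Cmd.exec_v _ _ _ _ (by decide), h20]
  have h25 : (totalCmd.exec h w s5).v 25 = closedCount t (s3.A 2 0) M := by
    rw [Cmd.exec_v _ _ _ _ (by decide), h25]
  generalize totalCmd.exec h w s5 = s6 at h26 h25 h20 ⊢
  refine rank_correct ht hper hx hj1 hjt hmax hmin htar rfl ?_
  rw [← h26, ← h25, ← h20]
  simp only [resultCmd, Cmd.exec, Expr.eval, Nat.sub_eq_zero_iff_le]
  split_ifs <;> simp

end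

end SubsetCycle

namespace SubsetCycle

/-! ### The program for unranking -/

/-- Variables `5` and `6` receive the least `L` such that `M < 2 ^ L`, and `2 ^ L`. -/
def powCmd : Cmd :=
  .seq (.seq (.assign 5 (.lit 0)) (.assign 6 (.lit 1)))
    (.loop 10 0 (.ifz (.sub (.var 6) (.var 3))
      (.seq (.assign 6 (.add (.var 6) (.var 6))) (.assign 5 (.add (.var 5) (.lit 1)))) .skip))

/-- One step of the binary search for a symbol. -/
def searchCmd : Cmd :=
  .seq (.seq (.seq (.assign 30 (.half (.var 30)))
    (.put 2 (.lit 0) (.var 29) (.add (.get 2 (.lit 0) (.var 29)) (.var 30)))) closedCmd)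
    (.ifz (.sub (.sub (.var 26) (.var 17)) (.var 28))
      (.put 2 (.lit 0) (.var 29) (.sub (.get 2 (.lit 0) (.var 29)) (.var 30))) .skip)

/-- Array `2` receives the string for the necklace at the position given by variable `28`. -/
def findCmd : Cmd :=
  .seq (.loop 29 1 (.put 2 (.lit 0) (.var 29) (.lit 0)))
    (.loop 29 1 (.seq (.assign 30 (.var 6)) (.loop 31 5 searchCmd)))

/-- The output, in the order that the last part of the program expects. -/
def outputCmd : Cmd :=
  .loop 29 1 (.seq
    (.ifz (.sub (.var 26) (.add (.var 9) (.var 1)))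
      (.ifz (.add (.sub (.var 29) (.sub (.var 26) (.var 9)))
          (.sub (.sub (.var 26) (.var 9)) (.var 29)))
        (.assign 30 (.var 3)) (.assign 30 (.lit 0)))
      (.ifz (.sub (.add (.var 29) (.lit 1)) (.var 27))
        (.assign 30 (.get 7 (.lit 0) (.add (.sub (.var 1) (.var 27)) (.var 29))))
        (.assign 30 (.get 2 (.lit 0) (.sub (.var 29) (.var 27))))))
    (.ifz (.sub (.lit 64) (.var 29))
      (.put 0 (.lit 0) (.sub (.var 29) (.lit 64)) (.add (.var 30) (.lit 1)))
      (.put 0 (.lit 0) (.add (.var 1) (.var 29)) (.add (.var 30) (.lit 1)))))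

/-- The first necklace is saved because the second search overwrites array 2. -/
def copyCmd : Cmd :=
  .loop 29 1 (.put 7 (.lit 0) (.var 29) (.get 2 (.lit 0) (.var 29)))

/-- The count for the necklace found first gives the end of its block, hence j, and the second
search is made at the position where the next block starts. -/
def unrankCmd : Cmd :=
  .seq (.seq (.seq (.seq (.seq totalCmd (.assign 28 (.var 9))) findCmd)
    (.seq copyCmd (.seq closedCmd (.seq
      (.assign 27 (.sub (.sub (.var 26) (.var 17)) (.var 9)))
      (.assign 28 (.add (.var 9) (.var 27))))))) findCmd) outputCmd

/-! ### Correctness of the unranking program. -/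

section

variable {h w t M : ℕ} {s : State}

/-- Either the power already exceeds M or the exponent equals the number of iterations made. Since M
≤ n < 2^n, with n the loop bound in variable 0, the former holds at the end. -/
theorem powCmd_spec (hs : s.v 3 = M) (hn : M ≤ s.v 0) :
    (powCmd.exec h w s).v 6 = 2 ^ (powCmd.exec h w s).v 5 ∧
    2 ^ (powCmd.exec h w s).v 5 ≤ 2 * M + 1 ∧ M < 2 ^ (powCmd.exec h w s).v 5 := by
  have key := Cmd.exec_loop (h := h) (w := w) (x := 10) (y := 0) (c := .ifz (.sub (.var 6) (.var 3))
      (.seq (.assign 6 (.add (.var 6) (.var 6))) (.assign 5 (.add (.var 5) (.lit 1)))) .skip)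
    (s := (Cmd.seq (.assign 5 (.lit 0)) (.assign 6 (.lit 1))).exec h w s)
    (Q := fun n u => u.v 6 = 2 ^ u.v 5 ∧ 2 ^ u.v 5 ≤ 2 * M + 1 ∧ (M < 2 ^ u.v 5 ∨ u.v 5 = n))
    (by decide) ?_ ?_
  · obtain ⟨h1, h2, h3⟩ := key
    refine ⟨h1, h2, ?_⟩
    rcases h3 with h3 | h3
    · exact h3
    · have h4 : ((Cmd.seq (.assign 5 (.lit 0)) (.assign 6 (.lit 1))).exec h w s).v 0 = s.v 0 := rfl
      rw [h4] at h3
      change M < 2 ^ ((Cmd.loop 10 0 _).exec h w _).v 5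
      rw [h3]
      exact hn.trans_lt Nat.lt_two_pow_self
  · simp [Cmd.exec, Expr.eval]
  · rintro p u _ _ hu ⟨h1, h2, h3⟩
    have hv3 : u.v 3 = M := by rw [hu.1 3 (by decide)]; exact hs
    simp only [Cmd.exec, Expr.eval, hv3, Nat.sub_eq_zero_iff_le]
    by_cases hc : u.v 6 ≤ M
    · simp only [if_pos hc, State.set_v]
      norm_num
      rw [pow_succ, h1]
      omega
    · simp only [if_neg hc, State.set_v]
      norm_num
      refine ⟨h1, h2, Or.inl ?_⟩
      omega

/-- The unknown letter c p lies in an interval of length 2^(e + 1) that starts at the current entry.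
Half of the length is added tentatively and taken back if the count shows that the candidate is too
large. -/
theorem searchCmd_spec (hs : Params h w t M s) {q N p e : ℕ} {c : ℕ → ℕ}
    (hc : ∀ y, pre y t ≤ pre c t ↔ q < N - closedCount t y M) (hN : s.v 26 = N) (hq : s.v 28 = q)
    (hp : s.v 29 = p) (hpt : p < t) (he : s.v 30 = 2 ^ (e + 1))
    (h1 : ∀ i < p, s.A 2 0 i = c i) (h2 : ∀ i, p < i → i < t → s.A 2 0 i = 0)
    (h3 : s.A 2 0 p ≤ c p) (h4 : c p < s.A 2 0 p + 2 ^ (e + 1)) :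
    (searchCmd.exec h w s).v 30 = 2 ^ e ∧
    (∀ i < p, (searchCmd.exec h w s).A 2 0 i = c i) ∧
    (∀ i, p < i → i < t → (searchCmd.exec h w s).A 2 0 i = 0) ∧
    (searchCmd.exec h w s).A 2 0 p ≤ c p ∧ c p < (searchCmd.exec h w s).A 2 0 p + 2 ^ e := by
  have hhw := hs.hw
  have e1 : min p w = p := by omega
  have hexec : searchCmd.exec h w s = (Cmd.ifz (.sub (.sub (.var 26) (.var 17)) (.var 28))
      (.put 2 (.lit 0) (.var 29) (.sub (.get 2 (.lit 0) (.var 29)) (.var 30))) .skip).exec h w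
      (closedCmd.exec h w ((Cmd.seq (.assign 30 (.half (.var 30)))
        (.put 2 (.lit 0) (.var 29) (.add (.get 2 (.lit 0) (.var 29)) (.var 30)))).exec h w s)) := rfl
  rw [hexec]
  generalize hs1 : (Cmd.seq (.assign 30 (.half (.var 30)))
        (.put 2 (.lit 0) (.var 29) (.add (.get 2 (.lit 0) (.var 29)) (.var 30)))).exec h w s = s1
  have p1 : Params h w t M s1 := hs1 ▸ hs.agree (Cmd.agree_exec h w _ s) (by decide)
  have a30 : s1.v 30 = 2 ^ e := by
    rw [← hs1]
    simp [Cmd.exec, Expr.eval, he, pow_succ]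
  have a26 : s1.v 26 = N := by rw [← hs1, Cmd.exec_v _ _ _ _ (by decide), hN]
  have a28 : s1.v 28 = q := by rw [← hs1, Cmd.exec_v _ _ _ _ (by decide), hq]
  have a29 : s1.v 29 = p := by rw [← hs1, Cmd.exec_v _ _ _ _ (by decide), hp]
  have aA : ∀ i, s1.A 2 0 i = if i = p then s.A 2 0 p + 2 ^ e else s.A 2 0 i := by
    intro i
    rw [← hs1]
    simp [Cmd.exec, Expr.eval, he, hp, e1, pow_succ]
  have hcl := closedCmd_spec p1
  generalize hs2 : closedCmd.exec h w s1 = s2 at hcl ⊢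
  have b30 : s2.v 30 = 2 ^ e := by rw [← hs2, Cmd.exec_v _ _ _ _ (by decide), a30]
  have b26 : s2.v 26 = N := by rw [← hs2, Cmd.exec_v _ _ _ _ (by decide), a26]
  have b28 : s2.v 28 = q := by rw [← hs2, Cmd.exec_v _ _ _ _ (by decide), a28]
  have b29 : s2.v 29 = p := by rw [← hs2, Cmd.exec_v _ _ _ _ (by decide), a29]
  have bA : s2.A 2 = s1.A 2 := by rw [← hs2, Cmd.exec_A _ _ _ _ (by decide)]
  have htest : s1.A 2 0 p ≤ c p ↔ q < N - closedCount t (s1.A 2 0) M := by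
    rw [← hc]
    refine (pre_le_pre_iff hpt (fun i hi => ?_) fun i hi hit => ?_).symm
    · rw [aA, if_neg (by omega), h1 i hi]
    · rw [aA, if_neg (by omega), h2 i hi hit]
  rw [aA, if_pos rfl] at htest
  have hpow : 2 ^ (e + 1) = 2 ^ e + 2 ^ e := by rw [pow_succ]; omega
  rw [Cmd.exec]
  simp only [Expr.eval, b26, b28, hcl]
  by_cases hle : s.A 2 0 p + 2 ^ e ≤ c p
  · have := htest.1 hle
    rw [if_neg (by omega), Cmd.exec, bA]
    refine ⟨b30, fun i hi => ?_, fun i hi hit => ?_, ?_, ?_⟩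
    · rw [aA, if_neg (by omega), h1 i hi]
    · rw [aA, if_neg (by omega), h2 i hi hit]
    · rw [aA, if_pos rfl]; exact hle
    · rw [aA, if_pos rfl]; omega
  · have := mt htest.2 hle
    rw [if_pos (by omega)]
    have fA : ∀ i, ((Cmd.put 2 (.lit 0) (.var 29) (.sub (.get 2 (.lit 0) (.var 29)) (.var 30))).exec
        h w s2).A 2 0 i = s.A 2 0 i := by
      intro i
      simp only [Cmd.exec, Expr.eval, b29, b30, e1, Nat.zero_min, State.setA_A, true_and, bA, aA,
        if_true]
      split_ifs with hi
      · rw [hi]; omega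
      · rfl
    refine ⟨b30, fun i hi => ?_, fun i hi hit => ?_, ?_, ?_⟩
    · rw [fA, h1 i hi]
    · rw [fA, h2 i hi hit]
    · rw [fA]; exact h3
    · rw [fA]; omega

/-- Letters are found from left to right, each search starting with the interval from 0 to 2^L,
which contains all letters up to M. -/
theorem findCmd_spec (hs : Params h w t M s) {q N L : ℕ} {c : ℕ → ℕ} (hcM : ∀ i, c i ≤ M)
    (hc : ∀ y, pre y t ≤ pre c t ↔ q < N - closedCount t y M) (hN : s.v 26 = N) (hq : s.v 28 = q)
    (hL : s.v 5 = L) (hpow : s.v 6 = 2 ^ L) (hML : M < 2 ^ L) :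
    ∀ i < t, (findCmd.exec h w s).A 2 0 i = c i := by
  have hhw := hs.hw
  rw [findCmd, Cmd.exec]
  have h0 : ∀ i < t, ((Cmd.loop 29 1 (.put 2 (.lit 0) (.var 29) (.lit 0))).exec h w s).A 2 0 i = 0 := by
    intro i hi
    refine Cmd.exec_fillRow (fun _ => 0) (by decide) ?_ (by rw [hs.v1]; exact hi)
    intro p u hp hup hu _ q'
    rw [hs.v1] at hp
    have e1 : min p w = p := by omega
    simp [Cmd.exec, Expr.eval, hup, e1]
  generalize hs1 : (Cmd.loop 29 1 (.put 2 (.lit 0) (.var 29) (.lit 0))).exec h w s = s1 at h0 ⊢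
  have p1 : Params h w t M s1 := hs1 ▸ hs.agree (Cmd.agree_exec h w _ s) (by decide)
  have hag : ∀ z, z ≠ 29 → s1.v z = s.v z := fun z hz => by
    rw [← hs1, Cmd.exec_v _ _ _ _ (by simpa [Cmd.writes] using hz)]
  have key := Cmd.exec_loop (h := h) (w := w) (x := 29) (y := 1)
    (c := .seq (.assign 30 (.var 6)) (.loop 31 5 searchCmd)) (s := s1)
    (Q := fun n u => (∀ i < n, u.A 2 0 i = c i) ∧ ∀ i, n ≤ i → i < t → u.A 2 0 i = 0)
    (by decide) ?_ ?_
  · rw [p1.v1] at key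
    exact key.1
  · exact ⟨fun i hi => absurd hi (Nat.not_lt_zero _), fun i _ hi => h0 i hi⟩
  · rintro p u hp hup hu ⟨hQ1, hQ2⟩
    have pu := p1.agree hu (by decide)
    rw [p1.v1] at hp
    rw [Cmd.exec]
    generalize hs2 : (Cmd.assign 30 (.var 6)).exec h w u = u2
    have pu2 : Params h w t M u2 := hs2 ▸ pu.agree (Cmd.agree_exec h w _ u) (by decide)
    have huv : ∀ z ∈ [5, 6, 26, 28], u.v z = s.v z := by
      intro z hz
      rw [hu.1 z, hag z]
      · rintro rfl; exact absurd hz (by decide)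
      · revert z; decide
    have huv2 : ∀ z, z ≠ 30 → u2.v z = u.v z := fun z hz => by
      rw [← hs2, Cmd.exec_v _ _ _ _ (by simpa [Cmd.writes] using hz)]
    have hA2 : u2.A = u.A := by rw [← hs2]; rfl
    have b5 : u2.v 5 = L := by rw [huv2 5 (by decide), huv 5 (by decide), hL]
    have b30 : u2.v 30 = 2 ^ L := by
      rw [← hs2, Cmd.exec, State.set_v, if_pos rfl, Expr.eval, huv 6 (by decide), hpow]
    have b26 : u2.v 26 = N := by rw [huv2 26 (by decide), huv 26 (by decide), hN]
    have b28 : u2.v 28 = q := by rw [huv2 28 (by decide), huv 28 (by decide), hq]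
    have b29 : u2.v 29 = p := by rw [huv2 29 (by decide), hup]
    have key2 := Cmd.exec_loop (h := h) (w := w) (x := 31) (y := 5) (c := searchCmd) (s := u2)
      (Q := fun n v => v.v 30 = 2 ^ (L - n) ∧ (∀ i < p, v.A 2 0 i = c i) ∧
        (∀ i, p < i → i < t → v.A 2 0 i = 0) ∧ v.A 2 0 p ≤ c p ∧
        c p < v.A 2 0 p + 2 ^ (L - n)) (by decide) ?_ ?_
    · rw [b5, Nat.sub_self, pow_zero] at key2
      obtain ⟨-, k1, k2, k3, k4⟩ := key2
      refine ⟨fun i hi => ?_, fun i hi hit => ?_⟩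
      · rw [State.set_A]
        rcases Nat.lt_succ_iff_lt_or_eq.1 hi with h | rfl
        · exact k1 i h
        · omega
      · rw [State.set_A]
        exact k2 i (by omega) hit
    · simp only [State.set_A, State.set_v, hA2]
      refine ⟨b30, hQ1, fun i hi hit => hQ2 i (by omega) hit, ?_, ?_⟩
      · rw [hQ2 p le_rfl hp]; exact Nat.zero_le _
      · have := hcM p
        rw [Nat.sub_zero]; omega
    · rintro n v hn _ hv ⟨k0, k1, k2, k3, k4⟩
      rw [b5] at hn
      have pv := pu2.agree hv (by decide)
      have hLn : L - n = L - (n + 1) + 1 := by omega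
      rw [hLn] at k0 k4
      have := searchCmd_spec pv hc (by rw [hv.1 26 (by decide), b26])
        (by rw [hv.1 28 (by decide), b28]) (by rw [hv.1 29 (by decide), b29]) hp k0 k1 k2 k3 k4
      simpa using this

/-- Symbol i ≥ 64 goes to column i - 64, which is register i, its final place. The registers of the
first 64 symbols are still in use, so these symbols are parked in the columns from t on, behind all
the others. -/
theorem outputCmd_spec (hs : Params h w t M s) (hwide : 64 * t + 64 ≤ w) {q N j : ℕ}
    (hq : s.v 9 = q) (hN : s.v 26 = N) (hj : s.v 27 = j) {e : ℕ → ℕ}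
    (he : ∀ i < t, e i = if N ≤ q + t then if i = N - q then M else 0
      else if i < j then s.A 7 0 (t - j + i) else s.A 2 0 (i - j)) (hjt : N > q + t → j ≤ t) :
    ∀ i < t, (if i < 64 then (outputCmd.exec h w s).A 0 0 (t + i)
      else (outputCmd.exec h w s).A 0 0 (i - 64)) = e i + 1 := by
  have hhw := hs.hw
  have key := Cmd.exec_loop (h := h) (w := w) (s := s) (x := 29) (y := 1) (Q := fun n u => ∀ i < n,
    (if i < 64 then u.A 0 0 (t + i) else u.A 0 0 (i - 64)) = e i + 1) (c := .seq
    (.ifz (.sub (.var 26) (.add (.var 9) (.var 1)))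
      (.ifz (.add (.sub (.var 29) (.sub (.var 26) (.var 9)))
          (.sub (.sub (.var 26) (.var 9)) (.var 29)))
        (.assign 30 (.var 3)) (.assign 30 (.lit 0)))
      (.ifz (.sub (.add (.var 29) (.lit 1)) (.var 27))
        (.assign 30 (.get 7 (.lit 0) (.add (.sub (.var 1) (.var 27)) (.var 29))))
        (.assign 30 (.get 2 (.lit 0) (.sub (.var 29) (.var 27))))))
    (.ifz (.sub (.lit 64) (.var 29))
      (.put 0 (.lit 0) (.sub (.var 29) (.lit 64)) (.add (.var 30) (.lit 1)))
      (.put 0 (.lit 0) (.add (.var 1) (.var 29)) (.add (.var 30) (.lit 1))))) (by decide)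
    (fun i hi => absurd hi (Nat.not_lt_zero _)) ?_
  · rw [hs.v1] at key
    exact key
  intro p u hp hup hu hQ i hi
  have pu := hs.agree hu (by decide)
  rw [hs.v1] at hp
  have a9 : u.v 9 = q := by rw [hu.1 9 (by decide), hq]
  have a26 : u.v 26 = N := by rw [hu.1 26 (by decide), hN]
  have a27 : u.v 27 = j := by rw [hu.1 27 (by decide), hj]
  have a7 : u.A 7 = s.A 7 := by rw [hu.2 7 (by decide)]
  have a2 : u.A 2 = s.A 2 := by rw [hu.2 2 (by decide)]
  rw [State.set_A, Cmd.exec]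
  generalize hs1 : (Cmd.ifz (.sub (.var 26) (.add (.var 9) (.var 1)))
      (.ifz (.add (.sub (.var 29) (.sub (.var 26) (.var 9)))
          (.sub (.sub (.var 26) (.var 9)) (.var 29)))
        (.assign 30 (.var 3)) (.assign 30 (.lit 0)))
      (.ifz (.sub (.add (.var 29) (.lit 1)) (.var 27))
        (.assign 30 (.get 7 (.lit 0) (.add (.sub (.var 1) (.var 27)) (.var 29))))
        (.assign 30 (.get 2 (.lit 0) (.sub (.var 29) (.var 27)))))).exec h w u = u1
  have b30 : u1.v 30 = e p := by
    rw [he p hp, ← hs1]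
    simp only [Cmd.exec, Expr.eval, a9, a26, a27, pu.v1, pu.v3, hup, sub_add_sub_eq_zero, a7, a2,
      Nat.sub_eq_zero_iff_le, Nat.zero_min]
    by_cases h1 : N ≤ q + t
    · rw [if_pos h1, if_pos h1]
      split_ifs <;> simp
    · have := hjt (by omega)
      rw [if_neg h1, if_neg h1]
      by_cases h2 : p < j
      · rw [if_pos h2, if_pos (by omega), State.set_v, if_pos rfl,
          show min (t - j + p) w = t - j + p by omega]
      · rw [if_neg h2, if_neg (by omega), State.set_v, if_pos rfl,
          show min (p - j) w = p - j by omega]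
  have b29 : u1.v 29 = p := by rw [← hs1, Cmd.exec_v _ _ _ _ (by decide), hup]
  have b1 : u1.v 1 = t := by rw [← hs1, Cmd.exec_v _ _ _ _ (by decide), pu.v1]
  have bA : u1.A 0 = u.A 0 := by rw [← hs1, Cmd.exec_A _ _ _ _ (by decide)]
  simp only [Cmd.exec, Expr.eval, b29, b30, b1, Nat.zero_min, Nat.sub_eq_zero_iff_le]
  have e1 : min (p - 64) w = p - 64 := by omega
  have hQi : i < p → (if i < 64 then u.A 0 0 (t + i) else u.A 0 0 (i - 64)) = e i + 1 := hQ i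
  have hip : i < p ∨ i = p := by omega
  by_cases hp64 : 64 ≤ p
  · rw [if_pos hp64]
    simp only [State.setA_A, true_and, e1, bA]
    by_cases hi64 : i < 64
    · rw [if_pos hi64] at hQi ⊢
      rw [if_neg (by omega)]
      exact hQi (by omega)
    · rw [if_neg hi64] at hQi ⊢
      rcases hip with hip | rfl
      · rw [if_neg (by omega)]
        exact hQi hip
      · rw [if_pos rfl]
  · rw [if_neg hp64, if_pos (by omega : i < 64)]
    rw [if_pos (by omega : i < 64)] at hQi
    have e2 : min (t + p) w = t + p := by omega
    simp only [State.setA_A, true_and, e2, bA]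
    rcases hip with hip | rfl
    · rw [if_neg (by omega)]
      exact hQi hip
    · rw [if_pos rfl]

theorem unrankCmd_spec (hs : Params h w t M s) (hwide : 64 * t + 64 ≤ w) (ht : 1 ≤ t) {q L : ℕ}
    (hL : s.v 5 = L) (hpow : s.v 6 = 2 ^ L) (hML : M < 2 ^ L) (hq : s.v 9 = q)
    (hqN : q < (grandUp (M + 1) t ((M + 1) * (t - 1) + 1)).length) :
    ∃ e : ℕ → ℕ,
      window (grandUp (M + 1) t ((M + 1) * (t - 1) + 1)) t q = word t M e ∧
      ∀ i < t, (if i < 64 then (unrankCmd.exec h w s).A 0 0 (t + i)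
        else (unrankCmd.exec h w s).A 0 0 (i - 64)) = e i + 1 := by
  have hhw := hs.hw
  obtain ⟨N, hN⟩ : ∃ N, N = (grandUp (M + 1) t ((M + 1) * (t - 1) + 1)).length := ⟨_, rfl⟩
  -- The test determines the necklace, so this one statement serves both searches.
  have hword : ∀ q' (u : State), Params h w t M u → u.v 26 = N → u.v 28 = q' → u.v 5 = L →
      u.v 6 = 2 ^ L → ∀ α ∈ necklacesUp (M + 1) t ((M + 1) * (t - 1) + 1),
      (∀ y, α ≤ y ↔ q' < N - countAbove (M + 1) t ((M + 1) * (t - 1) + 1) y) →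
      word t M ((findCmd.exec h w u).A 2 0) = α := by
    intro q' u pu h26 h28 h5 h6 α hα hle
    obtain ⟨h1, h2, -⟩ := mem_heavy.1 (mem_necklacesUp.1 hα).1
    obtain ⟨c, hcM, rfl⟩ := exists_word_eq h1 h2
    exact word_congr (findCmd_spec pu hcM (pre_le_iff_lt ht hcM hle) h26 h28 h5 h6 hML)
  have hexec : unrankCmd.exec h w s = outputCmd.exec h w (findCmd.exec h w
    ((Cmd.seq (.assign 27 (.sub (.sub (.var 26) (.var 17)) (.var 9)))
      (.assign 28 (.add (.var 9) (.var 27)))).exec h w (closedCmd.exec h w (copyCmd.exec h w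
      (findCmd.exec h w ((Cmd.assign 28 (.var 9)).exec h w (totalCmd.exec h w s))))))) := by
    simp only [unrankCmd, Cmd.exec]
  rw [hexec]
  have h26 := totalCmd_spec hs ht
  rw [← hN] at h26 hqN
  have hag : ∀ z ∈ [5, 6, 9], (totalCmd.exec h w s).v z = s.v z := by
    intro z hz
    refine Cmd.exec_v _ _ _ _ ?_
    revert z; decide
  have p1 : Params h w t M (totalCmd.exec h w s) := hs.agree (Cmd.agree_exec h w _ s) (by decide)
  generalize totalCmd.exec h w s = s1 at h26 hag p1 ⊢
  have p2 : Params h w t M ((Cmd.assign 28 (.var 9)).exec h w s1) :=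
    p1.agree (Cmd.agree_exec h w _ s1) (by decide)
  have hag2 : ∀ z ∈ [5, 6, 9, 26], ((Cmd.assign 28 (.var 9)).exec h w s1).v z = s1.v z := by
    intro z hz
    refine Cmd.exec_v _ _ _ _ ?_
    revert z; decide
  have h28 : ((Cmd.assign 28 (.var 9)).exec h w s1).v 28 = q := by
    rw [Cmd.exec, State.set_v, if_pos rfl, Expr.eval, hag 9 (by decide), hq]
  generalize (Cmd.assign 28 (.var 9)).exec h w s1 = s2 at p2 hag2 h28 ⊢
  have hw2 := hword q s2 p2 (by rw [hag2 26 (by decide), h26]) h28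
    (by rw [hag2 5 (by decide), hag 5 (by decide), hL])
    (by rw [hag2 6 (by decide), hag 6 (by decide), hpow])
  have p3 : Params h w t M (findCmd.exec h w s2) := p2.agree (Cmd.agree_exec h w _ s2) (by decide)
  have hag3 : ∀ z ∈ [5, 6, 9, 26], (findCmd.exec h w s2).v z = s2.v z := by
    intro z hz
    refine Cmd.exec_v _ _ _ _ ?_
    revert z; decide
  generalize findCmd.exec h w s2 = s3 at hw2 p3 hag3 ⊢
  have hcopy : ∀ i < t, (copyCmd.exec h w s3).A 7 0 i = s3.A 2 0 i := by
    intro i hi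
    refine Cmd.exec_fillRow (fun i => s3.A 2 0 i) (by decide) ?_ (by rw [p3.v1]; exact hi)
    intro p u hp hup hu _ q'
    rw [p3.v1] at hp
    have e1 : min p w = p := by omega
    have h2 : u.A 2 = s3.A 2 := hu.2 2 (by decide)
    simp [Cmd.exec, Expr.eval, hup, e1, h2]
  have hcopy2 : (copyCmd.exec h w s3).A 2 = s3.A 2 := Cmd.exec_A _ _ _ _ (by decide)
  have p4 : Params h w t M (copyCmd.exec h w s3) := p3.agree (Cmd.agree_exec h w _ s3) (by decide)
  have hag4 : ∀ z ∈ [5, 6, 9, 26], (copyCmd.exec h w s3).v z = s3.v z := by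
    intro z hz
    refine Cmd.exec_v _ _ _ _ ?_
    revert z; decide
  generalize copyCmd.exec h w s3 = s4 at hcopy hcopy2 p4 hag4 ⊢
  have hcl := closedCmd_spec p4
  have p5 : Params h w t M (closedCmd.exec h w s4) := p4.agree (Cmd.agree_exec h w _ s4) (by decide)
  have hag5 : ∀ z ∈ [5, 6, 9, 26], (closedCmd.exec h w s4).v z = s4.v z := by
    intro z hz
    refine Cmd.exec_v _ _ _ _ ?_
    revert z; decide
  have h75 : (closedCmd.exec h w s4).A 7 = s4.A 7 := Cmd.exec_A _ _ _ _ (by decide)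
  generalize closedCmd.exec h w s4 = s5 at hcl p5 hag5 h75 ⊢
  have hall : ∀ z ∈ [5, 6, 9], s5.v z = s.v z := by
    intro z hz
    have hz' : z ∈ [5, 6, 9, 26] := List.mem_append_left [26] hz
    rw [hag5 z hz', hag4 z hz', hag3 z hz', hag2 z hz', hag z hz]
  have h526 : s5.v 26 = N := by
    rw [hag5 26 (by decide), hag4 26 (by decide), hag3 26 (by decide), hag2 26 (by decide), h26]
  have p6 : Params h w t M ((Cmd.seq (.assign 27 (.sub (.sub (.var 26) (.var 17)) (.var 9)))
      (.assign 28 (.add (.var 9) (.var 27)))).exec h w s5) :=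
    p5.agree (Cmd.agree_exec h w _ s5) (by decide)
  have hag6 : ∀ z ∈ [5, 6, 9, 26], ((Cmd.seq (.assign 27 (.sub (.sub (.var 26) (.var 17)) (.var 9)))
      (.assign 28 (.add (.var 9) (.var 27)))).exec h w s5).v z = s5.v z := by
    intro z hz
    refine Cmd.exec_v _ _ _ _ ?_
    revert z; decide
  have h76 : ((Cmd.seq (.assign 27 (.sub (.sub (.var 26) (.var 17)) (.var 9)))
      (.assign 28 (.add (.var 9) (.var 27)))).exec h w s5).A 7 = s5.A 7 := rfl
  obtain ⟨j, hj⟩ : ∃ j, j = N - closedCount t (s3.A 2 0) M - q := ⟨_, rfl⟩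
  have h27 : ((Cmd.seq (.assign 27 (.sub (.sub (.var 26) (.var 17)) (.var 9)))
      (.assign 28 (.add (.var 9) (.var 27)))).exec h w s5).v 27 = j ∧
      ((Cmd.seq (.assign 27 (.sub (.sub (.var 26) (.var 17)) (.var 9)))
      (.assign 28 (.add (.var 9) (.var 27)))).exec h w s5).v 28 = q + j := by
    simp [Cmd.exec, Expr.eval, h526, hcl, hcopy2, hall 9 (by decide), hq, hj]
  generalize (Cmd.seq (.assign 27 (.sub (.sub (.var 26) (.var 17)) (.var 9)))
      (.assign 28 (.add (.var 9) (.var 27)))).exec h w s5 = s6 at p6 hag6 h76 h27 ⊢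
  have hw6 := hword (q + j) s6 p6 (by rw [hag6 26 (by decide), h526]) h27.2
    (by rw [hag6 5 (by decide), hall 5 (by decide), hL])
    (by rw [hag6 6 (by decide), hall 6 (by decide), hpow])
  have p7 : Params h w t M (findCmd.exec h w s6) := p6.agree (Cmd.agree_exec h w _ s6) (by decide)
  have hag7 : ∀ z ∈ [9, 26, 27], (findCmd.exec h w s6).v z = s6.v z := by
    intro z hz
    refine Cmd.exec_v _ _ _ _ ?_
    revert z; decide
  have h77 : (findCmd.exec h w s6).A 7 = s6.A 7 := Cmd.exec_A _ _ _ _ (by decide)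
  generalize findCmd.exec h w s6 = s7 at hw6 p7 hag7 h77 ⊢
  have hA7 : ∀ i < t, s7.A 7 0 i = s3.A 2 0 i := fun i hi => by rw [h77, h76, h75, hcopy i hi]
  -- A block has at most t letters; this makes the subtraction t - j in the output a true one.
  have hjt : N > q + t → j ≤ t := by
    intro hlt
    obtain ⟨α, hα, -, -, j', -, h2, h3, h4, -⟩ :=
      window_eq_of_lt (k := M + 1) (by omega) ht (q := q) (by rw [← hN]; exact hlt)
    rw [← hN] at h3 h4
    rw [hj, ← countAbove_word ht, hw2 α hα h3, ← h4]
    exact h2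
  refine ⟨fun i => if N ≤ q + t then if i = N - q then M else 0
      else if i < j then s7.A 7 0 (t - j + i) else s7.A 2 0 (i - j), ?_,
    outputCmd_spec p7 hwide (by rw [hag7 9 (by decide), hag6 9 (by decide), hall 9 (by decide), hq])
      (by rw [hag7 26 (by decide), hag6 26 (by decide), h526])
      (by rw [hag7 27 (by decide), h27.1]) (fun i _ => rfl) hjt⟩
  have hcong : word t M (s7.A 7 0) = word t M (s3.A 2 0) := word_congr hA7
  refine unrank_correct ht hN hqN (a := s7.A 7 0) (b := s7.A 2 0) (j := j) ?_ ?_ ?_ fun i _ => rfl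
  · intro _ α hα hle
    rw [hcong, hw2 α hα hle]
  · rw [hj, closedCount_congr ht hA7]
  · exact fun _ α hα hle => hw6 α hα hle

end

end SubsetCycle

namespace SubsetCycle

/-! ### Degrees of the time bounds -/

/-- The largest sum of the degrees of the bounds of nested loops. -/
def Cmd.degree (f : ℕ → ℕ) : Cmd → ℕ
  | .skip => 0
  | .assign _ _ => 0
  | .put _ _ _ _ => 0
  | .seq c d => max (c.degree f) (d.degree f)
  | .ifz _ c d => max (c.degree f) (d.degree f)
  | .loop _ y c => f y + c.degree f

theorem Cmd.weight_le {a b c : ℕ} (ha : 1 ≤ a) (hb : 1 ≤ b) (hc : 1 ≤ c) (f f' f'' : ℕ → ℕ)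
    (d : Cmd) : d.weight (fun y => a ^ f y * b ^ f' y * c ^ f'' y)
      ≤ a ^ d.degree f * b ^ d.degree f' * c ^ d.degree f'' := by
  have hmono : ∀ {i i' j j' k k' : ℕ}, i ≤ i' → j ≤ j' → k ≤ k' →
      a ^ i * b ^ j * c ^ k ≤ a ^ i' * b ^ j' * c ^ k' := fun hi hj hk =>
    Nat.mul_le_mul (Nat.mul_le_mul (Nat.pow_le_pow_right ha hi) (Nat.pow_le_pow_right hb hj))
      (Nat.pow_le_pow_right hc hk)
  induction d with
  | skip => simp [weight, degree]
  | assign => simp [weight, degree]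
  | put => simp [weight, degree]
  | seq d e ihd ihe =>
    exact max_le (ihd.trans (hmono (le_max_left _ _) (le_max_left _ _) (le_max_left _ _)))
      (ihe.trans (hmono (le_max_right _ _) (le_max_right _ _) (le_max_right _ _)))
  | ifz _ d e ihd ihe =>
    exact max_le (ihd.trans (hmono (le_max_left _ _) (le_max_left _ _) (le_max_left _ _)))
      (ihe.trans (hmono (le_max_right _ _) (le_max_right _ _) (le_max_right _ _)))
  | loop x y d ih =>
    simp only [weight, degree, pow_add]
    refine (Nat.mul_le_mul_left _ ih).trans (le_of_eq ?_)
    ring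

/-- The degrees of the loop bounds in `t`, in `n` and in the length of the binary search. -/
def degT (y : ℕ) : ℕ := if y = 1 ∨ y = 2 then 1 else 0

def degN (y : ℕ) : ℕ := if y = 0 ∨ y = 4 then 1 else 0

def degL (y : ℕ) : ℕ := if y = 5 then 1 else 0

/-- The exponents are functions of the syntax, so for a concrete command they are found by `decide`.
-/
theorem Cmd.cost_le_pow {n t L i j k : ℕ} {σ : ℕ → ℕ} (ht : 1 ≤ t) (hn : 1 ≤ n) (hL : 1 ≤ L)
    (c : Cmd) (hσ : ∀ y ∈ c.bounds, σ y ≤ 2 * (t ^ degT y * n ^ degN y * L ^ degL y))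
    (hi : c.degree degT = i) (hj : c.degree degN = j) (hk : c.degree degL = k) :
    c.cost σ ≤ c.cost (fun _ => 2) * (t ^ i * n ^ j * L ^ k) := by
  subst hi hj hk
  refine (c.cost_le (g := fun y => t ^ degT y * n ^ degN y * L ^ degL y) (fun y _ => ?_) hσ).trans
    (Nat.mul_le_mul_left _ (c.weight_le ht hn hL _ _ _))
  exact Nat.mul_pos (Nat.mul_pos (Nat.pow_pos ht) (Nat.pow_pos hn)) (Nat.pow_pos hL)

/-! ### Input and output -/

/-- The state that the registers represent. -/
def memState (h w : ℕ) (m : ℕ → ℕ) : State := ⟨m, fun j i c => m (addr h w j i c)⟩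

theorem rel_memState {h w : ℕ} {m : ℕ → ℕ} (h40 : m 40 = h) (h41 : m 41 = h + 1) (h42 : m 42 = w)
    (h43 : m 43 = w + 1) : Rel h w (memState h w m) m :=
  ⟨fun _ _ => rfl, h40, h41, h42, h43, fun _ _ _ _ _ => rfl⟩

theorem addr_zero (h w c : ℕ) : addr h w 0 0 c = 64 + c := by simp [addr]

/-- The width of the arrays. -/
def width (n t : ℕ) : ℕ := 64 * t + n + 64

/-- The number of registers. -/
def space (n t : ℕ) : ℕ := 64 + 8 * (t + 1) * (width n t + 1)

/-- The source of the range conditions for the hand-written code. -/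
theorem width_le_space (n t : ℕ) : 64 + width n t + 2 * t < space n t := by
  have h1 : 1 * (width n t + 1) ≤ (t + 1) * (width n t + 1) := Nat.mul_le_mul_right _ (by omega)
  have h2 : t ≤ width n t := by rw [width]; omega
  have h3 : space n t = 64 + 8 * ((t + 1) * (width n t + 1)) := by rw [space, Nat.mul_assoc]
  omega

/-- In fact the space is at most 2144 n t, since `width n t + 1` is at most 130 n and t + 1 is at
most 2 t. -/
theorem space_le {n t : ℕ} (ht : 1 ≤ t) (htn : t ≤ n) : space n t ≤ 2144 * (n * t ^ 3) := by
  have h1 : space n t ≤ 64 * (n * t) + 8 * (2 * t) * (130 * n) := by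
    refine Nat.add_le_add (Nat.le_mul_of_pos_right _ (Nat.mul_pos (by omega) ht)) ?_
    exact Nat.mul_le_mul (Nat.mul_le_mul_left _ (by omega)) (by rw [width]; omega)
  have h2 : t ≤ t ^ 3 := Nat.le_self_pow (by omega) t
  have h3 := Nat.mul_le_mul_left n h2
  nlinarith

/-- The code that prepares the parameters of the problem. -/
def setupCode : List Instr :=
  [.const 10 1, .sub 3 0 1, .add 4 3 10, .add 2 1 10, .copy 40 1, .copy 41 2, .const 11 64,
    .mul 42 1 11, .add 42 42 0, .add 42 42 11, .add 43 42 10]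

theorem setupCode_spec {n t S : ℕ} {m : ℕ → ℕ} (hS : 64 ≤ S) (h0 : m 0 = n) (h1 : m 1 = t) :
    SafeCode S setupCode m ∧
    Rel t (width n t) (memState t (width n t) (effects setupCode m)) (effects setupCode m) ∧
    Params t (width n t) t (n - t) (memState t (width n t) (effects setupCode m)) ∧
    effects setupCode m 0 = n ∧ effects setupCode m 9 = m 9 ∧
    ∀ r, 64 ≤ r → effects setupCode m r = m r := by
  have hv : ∀ r, effects setupCode m r = if r = 43 then width n t + 1 else if r = 42 then width n t else
      if r = 11 then 64 else if r = 41 then t + 1 else if r = 40 then t else if r = 2 then t + 1 else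
      if r = 4 then n - t + 1 else if r = 3 then n - t else if r = 10 then 1 else m r := by
    intro r
    simp only [setupCode, effects, Instr.effect, Instr.exec, Config.write, Function.update_apply, h0,
      h1, width]
    norm_num
    split_ifs <;> omega
  refine ⟨?_, rel_memState ?_ ?_ ?_ ?_, ⟨le_rfl, ?_, ?_, ?_, ?_, ?_, ?_⟩, ?_, ?_, fun r hr => ?_⟩
  · simp only [setupCode, SafeCode, Instr.straight, Instr.accessed, List.mem_cons, List.not_mem_nil,
      or_false, forall_eq_or_imp, forall_eq, true_and, and_true]
    omega
  · simp [hv]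
  · simp [hv]
  · simp [hv]
  · simp [hv]
  · rw [width]; omega
  · rw [width]; omega
  · simp [memState, hv, h1]
  · simp [memState, hv]
  · simp [memState, hv]
  · simp [memState, hv]
  · simp [hv, h0]
  · simp [hv]
  · rw [hv]
    repeat rw [if_neg (by omega)]

/-- The code that copies the registers `3, …, k + 2` to the registers after the one to which
register `1` points, if register `2` holds `1`. -/
def moveCode (k : ℕ) : List Instr :=
  (List.range k).flatMap fun i => [.add 1 1 2, .store 1 (i + 3)]

theorem moveCode_spec {t S : ℕ} {m : ℕ → ℕ} (ht : 1 ≤ t) (hS : 64 * t + 61 < S)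
    (h1 : m 1 = 64 * t) (h2 : m 2 = 1) {k : ℕ} (hk : k ≤ 61) :
    SafeCode S (moveCode k) m ∧ effects (moveCode k) m 1 = 64 * t + k ∧
    (∀ i, 1 ≤ i → i ≤ k → effects (moveCode k) m (64 * t + i) = m (i + 2)) ∧
    ∀ r, r ≠ 1 → (r ≤ 64 * t ∨ 64 * t + k < r) → effects (moveCode k) m r = m r := by
  induction k with
  | zero =>
    refine ⟨trivial, h1, fun i hi1 hi2 => by omega, fun r _ _ => rfl⟩
  | succ k ih =>
    obtain ⟨a1, a2, a3, a4⟩ := ih (by omega)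
    have hm : moveCode (k + 1) = moveCode k ++ [.add 1 1 2, .store 1 (k + 3)] := by
      simp [moveCode, List.range_succ]
    rw [hm, safeCode_append, effects_append]
    have b2 : effects (moveCode k) m 2 = 1 := by rw [a4 2 (by omega) (by omega), h2]
    have b3 : effects (moveCode k) m (k + 3) = m (k + 3) := a4 _ (by omega) (by omega)
    generalize effects (moveCode k) m = m' at a1 a2 a3 a4 b2 b3 ⊢
    have hv : ∀ r, effects [.add 1 1 2, .store 1 (k + 3)] m' r = if r = 64 * t + k + 1 then m (k + 3)
        else if r = 1 then 64 * t + k + 1 else m' r := by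
      intro r
      simp only [effects, Instr.effect, Instr.exec, Config.write, Function.update_apply, a2, b2, b3]
      have hk3 : ¬ k + 3 = 1 := by omega
      norm_num
      rw [if_neg hk3]
    refine ⟨⟨a1, ?_⟩, ?_, fun i hi1 hi2 => ?_, fun r hr1 hr2 => ?_⟩
    · simp only [SafeCode, Instr.straight, Instr.accessed, List.mem_cons, List.not_mem_nil, or_false,
        forall_eq_or_imp, forall_eq, true_and, and_true, Instr.effect, Instr.exec, Config.write,
        Function.update_self, a2, b2]
      omega
    · rw [hv, if_neg (by omega), if_pos rfl]; rfl
    · rw [hv]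
      by_cases h : i = k + 1
      · rw [if_pos (by omega), h]
      · rw [if_neg (by omega), if_neg (by omega), a3 i hi1 (by omega)]
    · rw [hv, if_neg (by omega), if_neg hr1, a4 r hr1 (by omega)]

/-- The code that moves the first symbols of the input behind the rest. -/
def saveCode : List Instr :=
  [.add 1 1 1, .add 1 1 1, .add 1 1 1, .add 1 1 1, .add 1 1 1, .add 1 1 1, .store 1 2, .const 2 1] ++
    moveCode 61 ++
    [.const 3 61, .sub 1 1 3, .half 1 1, .half 1 1, .half 1 1, .half 1 1, .half 1 1, .half 1 1]

/-- At the start every register below 64 may hold input. Doubling t in place six times makes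
register 1 a pointer to 64 t, beyond the input, and storing the first symbol there frees register 2
for the increment. Subtracting 61 and halving six times recovers t. -/
theorem saveCode_spec {t S : ℕ} {m : ℕ → ℕ} (ht : 1 ≤ t) (hS : 64 * t + 61 < S) (h1 : m 1 = t) :
    SafeCode S saveCode m ∧ effects saveCode m 0 = m 0 ∧ effects saveCode m 1 = t ∧
    (∀ i < 62, effects saveCode m (64 * t + i) = m (i + 2)) ∧
    ∀ r, 64 ≤ r → (r < 64 * t ∨ 64 * t + 61 < r) → effects saveCode m r = m r := by
  have hp : ∀ r, effects [.add 1 1 1, .add 1 1 1, .add 1 1 1, .add 1 1 1, .add 1 1 1, .add 1 1 1,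
      .store 1 2, .const 2 1] m r = if r = 2 then 1 else if r = 64 * t then m 2 else
      if r = 1 then 64 * t else m r := by
    intro r
    simp only [effects, Instr.effect, Instr.exec, Config.write, Function.update_apply, h1]
    norm_num
    have e' : ∀ x : ℕ, x = 32 * t → x + x = 64 * t := by omega
    rw [e' _ (by omega)]
    split_ifs <;> rfl
  have hsafe : SafeCode S [.add 1 1 1, .add 1 1 1, .add 1 1 1, .add 1 1 1, .add 1 1 1, .add 1 1 1,
      .store 1 2, .const 2 1] m := by
    simp only [SafeCode, Instr.straight, Instr.accessed, List.mem_cons, List.not_mem_nil, or_false,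
      forall_eq_or_imp, forall_eq, true_and, and_true, Instr.effect, Instr.exec, Config.write,
      Function.update_apply, h1]
    norm_num
    omega
  rw [saveCode]
  simp only [safeCode_append, effects_append]
  generalize effects _ m = m1 at hp ⊢
  obtain ⟨a1, a2, a3, a4⟩ := moveCode_spec (S := S) (m := m1) ht hS
    (by rw [hp, if_neg (by omega), if_neg (by omega), if_pos rfl]) (by rw [hp, if_pos rfl])
    (k := 61) le_rfl
  generalize effects (moveCode 61) m1 = m2 at a2 a3 a4 ⊢
  have hq : ∀ r, effects [.const 3 61, .sub 1 1 3, .half 1 1, .half 1 1, .half 1 1, .half 1 1,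
      .half 1 1, .half 1 1] m2 r = if r = 1 then t else if r = 3 then 61 else m2 r := by
    intro r
    simp only [effects, Instr.effect, Instr.exec, Config.write, Function.update_apply, a2]
    norm_num
    split_ifs <;> omega
  refine ⟨⟨⟨hsafe, a1⟩, ?_⟩, ?_, ?_, fun i hi => ?_, fun r hr hr' => ?_⟩
  · simp only [SafeCode, Instr.straight, Instr.accessed, List.mem_cons, List.not_mem_nil, or_false,
      forall_eq_or_imp, forall_eq, true_and, and_true]
    omega
  · rw [hq, if_neg (by omega), if_neg (by omega), a4 0 (by omega) (by omega), hp,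
      if_neg (by omega), if_neg (by omega), if_neg (by omega)]
  · rw [hq, if_pos rfl]
  · rw [hq, if_neg (by omega), if_neg (by omega)]
    rcases Nat.eq_zero_or_pos i with rfl | hi0
    · rw [a4 _ (by omega) (by omega), hp, if_neg (by omega), if_pos (by omega)]
    · rw [a3 i hi0 (by omega), hp, if_neg (by omega), if_neg (by omega), if_neg (by omega)]
  · rw [hq, if_neg (by omega), if_neg (by omega), a4 r (by omega) (by omega), hp, if_neg (by omega),
      if_neg (by omega), if_neg (by omega)]

/-- The code that copies registers from where register `63` points to the registers `0, …, k - 1`,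
if register `62` holds `1`. -/
def fetchCode (k : ℕ) : List Instr :=
  (List.range k).flatMap fun i => [.load i 63, .add 63 63 62]

theorem fetchCode_spec {a S : ℕ} {m : ℕ → ℕ} (ha : 64 ≤ a) (hS : a + 62 < S)
    (h1 : m 63 = a) (h2 : m 62 = 1) {k : ℕ} (hk : k ≤ 62) :
    SafeCode S (fetchCode k) m ∧ effects (fetchCode k) m 63 = a + k ∧
    (∀ i < k, effects (fetchCode k) m i = m (a + i)) ∧
    ∀ r, r ≠ 63 → k ≤ r → effects (fetchCode k) m r = m r := by
  induction k with
  | zero => exact ⟨trivial, h1, fun i hi => absurd hi (Nat.not_lt_zero _), fun r _ _ => rfl⟩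
  | succ k ih =>
    obtain ⟨a1, a2, a3, a4⟩ := ih (by omega)
    have hm : fetchCode (k + 1) = fetchCode k ++ [.load k 63, .add 63 63 62] := by
      simp [fetchCode, List.range_succ]
    rw [hm, safeCode_append, effects_append]
    have b2 : effects (fetchCode k) m 62 = 1 := by rw [a4 62 (by omega) (by omega), h2]
    have b3 : effects (fetchCode k) m (a + k) = m (a + k) := a4 _ (by omega) (by omega)
    generalize effects (fetchCode k) m = m' at a1 a2 a3 a4 b2 b3 ⊢
    have hv : ∀ r, effects [.load k 63, .add 63 63 62] m' r = if r = 63 then a + k + 1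
        else if r = k then m (a + k) else m' r := by
      intro r
      simp only [effects, Instr.effect, Instr.exec, Config.write, Function.update_apply, a2, b3]
      rw [if_neg (by omega : 63 ≠ k), if_neg (by omega : 62 ≠ k), b2]
    refine ⟨⟨a1, ?_⟩, ?_, fun i hi => ?_, fun r hr1 hr2 => ?_⟩
    · simp only [SafeCode, Instr.straight, Instr.accessed, List.mem_cons, List.not_mem_nil, or_false,
        forall_eq_or_imp, forall_eq, true_and, and_true, a2]
      omega
    · rw [hv, if_pos rfl]; rfl
    · rw [hv, if_neg (by omega)]
      by_cases h : i = k
      · rw [if_pos h, h]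
      · rw [if_neg h, a3 i (by omega)]
    · rw [hv, if_neg hr1, if_neg (by omega), a4 r hr1 (by omega)]

/-- The code that moves the output to its place. -/
def restoreCode : List Instr :=
  [.const 62 1, .const 63 64, .add 63 63 1] ++ fetchCode 62 ++
    [.add 63 63 62, .sub 62 63 62, .load 62 62, .load 63 63]

/-- Registers 62 and 63 serve as increment and pointer until the end; each is then set to the
address of its own final value and loads it. -/
theorem restoreCode_spec {t S : ℕ} {m : ℕ → ℕ} (hS : t + 127 < S) (h1 : m 1 = t) :
    SafeCode S restoreCode m ∧ (∀ i < 64, effects restoreCode m i = m (64 + t + i)) ∧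
    ∀ r, 64 ≤ r → effects restoreCode m r = m r := by
  have hp : ∀ r, effects [.const 62 1, .const 63 64, .add 63 63 1] m r
      = if r = 63 then 64 + t else if r = 62 then 1 else m r := by
    intro r
    simp only [effects, Instr.effect, Instr.exec, Config.write, Function.update_apply]
    norm_num
    rw [h1]
    split_ifs <;> rfl
  have hsafe : SafeCode S [.const 62 1, .const 63 64, .add 63 63 1] m := by
    simp only [SafeCode, Instr.straight, Instr.accessed, List.mem_cons, List.not_mem_nil, or_false,
      forall_eq_or_imp, forall_eq, true_and, and_true]
    omega
  rw [restoreCode]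
  simp only [safeCode_append, effects_append]
  generalize effects _ m = m1 at hp ⊢
  obtain ⟨a1, a2, a3, a4⟩ := fetchCode_spec (a := 64 + t) (S := S) (m := m1) (by omega) (by omega)
    (by rw [hp, if_pos rfl]) (by rw [hp, if_neg (by omega), if_pos rfl]) (k := 62) le_rfl
  have b62 : effects (fetchCode 62) m1 62 = 1 := by
    rw [a4 62 (by omega) (by omega), hp, if_neg (by omega), if_pos rfl]
  have bhi : ∀ r, 64 ≤ r → effects (fetchCode 62) m1 r = m r := fun r hr => by
    rw [a4 r (by omega) (by omega), hp, if_neg (by omega), if_neg (by omega)]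
  generalize effects (fetchCode 62) m1 = m2 at a2 a3 a4 b62 bhi ⊢
  have hq : ∀ r, effects [.add 63 63 62, .sub 62 63 62, .load 62 62, .load 63 63] m2 r
      = if r = 63 then m (64 + t + 63) else if r = 62 then m (64 + t + 62) else m2 r := by
    intro r
    simp only [effects, Instr.effect, Instr.exec, Config.write, Function.update_apply, a2, b62]
    norm_num
    have n1 : ¬ 64 + t + 62 + 1 = 62 := by omega
    have n2 : ¬ 64 + t + 62 + 1 = 63 := by omega
    have n3 : ¬ 64 + t + 62 = 63 := by omega
    rw [if_neg n1, if_neg n1, if_neg n2, if_neg n3, bhi (64 + t + 62) (by omega),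
      bhi (64 + t + 62 + 1) (by omega)]
    split_ifs <;> rfl
  refine ⟨⟨⟨hsafe, a1⟩, ?_⟩, fun i hi => ?_, fun r hr => ?_⟩
  · simp only [SafeCode, Instr.straight, Instr.accessed, List.mem_cons, List.not_mem_nil, or_false,
      forall_eq_or_imp, forall_eq, true_and, and_true, Instr.effect, Instr.exec, Config.write,
      Function.update_apply, a2, b62]
    norm_num
    omega
  · rw [hq]
    by_cases h63 : i = 63
    · rw [if_pos h63, h63]
    · rw [if_neg h63]
      by_cases h62 : i = 62
      · rw [if_pos h62, h62]
      · rw [if_neg h62, a3 i (by omega), hp, if_neg (by omega), if_neg (by omega)]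
  · rw [hq, if_neg (by omega), if_neg (by omega), bhi r hr]

end SubsetCycle

namespace SubsetCycle

/-! ### The programs -/

/-- The code for ranking up to the structured part. -/
def rankCode : List Instr := saveCode ++ setupCode

def rankProgram : Program := rankCode ++ rankCmd.compile rankCode.length

/-- The code for unranking up to the structured part. -/
def unrankCode : List Instr := [.const 10 1, .sub 9 2 10] ++ setupCode

def unrankProgram : Program :=
  unrankCode ++ powCmd.compile unrankCode.length ++
    unrankCmd.compile (unrankCode.length + powCmd.size) ++ restoreCode

theorem comp_map_add_one {t M : ℕ} (e : ℕ → ℕ) :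
    comp (M + 1) (pre (fun i => e i + 1) t) = word t M e := by
  simp only [comp, word, pre, List.map_map]
  refine List.map_congr_left fun i _ => ?_
  simp only [Function.comp_apply]
  omega

theorem pre_getD {d : List ℕ} : pre (fun i => d.getD i 0) d.length = d := by
  refine List.ext_getElem (by simp [pre]) fun i h1 h2 => ?_
  simp [pre, h2]

theorem rank_computes {n t : ℕ} (ht : 1 ≤ t) (htn : t ≤ n) {d : List ℕ} (hd : IsDiffString n t d) :
    ∃ r T : ℕ, HasRank (grandDown (n - t + 1) t n) d r ∧
      Computes rankProgram (n :: t :: d) [r] T (space n t) ∧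
      T ≤ (rankCode.length + rankCmd.cost fun _ => 2) * (n ^ 2 * t ^ 3) := by
  have hlen : d.length = t := hd.1
  obtain ⟨hd1, hd2⟩ := (mem_heavy_iff_comp ht htn).1 hd
  have hwS := width_le_space n t
  have hwd : width n t = 64 * t + n + 64 := rfl
  set m : ℕ → ℕ := fun a => (n :: t :: d).getD a 0 with hm
  have hm2 : ∀ i, m (i + 2) = d.getD i 0 := fun i => rfl
  obtain ⟨a1, a2, a3, a4, a5⟩ := saveCode_spec (S := space n t) (m := m) ht (by omega) rfl
  obtain ⟨b1, b2, b3, b4, -, b6⟩ := setupCode_spec (n := n) (t := t) (S := space n t)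
    (m := effects saveCode m) (by omega) (by rw [a2]; rfl) a3
  have hsafe : SafeCode (space n t) rankCode m := safeCode_append.2 ⟨a1, b1⟩
  rw [← effects_append] at b2 b3 b4
  have b6' : ∀ r, 64 ≤ r → effects rankCode m r = effects saveCode m r := fun r hr => by
    rw [rankCode, effects_append, b6 r hr]
  change Rel _ _ (memState _ _ (effects rankCode m)) (effects rankCode m) at b2
  change Params _ _ _ _ (memState _ _ (effects rankCode m)) at b3
  generalize hm1 : effects rankCode m = m1 at b2 b3 b6'
  have hrun1 := run_straight (P := rankProgram) (p := 0) (l := rankCode) (m := m)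
    (by simpa [rankProgram] using codeAt_append [] rankCode (rankCmd.compile rankCode.length)) hsafe
  rw [Nat.zero_add, hm1] at hrun1
  obtain ⟨T, m2, hrun2, hR, hT⟩ := rankCmd.run (S := space n t) rfl (P := rankProgram)
    (memState t (width n t) m1).v (p := rankCode.length) (s := memState t (width n t) m1) (m := m1)
    (by simpa [rankProgram] using codeAt_append rankCode (rankCmd.compile rankCode.length) []) b2 (by decide)
    (fun y hy => ⟨rfl, by revert y; decide⟩)
  -- The deepest nest of loops is that of the count, over start state, length, state, weight and
  -- letter: three bounds of order t and two of order n. There is no binary search, so the third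
  -- base is 1.
  have hcost : rankCmd.cost (memState t (width n t) m1).v
      ≤ rankCmd.cost (fun _ => 2) * (t ^ 3 * n ^ 2 * 1 ^ 0) := by
    refine rankCmd.cost_le_pow ht (ht.trans htn) le_rfl (fun y hy => ?_) (by decide) (by decide)
      (by decide)
    have hy' : y = 1 ∨ y = 2 ∨ y = 4 := by revert y; decide
    rcases hy' with rfl | rfl | rfl
    · rw [b3.v1]; simp [degT, degN, degL]; omega
    · rw [b3.v2]; simp [degT, degN, degL]; omega
    · rw [b3.v4]; simp [degT, degN, degL]; omega
  have hword : word t (n - t) (fun i => d.getD i 0 - 1) = comp (n - t + 1) d := by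
    have hpre : pre (fun i => d.getD i 0 - 1 + 1) t = pre (fun i => d.getD i 0) d.length := by
      rw [hlen]
      refine pre_congr fun i hi => ?_
      have : 1 ≤ d.getD i 0 := by
        rw [List.getD_eq_getElem _ _ (by omega)]
        exact (hd1 _ (List.getElem_mem _)).1
      omega
    rw [← comp_map_add_one, hpre, pre_getD]
  have hspec := rankCmd_spec b3 (by omega) ht (d := fun i => d.getD i 0) (fun i hi => by
    change (if i < 62 then m1 (addr _ _ 0 0 _) else m1 (addr _ _ 0 0 _)) = _
    rw [addr_zero, addr_zero, b6' _ (by omega), b6' _ (by omega)]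
    by_cases h62 : i < 62
    · rw [if_pos h62, show 64 + (64 * (t - 1) + i) = 64 * t + i by omega, a4 i h62, hm2]
    · rw [if_neg h62, show 64 + (i - 62) = i + 2 by omega, a5 _ (by omega) (by omega), hm2])
    (by rw [hword]; exact hd2)
  rw [hword] at hspec
  refine ⟨(rankCmd.exec t (width n t) (memState t (width n t) m1)).v 0, rankCode.length + T,
    (hasRank_iff ht htn hd).2 hspec, ⟨?_, ?_, ⟨rankCode.length + rankCmd.size, m2⟩,
    hrun1.trans hrun2, ?_, ?_⟩, ?_⟩
  · simp only [List.length_cons]; omega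
  · simp only [List.length_cons, List.length_nil]; omega
  · rw [rankProgram, List.getElem?_eq_none]
    rw [List.length_append, Cmd.length_compile]
  · simp [List.range_succ, hR.vars 0 (by omega)]
  · have h1 : 1 ≤ n ^ 2 * t ^ 3 := Nat.mul_pos (Nat.pow_pos (by omega)) (Nat.pow_pos ht)
    rw [Nat.add_mul]
    refine Nat.add_le_add (Nat.le_mul_of_pos_right _ h1) ((hT.trans hcost).trans (le_of_eq ?_))
    ring

/-- From L log 2 ≤ log 2 + log (n + 1) and log 2 ≤ log (n + 1) one gets L + 1 ≤ 3 log (n + 1) / log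
2, and 3 / log 2 < 6. -/
theorem log_bound {n L : ℕ} (hn : 1 ≤ n) (hL : 2 ^ L ≤ 2 * n + 1) :
    ((L + 1 : ℕ) : ℝ) ≤ 6 * Real.log ((n : ℝ) + 1) ∧ 1 ≤ 6 * Real.log ((n : ℝ) + 1) := by
  have h2 : (0.6931471803 : ℝ) < Real.log 2 := Real.log_two_gt_d9
  have hn' : (1 : ℝ) ≤ n := by exact_mod_cast hn
  have h3 : Real.log 2 ≤ Real.log ((n : ℝ) + 1) := Real.log_le_log (by norm_num) (by linarith)
  have h4 : (L : ℝ) * Real.log 2 ≤ Real.log 2 + Real.log ((n : ℝ) + 1) := by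
    rw [← Real.log_pow, ← Real.log_mul (by norm_num) (by positivity)]
    refine Real.log_le_log (by positivity) ?_
    have : (2 : ℝ) ^ L ≤ 2 * n + 1 := by exact_mod_cast hL
    linarith
  refine ⟨?_, by linarith⟩
  push_cast
  nlinarith

theorem unrank_computes {n t r : ℕ} (ht : 1 ≤ t) (htn : t ≤ n) (hr1 : 1 ≤ r)
    (hr : r ≤ n.choose t) : ∃ d, IsDiffString n t d ∧ ∃ T : ℕ,
      HasRank (grandDown (n - t + 1) t n) d r ∧
      Computes unrankProgram [n, t, r] d T (space n t) ∧
      ∃ L, 2 ^ L ≤ 2 * n + 1 ∧ T ≤ (unrankCode.length + powCmd.cost (fun _ => 2)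
        + unrankCmd.cost (fun _ => 2) + restoreCode.length) * (n ^ 2 * t ^ 4 * (L + 1)) := by
  have hwS := width_le_space n t
  have hwd : width n t = 64 * t + n + 64 := rfl
  have hn1 := ht.trans htn
  set m : ℕ → ℕ := fun a => [n, t, r].getD a 0 with hm
  have hpre : ∀ x, effects [.const 10 1, .sub 9 2 10] m x = if x = 9 then r - 1 else
      if x = 10 then 1 else m x := by
    intro x
    simp [effects, Instr.effect, Instr.exec, Config.write, Function.update_apply, hm]
  have hpre' : SafeCode (space n t) [.const 10 1, .sub 9 2 10] m := by
    simp only [SafeCode, Instr.straight, Instr.accessed, List.mem_cons, List.not_mem_nil, or_false,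
      forall_eq_or_imp, forall_eq, true_and, and_true]
    omega
  obtain ⟨b1, b2, b3, b4, b5, -⟩ := setupCode_spec (n := n) (t := t) (S := space n t)
    (m := effects [.const 10 1, .sub 9 2 10] m) (by omega) (by rw [hpre]; rfl) (by rw [hpre]; rfl)
  have hsafe : SafeCode (space n t) unrankCode m := safeCode_append.2 ⟨hpre', b1⟩
  rw [hpre, if_pos rfl] at b5
  rw [← effects_append] at b2 b3 b4 b5
  change Rel _ _ (memState _ _ (effects unrankCode m)) (effects unrankCode m) at b2
  change Params _ _ _ _ (memState _ _ (effects unrankCode m)) at b3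
  change effects unrankCode m 0 = n at b4
  change effects unrankCode m 9 = r - 1 at b5
  generalize hm1 : effects unrankCode m = m1 at b2 b3 b4 b5
  have hrun1 := run_straight (P := unrankProgram) (p := 0) (l := unrankCode) (m := m)
    (by
      have := codeAt_append [] unrankCode (powCmd.compile unrankCode.length ++
        (unrankCmd.compile (unrankCode.length + powCmd.size) ++ restoreCode))
      simpa [unrankProgram] using this) hsafe
  rw [Nat.zero_add, hm1] at hrun1
  obtain ⟨T2, m2, hrun2, hR2, hT2⟩ := powCmd.run (S := space n t) rfl (P := unrankProgram)
    (memState t (width n t) m1).v (p := unrankCode.length) (s := memState t (width n t) m1) (m := m1)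
    (by
      have := codeAt_append unrankCode (powCmd.compile unrankCode.length)
        (unrankCmd.compile (unrankCode.length + powCmd.size) ++ restoreCode)
      simpa [unrankProgram] using this) b2 (by decide)
    (fun y hy => ⟨rfl, by revert y; decide⟩)
  obtain ⟨c1, c2, c3⟩ := powCmd_spec (h := t) (w := width n t) b3.v3
    (show n - t ≤ (memState t (width n t) m1).v 0 from b4.symm ▸ Nat.sub_le n t)
  have b3' := b3.agree (powCmd.agree_exec t (width n t) _) (by decide)
  have c9 : (powCmd.exec t (width n t) (memState t (width n t) m1)).v 9 = r - 1 := by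
    rw [Cmd.exec_v _ _ _ _ (by decide)]; exact b5
  have hcost2 : powCmd.cost (memState t (width n t) m1).v
      ≤ powCmd.cost (fun _ => 2) * (t ^ 0 * n ^ 1 * 1 ^ 0) := by
    refine powCmd.cost_le_pow ht hn1 le_rfl (fun y hy => ?_) (by decide) (by decide) (by decide)
    have hy' : y = 0 := by revert y; decide
    subst hy'
    rw [show (memState t (width n t) m1).v 0 = n from b4]
    simp [degT, degN, degL]; omega
  generalize powCmd.exec t (width n t) (memState t (width n t) m1) = s2 at hR2 c1 c2 c3 b3' c9
  obtain ⟨T3, m3, hrun3, hR3, hT3⟩ := unrankCmd.run (S := space n t) rfl (P := unrankProgram)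
    s2.v (p := unrankCode.length + powCmd.size) (s := s2) (m := m2)
    (by
      have := codeAt_append (unrankCode ++ powCmd.compile unrankCode.length)
        (unrankCmd.compile (unrankCode.length + powCmd.size)) restoreCode
      rwa [List.length_append, Cmd.length_compile] at this) hR2 (by decide)
    (fun y hy => ⟨rfl, by revert y; decide⟩)
  have hlenU := length_grandUp_eq_choose ht htn
  obtain ⟨e, he1, he2⟩ := unrankCmd_spec b3' (by omega) ht rfl c1 c3 c9 (by rw [hlenU]; omega)
  -- The search for each of the t letters repeats the count once for every halving. The base is the
  -- number of halvings plus 1, because that number is 0 for M = 0 and the bases must be positive.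
  have hcost3 : unrankCmd.cost s2.v
      ≤ unrankCmd.cost (fun _ => 2) * (t ^ 4 * n ^ 2 * (s2.v 5 + 1) ^ 1) := by
    refine unrankCmd.cost_le_pow ht hn1 (by omega) (fun y hy => ?_) (by decide) (by decide)
      (by decide)
    have hy' : y = 1 ∨ y = 2 ∨ y = 4 ∨ y = 5 := by revert y; decide
    rcases hy' with rfl | rfl | rfl | rfl
    · rw [b3'.v1]; simp [degT, degN, degL]; omega
    · rw [b3'.v2]; simp [degT, degN, degL]; omega
    · rw [b3'.v4]; simp [degT, degN, degL]; omega
    · simp [degT, degN, degL]; omega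
  have ht3 : m3 1 = t := by
    rw [hR3.vars 1 (by omega), Cmd.exec_v _ _ _ _ (by decide), b3'.v1]
  obtain ⟨d1, d2, d3⟩ := restoreCode_spec (S := space n t) (m := m3) (by omega) ht3
  have hrun4 := run_straight (P := unrankProgram) (p := unrankCode.length + powCmd.size + unrankCmd.size)
    (l := restoreCode) (m := m3) (by
      have := codeAt_append (unrankCode ++ powCmd.compile unrankCode.length ++
        unrankCmd.compile (unrankCode.length + powCmd.size)) restoreCode []
      rwa [List.append_nil, List.length_append, List.length_append, Cmd.length_compile,
        Cmd.length_compile] at this) d1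
  have hmem := (window_bijOn (k := n - t + 1) (by omega) ht).mapsTo
    (Finset.mem_coe.2 (Finset.mem_range.2 (show r - 1 < _ by rw [hlenU]; omega)))
  rw [he1] at hmem
  have hle := le_of_mem_heavy hmem
  have hd : IsDiffString n t (pre (fun i => e i + 1) t) := by
    rw [mem_heavy_iff_comp ht htn, comp_map_add_one]
    refine ⟨?_, hmem⟩
    simp only [pre, List.mem_map, List.mem_range]
    rintro a ⟨i, hi, rfl⟩
    have := hle i hi
    omega
  have hout : ∀ i < t, effects restoreCode m3 i = e i + 1 := by
    intro i hi
    rw [← he2 i hi]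
    by_cases h64 : i < 64
    · rw [if_pos h64, d2 i h64, ← hR3.arr 0 0 (t + i) (Nat.zero_le _) (by omega), addr_zero]
      congr 1; omega
    · rw [if_neg h64, d3 i (by omega), ← hR3.arr 0 0 (i - 64) (Nat.zero_le _) (by omega), addr_zero]
      congr 1; omega
  refine ⟨_, hd, unrankCode.length + (T2 + (T3 + restoreCode.length)), ?_, ⟨?_, ?_,
    ⟨unrankCode.length + powCmd.size + unrankCmd.size + restoreCode.length, effects restoreCode m3⟩,
    hrun1.trans (hrun2.trans (hrun3.trans hrun4)), ?_, ?_⟩, s2.v 5, by omega, ?_⟩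
  · rw [hasRank_iff ht htn hd, hlenU, comp_map_add_one]
    exact ⟨hr1, hr, he1⟩
  · simp only [List.length_cons, List.length_nil]; omega
  · rw [length_pre]; omega
  · rw [unrankProgram, List.getElem?_eq_none]
    simp only [List.length_append, Cmd.length_compile, le_refl]
  · rw [length_pre]
    exact pre_congr hout
  · have hL1 : 1 ≤ s2.v 5 + 1 := by omega
    generalize s2.v 5 + 1 = L at hcost3 hL1 ⊢
    have ht4 : 1 ≤ t ^ 4 := Nat.pow_pos ht
    have hX : n ≤ n ^ 2 * t ^ 4 * L := by
      calc n = n * 1 * 1 := by ring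
        _ ≤ n ^ 2 * t ^ 4 * L :=
          Nat.mul_le_mul (Nat.mul_le_mul (Nat.le_self_pow (by omega) n) ht4) hL1
    have h2 : T2 ≤ powCmd.cost (fun _ => 2) * (n ^ 2 * t ^ 4 * L) :=
      (hT2.trans hcost2).trans (Nat.mul_le_mul_left _ (by simpa using hX))
    have h3 : T3 ≤ unrankCmd.cost (fun _ => 2) * (n ^ 2 * t ^ 4 * L) :=
      (hT3.trans hcost3).trans (le_of_eq (by ring))
    generalize n ^ 2 * t ^ 4 * L = X at hX h2 h3 ⊢
    have h1 : unrankCode.length ≤ unrankCode.length * X := Nat.le_mul_of_pos_right _ (by omega)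
    have h4 : restoreCode.length ≤ restoreCode.length * X := Nat.le_mul_of_pos_right _ (by omega)
    simp only [Nat.add_mul]
    omega

end SubsetCycle

/-! ### The universal cycle and the two programs together. -/

theorem mainTheorem3 :
    (∀ n t : ℕ, 1 ≤ t → t ≤ n →
      SubsetCycle.IsUniversalCycle (SubsetCycle.grandDown (n - t + 1) t n)
        (SubsetCycle.tSubsets n t) SubsetCycle.diffRep) ∧
    (∃ (rankProg : SubsetCycle.Program) (C : ℕ), ∀ n t : ℕ, 1 ≤ t → t ≤ n →
      ∀ A ∈ SubsetCycle.tSubsets n t, ∃ r T S : ℕ,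
        SubsetCycle.HasRank (SubsetCycle.grandDown (n - t + 1) t n) (SubsetCycle.diffRep A) r ∧
        SubsetCycle.Computes rankProg (n :: t :: SubsetCycle.diffRep A) [r] T S ∧
        T ≤ C * (n ^ 2 * t ^ 3) ∧ S ≤ C * (n * t ^ 3)) ∧
    (∃ (unrankProg : SubsetCycle.Program) (C : ℕ), ∀ n t : ℕ, 1 ≤ t → t ≤ n →
      ∀ r : ℕ, 1 ≤ r → r ≤ n.choose t → ∃ A ∈ SubsetCycle.tSubsets n t, ∃ T S : ℕ,
        SubsetCycle.HasRank (SubsetCycle.grandDown (n - t + 1) t n) (SubsetCycle.diffRep A) r ∧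
        SubsetCycle.Computes unrankProg [n, t, r] (SubsetCycle.diffRep A) T S ∧
        (T : ℝ) ≤ C * ((n : ℝ) ^ 2 * (t : ℝ) ^ 4 * Real.log ((n : ℝ) + 1)) ∧
        S ≤ C * (n * t ^ 3)) := by
  refine ⟨fun n t ht htn => SubsetCycle.isUniversalCycle_grandDown ht htn,
    ⟨SubsetCycle.rankProgram, max (SubsetCycle.rankCode.length + SubsetCycle.rankCmd.cost fun _ => 2)
      2144, fun n t ht htn A hA => ?_⟩,
    ⟨SubsetCycle.unrankProgram, max (6 * (SubsetCycle.unrankCode.length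
      + SubsetCycle.powCmd.cost (fun _ => 2) + SubsetCycle.unrankCmd.cost (fun _ => 2)
      + SubsetCycle.restoreCode.length)) 2144, fun n t ht htn r hr1 hr => ?_⟩⟩
  · obtain ⟨r, T, h1, h2, h3⟩ :=
      SubsetCycle.rank_computes ht htn (SubsetCycle.isDiffString_diffRep hA)
    exact ⟨r, T, SubsetCycle.space n t, h1, h2,
      h3.trans (Nat.mul_le_mul_right _ (le_max_left _ _)),
      (SubsetCycle.space_le ht htn).trans (Nat.mul_le_mul_right _ (le_max_right _ _))⟩
  · obtain ⟨d, hd, T, h1, h2, L, hL, hT⟩ := SubsetCycle.unrank_computes ht htn hr1 hr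
    obtain ⟨A, hA, rfl⟩ := SubsetCycle.exists_diffRep_eq hd
    refine ⟨A, hA, T, SubsetCycle.space n t, h1, h2, ?_,
      (SubsetCycle.space_le ht htn).trans (Nat.mul_le_mul_right _ (le_max_right _ _))⟩
    generalize SubsetCycle.unrankCode.length + SubsetCycle.powCmd.cost (fun _ => 2)
      + SubsetCycle.unrankCmd.cost (fun _ => 2) + SubsetCycle.restoreCode.length = K at hT ⊢
    obtain ⟨h4, h5⟩ := SubsetCycle.log_bound (ht.trans htn) hL
    have hlog : 0 ≤ Real.log ((n : ℝ) + 1) := by linarith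
    calc (T : ℝ) ≤ ((K * (n ^ 2 * t ^ 4 * (L + 1)) : ℕ) : ℝ) := by exact_mod_cast hT
      _ = K * ((n : ℝ) ^ 2 * (t : ℝ) ^ 4) * ((L + 1 : ℕ) : ℝ) := by push_cast; ring
      _ ≤ K * ((n : ℝ) ^ 2 * (t : ℝ) ^ 4) * (6 * Real.log ((n : ℝ) + 1)) :=
        mul_le_mul_of_nonneg_left h4 (by positivity)
      _ = ((6 * K : ℕ) : ℝ) * ((n : ℝ) ^ 2 * (t : ℝ) ^ 4 * Real.log ((n : ℝ) + 1)) := by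
        push_cast; ring
      _ ≤ _ := mul_le_mul_of_nonneg_right (by exact_mod_cast le_max_left _ _) (by positivity)
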